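/- A stationary Bratteli diagram $B$ has one vertex at level $0$, a copy of one finite non-empty vertex set $V$ at each level $n\ge 1$, finitely many (and at least one) edges from the top vertex to each vertex of level $1$, and the same matrix $F$ of edge multiplicities between levels $n$ and $n+1$ for every $n\ge1$; every vertex emits an edge and every vertex below level $0$ receives one. Let $X_B$ be its space of infinite paths from the top vertex, with the topology induced from the product of the discrete edge sets, and let $\mathcal R$ be the tail equivalence relation on $X_B$ (two paths are equivalent if they agree from some level on). A Borel measure on $X_B$ is $\mathcal R$-invariant if every Borel automorphism of $X_B$ that moves points inside their $\mathcal R$-classes preserves it, and ergodic if every $\mathcal R$-saturated Borel set is null or has null complement. A minimal component is a minimal non-empty closed $\mathcal R$-saturated subset of $X_B$. Two systems $(X_B,\mathcal R)$, $(X_{B'},\mathcal R')$ are topologically orbit equivalent if some homeomorphism $h:X_B\to X_{B'}$ satisfies $x\,\mathcal R\,y\iff h(x)\,\mathcal R'\,h(y)$. A Borel measure $\mu$ on a space $X$ is called good infinite if it is positive on non-empty open sets, gives measure $0$ to points, $\mu(X)=\infty$, the set of points all of whose clopen neighbourhoods have infinite measure is $\mu$-null, and whenever $U,V\subset X$ are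 clopen with $\mu(U)<\mu(V)$ there is a clopen $W\subset V$ with $\mu(W)=\mu(U)$. Measures $\mu$ on $X$ and $\nu$ on $Y$ are homeomorphic if $h_*\mu=\nu$ for some homeomorphism $h:X\to Y$. **Theorem.** Let $\mu$ be an ergodic $\mathcal R$-invariant Borel measure on the path space $X_B$ of a stationary Bratteli diagram $B$ which is good infinite when it is regarded as a measure on its closed support. Then there exist stationary Bratteli diagrams $B_i$ and ergodic $\mathcal R_i$-invariant good infinite measures $\mu_i$ on $X_{B_i}$ (so each $\mu_i$ has full support), $i=1,2,3,\dots$, such that each $\mu_i$ is homeomorphic to $\mu$ (on its support), the systems $(X_{B_i},\mathcal R_i)$ and $(X_{B_j},\mathcal R_j)$ are topologically orbit equivalent if and only if $i=j$, and $X_{B_i}$ has exactly $i$ minimal components for the tail equivalence relation $\mathcal R_i$. -/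

import Mathlib

open MeasureTheory Set

/-! ### Measures on Cantor spaces -/

section CantorMeasures

variable {X : Type*} [TopologicalSpace X] [MeasurableSpace X]

/-- The defective set of a measure: the points all of whose clopen neighbourhoods have
infinite measure. -/
def defectiveSet (μ : Measure X) : Set X :=
  {x | ∀ U : Set X, IsClopen U → x ∈ U → μ U = ⊤}

/-- Non-defective measures: full, non-atomic, infinite Borel measures
which vanish on their defective set. -/
structure IsNonDefective (μ : Measure X) : Prop where
  full : ∀ U : Set X, IsOpen U → U.Nonempty → 0 < μ U
  nonatomic : ∀ x : X, μ {x} = 0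
  infinite : μ univ = ⊤
  defective_null : μ (defectiveSet μ) = 0

/-- A clopen set `V` is good for `μ` if every clopen `U` with `μ U < μ V` has the measure of some
clopen subset of `V`. -/
def IsGoodClopen (μ : Measure X) (V : Set X) : Prop :=
  ∀ U : Set X, IsClopen U → μ U < μ V → ∃ W : Set X, IsClopen W ∧ W ⊆ V ∧ μ W = μ U

/-- Good non-defective (infinite) measures. -/
structure IsGoodInfiniteMeasure (μ : Measure X) : Prop where
  nonDefective : IsNonDefective μ
  good : ∀ V : Set X, IsClopen V → IsGoodClopen μ V

/-- A measure regarded as a measure on its (closed) topological support. -/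
noncomputable def onSupport (μ : Measure X) : Measure μ.support :=
  μ.comap Subtype.val

/-- Two measures are homeomorphic if some homeomorphism carries one to the other. -/
def HomeomorphicMeasures {Y : Type*} [TopologicalSpace Y] [MeasurableSpace Y]
    (μ : Measure X) (ν : Measure Y) : Prop :=
  ∃ h : X ≃ₜ Y, μ.map h = ν

end CantorMeasures

/-! ### Stationary Bratteli diagrams -/

/-- A stationary Bratteli diagram. Level `0` is a single vertex, every level `n ≥ 1` is a copy of
the finite set `Vertex`; `hat v` is the number of edges from the top vertex to the vertex `v` of
level `1`, and `F v w` is, for every `n ≥ 1`, the number of edges from the vertex `w` of level `n`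
to the vertex `v` of level `n + 1`. Every vertex emits an edge, and every vertex below level `0`
receives one. -/
structure StationaryBratteliDiagram where
  Vertex : Type
  [fintypeVertex : Fintype Vertex]
  [nonemptyVertex : Nonempty Vertex]
  hat : Vertex → ℕ
  F : Matrix Vertex Vertex ℕ
  hat_pos : ∀ v, 0 < hat v
  exists_in : ∀ v, ∃ w, 0 < F v w
  exists_out : ∀ w, ∃ v, 0 < F v w

attribute [instance] StationaryBratteliDiagram.fintypeVertex
  StationaryBratteliDiagram.nonemptyVertex

namespace StationaryBratteliDiagram

/-- The edges from level `0` to level `1`. -/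
structure FirstEdge (B : StationaryBratteliDiagram) where
  range : B.Vertex
  label : Fin (B.hat range)

/-- The edges from level `n` to level `n + 1`, for any fixed `n ≥ 1`. -/
structure Edge (B : StationaryBratteliDiagram) where
  source : B.Vertex
  range : B.Vertex
  label : Fin (B.F range source)

instance (B : StationaryBratteliDiagram) : TopologicalSpace B.FirstEdge := ⊥
instance (B : StationaryBratteliDiagram) : DiscreteTopology B.FirstEdge := ⟨rfl⟩
instance (B : StationaryBratteliDiagram) : TopologicalSpace B.Edge := ⊥
instance (B : StationaryBratteliDiagram) : DiscreteTopology B.Edge := ⟨rfl⟩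

/-- A sequence of edges, the first of them starting at the top vertex and the `n`-th entry of the
second component leading from level `n + 1` to level `n + 2`, is a path. -/
def IsPath (B : StationaryBratteliDiagram) (x : B.FirstEdge × (ℕ → B.Edge)) : Prop :=
  x.1.range = (x.2 0).source ∧ ∀ n, (x.2 n).range = (x.2 (n + 1)).source

/-- The space of infinite paths from the top vertex. -/
def PathSpace (B : StationaryBratteliDiagram) : Type :=
  {x : B.FirstEdge × (ℕ → B.Edge) // B.IsPath x}

/-- The path space carries the topology induced by the product of the discrete edge sets. -/
instance (B : StationaryBratteliDiagram) : TopologicalSpace B.PathSpace :=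
  inferInstanceAs (TopologicalSpace {x : B.FirstEdge × (ℕ → B.Edge) // B.IsPath x})

instance (B : StationaryBratteliDiagram) : MeasurableSpace B.PathSpace := borel _
instance (B : StationaryBratteliDiagram) : BorelSpace B.PathSpace := ⟨rfl⟩

/-- The tail (cofinal) equivalence relation: two paths agree from some level on. -/
def Tail (B : StationaryBratteliDiagram) (x y : B.PathSpace) : Prop :=
  ∃ N : ℕ, ∀ n, N ≤ n → x.1.2 n = y.1.2 n

/-- A set of paths is saturated if it is a union of tail equivalence classes. -/
def IsSaturated (B : StationaryBratteliDiagram) (E : Set B.PathSpace) : Prop :=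
  ∀ x y, B.Tail x y → x ∈ E → y ∈ E

/-- Invariance of a measure under the tail relation: it is preserved by every Borel automorphism
that moves points inside their tail classes. -/
def IsTailInvariant (B : StationaryBratteliDiagram) (μ : Measure B.PathSpace) : Prop :=
  ∀ f : B.PathSpace ≃ᵐ B.PathSpace, (∀ x, B.Tail x (f x)) → μ.map f = μ

/-- Ergodicity for the tail relation: saturated Borel sets are null or conull. -/
def IsTailErgodic (B : StationaryBratteliDiagram) (μ : Measure B.PathSpace) : Prop :=
  ∀ E : Set B.PathSpace, MeasurableSet E → B.IsSaturated E → μ E = 0 ∨ μ Eᶜ = 0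

/-- Minimal components: the minimal elements among the non-empty closed saturated sets. -/
def IsMinimalComponent (B : StationaryBratteliDiagram) (Z : Set B.PathSpace) : Prop :=
  Minimal (fun Z : Set B.PathSpace => Z.Nonempty ∧ IsClosed Z ∧ B.IsSaturated Z) Z

/-- Topological orbit equivalence of the tail relations of two diagrams. -/
def OrbitEquivalent (B C : StationaryBratteliDiagram) : Prop :=
  ∃ h : B.PathSpace ≃ₜ C.PathSpace, ∀ x y, B.Tail x y ↔ C.Tail (h x) (h y)

end StationaryBratteliDiagram

/-! An invariant measure $\mu$ gives the same mass to all cylinders ending in the same vertex of the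
same level. The zero and infinite masses at one level are determined by those at the next, so their
pattern is periodic, with some period $p$ (`IsTailInvariant.exists_period`). Let $U$ be the set of
vertices of positive finite mass at the levels with index divisible by $p$; it is non-empty, since
otherwise every point of the support would be defective (`exists_mass_ne`).

For each $i$ the diagram is telescoped by $p$ and restricted to $U$, and $i$ vertices are added,
each with $N$ loops and one edge to every vertex of $U$. Nothing returns from $U$ to the added
vertices. A path either ends up in $U$, where its tail codes a tail of a path of $B$, or stays
forever at one added vertex. Every closed saturated non-empty set contains all paths looping at some
added vertex, so there are exactly $i$ minimal components (`TowerData.isMinimalComponent_iff`).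
Their number is an invariant of orbit equivalence (`OrbitEquivalent.encard_eq`), which separates the
diagrams.

The measure on the new path space copies $\mu$ along the coding of tails. It is invariant because
splicing commutes with coding (`TowerData.isTailInvariant_towerMeasure`), and ergodic because
saturated sets pull back to saturated sets. With $N$ large, the added vertices have infinite mass
(`TowerData.IsAdapted.mass_inr`), while the paths looping forever are null. Hence the measure is
non-defective, and goodness of $\mu$ passes to it along the cylinders ending in $U$, with the same
finite values on clopen sets (`TowerData.IsAdapted.clopenValues_eq`).

A back-and-forth argument then yields a homeomorphism of the measures
(`homeomorphicMeasures_of_clopenValues`). Besides goodness and equal clopen values it needs that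
clopen sets of infinite measure split into two such sets (`IsTailInvariant.splitsInfinite`). This
holds because an infinite vertex must lead to an infinite vertex lying on two different cycles of
equal length: otherwise the masses below it would decay exponentially and sum to a finite number. -/

namespace StationaryBratteliDiagram

variable {B : StationaryBratteliDiagram}

/-! ### Cylinder sets of the path space -/

instance : Finite B.FirstEdge :=
  Finite.of_injective (fun e : B.FirstEdge => (⟨e.range, e.label⟩ : Σ v, Fin (B.hat v)))
    (by rintro ⟨r, l⟩ ⟨r', l'⟩ h; cases h; rfl)

instance : Finite B.Edge :=
  Finite.of_injective
    (fun e : B.Edge => (⟨e.source, e.range, e.label⟩ : Σ s, Σ r, Fin (B.F r s)))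
    (by rintro ⟨s, r, l⟩ ⟨s', r', l'⟩ h; cases h; rfl)

/-- The vertex of level `n + 1` on a path. -/
def vtx (x : B.PathSpace) (n : ℕ) : B.Vertex := (x.1.2 n).source

/-- The first edge and the `n` edges following it. -/
def pre (n : ℕ) (x : B.PathSpace) : B.FirstEdge × (Fin n → B.Edge) :=
  (x.1.1, fun k => x.1.2 k)

/-- The paths that agree with `x` up to level `n + 1`. -/
def cyl (x : B.PathSpace) (n : ℕ) : Set B.PathSpace :=
  {y | y.1.1 = x.1.1 ∧ ∀ k < n, y.1.2 k = x.1.2 k}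

theorem path_ext {x y : B.PathSpace} (h : x.1.1 = y.1.1) (h' : ∀ k, x.1.2 k = y.1.2 k) : x = y :=
  Subtype.ext (Prod.ext h (funext h'))

theorem pre_eq_iff {x y : B.PathSpace} {n : ℕ} : pre n y = pre n x ↔ y ∈ cyl x n := by
  simp only [pre, cyl, Prod.ext_iff, funext_iff, mem_ofPred_eq, Fin.forall_iff]

theorem cyl_eq_preimage (x : B.PathSpace) (n : ℕ) : cyl x n = pre n ⁻¹' {pre n x} := by
  ext y; simp [pre_eq_iff]

theorem mem_cyl_self (x : B.PathSpace) (n : ℕ) : x ∈ cyl x n := ⟨rfl, fun _ _ => rfl⟩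

theorem cyl_eq_of_mem {x y : B.PathSpace} {n : ℕ} (h : y ∈ cyl x n) : cyl y n = cyl x n := by
  rw [cyl_eq_preimage, cyl_eq_preimage, pre_eq_iff.2 h]

theorem mem_cyl_symm {x y : B.PathSpace} {n : ℕ} (h : y ∈ cyl x n) : x ∈ cyl y n := by
  rw [cyl_eq_of_mem h]; exact mem_cyl_self x n

theorem cyl_anti (x : B.PathSpace) {m n : ℕ} (h : m ≤ n) : cyl x n ⊆ cyl x m :=
  fun _ hy => ⟨hy.1, fun k hk => hy.2 k (hk.trans_le h)⟩

theorem cyl_subset_of_mem {x y : B.PathSpace} {m n : ℕ} (h : y ∈ cyl x m) (hmn : m ≤ n) :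
    cyl y n ⊆ cyl x m := (cyl_anti y hmn).trans (cyl_eq_of_mem h).subset

theorem disjoint_cyl {x y : B.PathSpace} {n : ℕ} (h : y ∉ cyl x n) :
    Disjoint (cyl x n) (cyl y n) := by
  rw [Set.disjoint_left]
  intro z hz hz'
  exact h (by rw [← cyl_eq_of_mem hz]; exact mem_cyl_symm hz')

theorem vtx_zero (x : B.PathSpace) : vtx x 0 = x.1.1.range := x.2.1.symm

theorem vtx_succ (x : B.PathSpace) (n : ℕ) : vtx x (n + 1) = (x.1.2 n).range := (x.2.2 n).symm

theorem vtx_eq_of_mem {x y : B.PathSpace} {n : ℕ} (h : y ∈ cyl x n) : vtx y n = vtx x n := by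
  cases n with
  | zero => rw [vtx_zero, vtx_zero, h.1]
  | succ n => rw [vtx_succ, vtx_succ, h.2 n n.lt_succ_self]

theorem vtx_eq_of_mem_of_le {x y : B.PathSpace} {k n : ℕ} (h : y ∈ cyl x n) (hk : k ≤ n) :
    vtx y k = vtx x k := vtx_eq_of_mem (cyl_anti x hk h)

theorem edge_pos (e : B.Edge) : 0 < B.F e.range e.source := e.label.pos

theorem continuous_fst : Continuous fun x : B.PathSpace => x.1.1 :=
  _root_.continuous_fst.comp continuous_subtype_val

theorem continuous_edge (k : ℕ) : Continuous fun x : B.PathSpace => x.1.2 k :=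
  (continuous_apply k).comp (_root_.continuous_snd.comp continuous_subtype_val)

theorem continuous_pre (n : ℕ) : Continuous (pre n : B.PathSpace → _) :=
  continuous_fst.prodMk (continuous_pi fun k => continuous_edge k)

theorem isClopen_pre (n : ℕ) (T : Set (B.FirstEdge × (Fin n → B.Edge))) :
    IsClopen (pre n ⁻¹' T) := (isClopen_discrete T).preimage (continuous_pre n)

theorem isClopen_cyl (x : B.PathSpace) (n : ℕ) : IsClopen (cyl x n) := by
  rw [cyl_eq_preimage]; exact isClopen_pre n _

theorem measurableSet_cyl (x : B.PathSpace) (n : ℕ) : MeasurableSet (cyl x n) :=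
  (isClopen_cyl x n).isOpen.measurableSet

theorem isClopen_of_cyl (n : ℕ) {A : Set B.PathSpace} (h : ∀ x ∈ A, cyl x n ⊆ A) :
    IsClopen A := by
  have : A = pre n ⁻¹' (pre n '' A) := by
    refine (subset_preimage_image _ _).antisymm ?_
    rintro x ⟨y, hy, hxy⟩
    exact h y hy (pre_eq_iff.1 hxy.symm)
  rw [this]; exact isClopen_pre n _

theorem isClopen_vtx (n : ℕ) (T : Set B.Vertex) : IsClopen {x : B.PathSpace | vtx x n ∈ T} :=
  isClopen_of_cyl n fun x hx y hy => by
    rw [mem_ofPred_eq, vtx_eq_of_mem hy]; exact hx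

instance : T2Space B.PathSpace :=
  inferInstanceAs (T2Space {x : B.FirstEdge × (ℕ → B.Edge) // B.IsPath x})

instance : TotallyDisconnectedSpace B.PathSpace :=
  inferInstanceAs (TotallyDisconnectedSpace {x : B.FirstEdge × (ℕ → B.Edge) // B.IsPath x})

instance : SecondCountableTopology B.FirstEdge :=
  DiscreteTopology.secondCountableTopology_of_countable

instance : SecondCountableTopology B.Edge :=
  DiscreteTopology.secondCountableTopology_of_countable

instance : SecondCountableTopology B.PathSpace :=
  (Topology.IsInducing.mk rfl : Topology.IsInducing
    fun x : B.PathSpace => (x.1 : B.FirstEdge × (ℕ → B.Edge))).secondCountableTopology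

instance : CompactSpace B.PathSpace := by
  have h : IsClosed {x : B.FirstEdge × (ℕ → B.Edge) | B.IsPath x} := by
    have h1 : IsClosed {x : B.FirstEdge × (ℕ → B.Edge) | x.1.range = (x.2 0).source} :=
      (isClosed_discrete {e : B.FirstEdge × B.Edge | e.1.range = e.2.source}).preimage
        (f := fun x : B.FirstEdge × (ℕ → B.Edge) => (x.1, x.2 0)) (by fun_prop)
    have h2 : ∀ n, IsClosed
        {x : B.FirstEdge × (ℕ → B.Edge) | (x.2 n).range = (x.2 (n + 1)).source} := fun n =>
      (isClosed_discrete {e : B.Edge × B.Edge | e.1.range = e.2.source}).preimage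
        (f := fun x : B.FirstEdge × (ℕ → B.Edge) => (x.2 n, x.2 (n + 1))) (by fun_prop)
    have := h1.inter (isClosed_iInter h2)
    convert this using 1
    ext x; simp [IsPath]
  exact isCompact_iff_compactSpace.1 h.isCompact

theorem iInter_cyl (x : B.PathSpace) : ⋂ n, cyl x n = {x} := by
  ext y
  simp only [mem_iInter, mem_singleton_iff]
  refine ⟨fun h => path_ext (h 0).1 fun k => (h (k + 1)).2 k k.lt_succ_self, ?_⟩
  rintro rfl n
  exact mem_cyl_self y n

theorem exists_cyl_subset {x : B.PathSpace} {s : Set B.PathSpace} (hs : s ∈ nhds x) :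
    ∃ n, cyl x n ⊆ s :=
  exists_subset_nhds_of_compactSpace
    (fun m n => ⟨max m n, cyl_anti x (le_max_left m n), cyl_anti x (le_max_right m n)⟩)
    (fun n => (isClopen_cyl x n).1) (fun y hy => by
      rw [iInter_cyl] at hy; rwa [mem_singleton_iff.1 hy])

theorem cyl_mem_nhds (x : B.PathSpace) (n : ℕ) : cyl x n ∈ nhds x :=
  (isClopen_cyl x n).isOpen.mem_nhds (mem_cyl_self x n)

theorem exists_level_of_isClopen {A : Set B.PathSpace} (hA : IsClopen A) :
    ∃ N, ∀ n, N ≤ n → ∀ x ∈ A, cyl x n ⊆ A := by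
  choose! n hn using fun x (hx : x ∈ A) => exists_cyl_subset (hA.isOpen.mem_nhds hx)
  obtain ⟨t, ht, hAt⟩ := hA.1.isCompact.elim_nhds_subcover (fun x => cyl x (n x))
    fun x _ => cyl_mem_nhds x _
  refine ⟨t.sup n, fun N hN x hx => ?_⟩
  obtain ⟨y, hy, hxy⟩ := mem_iUnion₂.1 (hAt hx)
  exact (cyl_subset_of_mem hxy ((Finset.le_sup hy).trans hN)).trans (hn y (ht y hy))

/-- A clopen set is a finite union of cylinders of any sufficiently large length. -/
theorem exists_finset_cyl {A : Set B.PathSpace} {n : ℕ} (hA : ∀ x ∈ A, cyl x n ⊆ A) :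
    ∃ t : Finset B.PathSpace, (∀ x ∈ t, x ∈ A) ∧ A = ⋃ x ∈ t, cyl x n := by
  have hc : IsClopen A := isClopen_of_cyl n hA
  obtain ⟨t, ht, hAt⟩ := hc.1.isCompact.elim_nhds_subcover (fun x => cyl x n)
    fun x _ => cyl_mem_nhds x _
  exact ⟨t, ht, hAt.antisymm (iUnion₂_subset fun x hx => hA x (ht x hx))⟩

theorem continuousOn_of_cyl {C : StationaryBratteliDiagram} {f : B.PathSpace → C.PathSpace}
    {s : Set B.PathSpace}
    (h : ∀ x ∈ s, ∀ n, ∃ k, ∀ y ∈ s, y ∈ cyl x k → f y ∈ cyl (f x) n) : ContinuousOn f s := by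
  intro x hx t ht
  obtain ⟨n, hn⟩ := exists_cyl_subset ht
  obtain ⟨k, hk⟩ := h x hx n
  rw [Filter.mem_map]
  exact Filter.mem_of_superset (inter_mem_nhdsWithin s (cyl_mem_nhds x k))
    fun y hy => hn (hk y hy.1 hy.2)

/-! ### Extending and splicing paths -/

theorem exists_edge_from (v : B.Vertex) : ∃ e : B.Edge, e.source = v :=
  let ⟨w, hw⟩ := B.exists_out v
  ⟨⟨v, w, ⟨0, hw⟩⟩, rfl⟩

/-- A chosen edge leaving the given vertex. -/
noncomputable def outEdge (v : B.Vertex) : B.Edge := (exists_edge_from v).choose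

theorem outEdge_source (v : B.Vertex) : (outEdge v).source = v := (exists_edge_from v).choose_spec

/-- The chosen walk that starts with the given edge. -/
noncomputable def walk (e : B.Edge) : ℕ → B.Edge
  | 0 => e
  | k + 1 => outEdge (walk e k).range

/-- The path that agrees with `x` up to level `n + 1` and with `y` from then on. -/
def spliceOfEq (n : ℕ) (x y : B.PathSpace) (h : vtx x n = vtx y n) : B.PathSpace :=
  ⟨(x.1.1, fun k => if k < n then x.1.2 k else y.1.2 k), by
    constructor
    · rcases Nat.eq_zero_or_pos n with rfl | hn
      · simpa [vtx] using (vtx_zero x).symm.trans h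
      · simpa [hn] using x.2.1
    · intro k
      rcases lt_trichotomy (k + 1) n with hk | hk | hk
      · simpa [hk, (Nat.lt_succ_self k).trans hk] using x.2.2 k
      · subst hk
        simpa [vtx] using (vtx_succ x k).symm.trans h
      · simpa [show ¬ k < n by omega, show ¬ k + 1 < n by omega] using y.2.2 k⟩

open Classical in
/-- The path that agrees with `x` up to level `n + 1` and with `y` from then on, if there is
such a path, and otherwise `x`. -/
noncomputable def splice (n : ℕ) (x y : B.PathSpace) : B.PathSpace :=
  if h : vtx x n = vtx y n then spliceOfEq n x y h else x

theorem splice_of_eq {n : ℕ} {x y : B.PathSpace} (h : vtx x n = vtx y n) :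
    splice n x y = spliceOfEq n x y h := dif_pos h

theorem splice_of_ne {n : ℕ} {x y : B.PathSpace} (h : vtx x n ≠ vtx y n) :
    splice n x y = x := dif_neg h

theorem splice_fst {n : ℕ} {x y : B.PathSpace} : (splice n x y).1.1 = x.1.1 := by
  by_cases h : vtx x n = vtx y n
  · rw [splice_of_eq h]; rfl
  · rw [splice_of_ne h]

theorem splice_of_lt {n k : ℕ} {x y : B.PathSpace} (hk : k < n) :
    (splice n x y).1.2 k = x.1.2 k := by
  by_cases h : vtx x n = vtx y n
  · rw [splice_of_eq h]; exact if_pos hk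
  · rw [splice_of_ne h]

theorem splice_of_le {n k : ℕ} {x y : B.PathSpace} (h : vtx x n = vtx y n) (hk : n ≤ k) :
    (splice n x y).1.2 k = y.1.2 k := by
  rw [splice_of_eq h]; exact if_neg hk.not_gt

theorem splice_mem_cyl (n : ℕ) (x y : B.PathSpace) : splice n x y ∈ cyl x n :=
  ⟨splice_fst, fun _ hk => splice_of_lt hk⟩

theorem splice_tail {n : ℕ} {x y : B.PathSpace} (h : vtx x n = vtx y n) :
    B.Tail y (splice n x y) := ⟨n, fun _ hk => (splice_of_le h hk).symm⟩

theorem eq_splice {n : ℕ} {x y z : B.PathSpace} (hz : z ∈ cyl x n)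
    (h : ∀ k, n ≤ k → z.1.2 k = y.1.2 k) : z = splice n x y := by
  have hv : vtx x n = vtx y n := by
    rw [← vtx_eq_of_mem hz]; exact congrArg Edge.source (h n le_rfl)
  refine path_ext (hz.1.trans splice_fst.symm) fun k => ?_
  rcases lt_or_ge k n with hk | hk
  · rw [splice_of_lt hk, hz.2 k hk]
  · rw [splice_of_le hv hk, h k hk]

theorem vtx_splice_of_le {n k : ℕ} {x y : B.PathSpace} (h : vtx x n = vtx y n) (hk : n ≤ k) :
    vtx (splice n x y) k = vtx y k := congrArg Edge.source (splice_of_le h hk)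

theorem splice_splice {n : ℕ} {x y z : B.PathSpace} (hz : z ∈ cyl y n)
    (h : vtx x n = vtx y n) : splice n y (splice n x z) = z := by
  have hv : vtx x n = vtx z n := h.trans (vtx_eq_of_mem hz).symm
  exact (eq_splice hz fun k hk => (splice_of_le hv hk).symm).symm

theorem continuous_splice (n : ℕ) (x : B.PathSpace) : Continuous (splice n x) := by
  rw [← continuousOn_univ]
  refine continuousOn_of_cyl fun y _ m => ⟨max m (n + 1), fun z _ hz => ?_⟩
  have hv : vtx z n = vtx y n := vtx_eq_of_mem_of_le hz (by omega)
  by_cases h : vtx x n = vtx y n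
  · refine ⟨by rw [splice_fst, splice_fst], fun k hk => ?_⟩
    rcases lt_or_ge k n with hkn | hkn
    · rw [splice_of_lt hkn, splice_of_lt hkn]
    · rw [splice_of_le h hkn, splice_of_le (h.trans hv.symm) hkn]
      exact hz.2 k (by omega)
  · have h' : ¬ vtx x n = vtx z n := by rwa [hv]
    rw [splice_of_ne h, splice_of_ne h']
    exact mem_cyl_self _ _

theorem exists_extension (x : B.PathSpace) (n : ℕ) (e : B.Edge) (he : e.source = vtx x n) :
    ∃ z ∈ cyl x n, z.1.2 n = e := by
  have hw : ∀ k, (walk e k).range = (walk e (k + 1)).source := fun k =>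
    (outEdge_source _).symm
  refine ⟨⟨(x.1.1, fun k => if k < n then x.1.2 k else walk e (k - n)), ?_, ?_⟩, ⟨rfl, ?_⟩, ?_⟩
  · rcases Nat.eq_zero_or_pos n with rfl | hn
    · simpa [walk, he] using (vtx_zero x).symm
    · simpa [hn] using x.2.1
  · intro k
    rcases lt_trichotomy (k + 1) n with hk | hk | hk
    · simpa [hk, (Nat.lt_succ_self k).trans hk] using x.2.2 k
    · subst hk
      simpa [walk, he] using (vtx_succ x k).symm
    · simpa [show ¬ k < n by omega, show ¬ k + 1 < n by omega,
        show k + 1 - n = k - n + 1 by omega] using hw (k - n)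
  · intro k hk; simp [hk]
  · simp [walk]

theorem exists_vtx (n : ℕ) (v : B.Vertex) : ∃ x : B.PathSpace, vtx x n = v := by
  induction n generalizing v with
  | zero =>
    have hw : ∀ k, (walk (outEdge v) k).range = (walk (outEdge v) (k + 1)).source := fun k =>
      (outEdge_source _).symm
    exact ⟨⟨(⟨v, ⟨0, B.hat_pos v⟩⟩, walk (outEdge v)), (outEdge_source v).symm, hw⟩,
      outEdge_source v⟩
  | succ n ih =>
    obtain ⟨w, hw⟩ := B.exists_in v
    obtain ⟨x, hx⟩ := ih w
    obtain ⟨z, -, hz⟩ := exists_extension x n ⟨w, v, ⟨0, hw⟩⟩ hx.symm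
    exact ⟨z, by rw [vtx_succ, hz]⟩

/-- A chosen path through the vertex `v` at level `n + 1`. -/
noncomputable def pathThrough (n : ℕ) (v : B.Vertex) : B.PathSpace := (exists_vtx n v).choose

theorem vtx_pathThrough (n : ℕ) (v : B.Vertex) : vtx (pathThrough n v) n = v :=
  (exists_vtx n v).choose_spec

/-! ### Invariant measures -/

/-- Invariance under the partial homeomorphisms exchanging the beginnings of paths. -/
theorem IsTailInvariant.map_splice {μ : Measure B.PathSpace} (h : B.IsTailInvariant μ) {n : ℕ}
    {x y : B.PathSpace} (hxy : vtx x n = vtx y n) :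
    (μ.restrict (cyl x n)).map (splice n y) = μ.restrict (cyl y n) := by
  classical
  by_cases hc : y ∈ cyl x n
  · have : ∀ z ∈ cyl x n, splice n y z = z := fun z hz =>
      (eq_splice (by rwa [cyl_eq_of_mem hc]) fun _ _ => rfl).symm
    rw [Measure.map_congr (g := id), Measure.map_id, cyl_eq_of_mem hc]
    exact (ae_restrict_iff' (measurableSet_cyl x n)).2 (Filter.Eventually.of_forall this)
  have hd := disjoint_cyl hc
  -- Invariance concerns automorphisms of the whole space, so the partial map is completed to the
  -- involution exchanging the two cylinders. This needs them to be disjoint; the case of equal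
  -- cylinders was trivial.
  set f : B.PathSpace → B.PathSpace := (cyl x n).piecewise (splice n y)
    ((cyl y n).piecewise (splice n x) id) with hf
  have fx : ∀ z ∈ cyl x n, f z = splice n y z := fun z hz => by simp [hf, hz]
  have fy : ∀ z ∈ cyl y n, f z = splice n x z := fun z hz => by
    simp [hf, hz, hd.notMem_of_mem_right hz]
  have fo : ∀ z, z ∉ cyl x n → z ∉ cyl y n → f z = z := fun z hz hz' => by simp [hf, hz, hz']
  have hff : Function.Involutive f := by
    intro z
    by_cases hz : z ∈ cyl x n
    · rw [fx z hz, fy _ (splice_mem_cyl _ _ _), splice_splice hz hxy.symm]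
    by_cases hz' : z ∈ cyl y n
    · rw [fy z hz', fx _ (splice_mem_cyl _ _ _), splice_splice hz' hxy]
    rw [fo z hz hz', fo z hz hz']
  have hm : Measurable f := (continuous_splice n y).measurable.piecewise
    (measurableSet_cyl x n) ((continuous_splice n x).measurable.piecewise
      (measurableSet_cyl y n) measurable_id)
  let g : B.PathSpace ≃ᵐ B.PathSpace := ⟨hff.toPerm, hm, hm⟩
  have hg : μ.map f = μ := h g fun z => by
    change B.Tail z (f z)
    by_cases hz : z ∈ cyl x n
    · rw [fx z hz]; exact splice_tail (hxy.symm.trans (vtx_eq_of_mem hz).symm)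
    by_cases hz' : z ∈ cyl y n
    · rw [fy z hz']; exact splice_tail (hxy.trans (vtx_eq_of_mem hz').symm)
    rw [fo z hz hz']; exact ⟨0, fun _ _ => rfl⟩
  have hpre : f ⁻¹' (cyl y n) = cyl x n := by
    ext z
    refine ⟨fun hz => ?_, fun hz => ?_⟩
    · by_contra hzx
      by_cases hz' : z ∈ cyl y n
      · rw [mem_preimage, fy z hz'] at hz
        exact hd.notMem_of_mem_right hz (splice_mem_cyl _ _ _)
      · rw [mem_preimage, fo z hzx hz'] at hz
        exact hz' hz
    · rw [mem_preimage, fx z hz]; exact splice_mem_cyl _ _ _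
  calc (μ.restrict (cyl x n)).map (splice n y) = (μ.restrict (cyl x n)).map f :=
        Measure.map_congr ((ae_restrict_iff' (measurableSet_cyl x n)).2
          (Filter.Eventually.of_forall fun z hz => (fx z hz).symm))
    _ = (μ.map f).restrict (cyl y n) := by
        rw [Measure.restrict_map hm (measurableSet_cyl y n), hpre]
    _ = μ.restrict (cyl y n) := by rw [hg]

theorem IsTailInvariant.measure_cyl_eq {μ : Measure B.PathSpace} (h : B.IsTailInvariant μ) {n : ℕ}
    {x y : B.PathSpace} (hxy : vtx x n = vtx y n) : μ (cyl x n) = μ (cyl y n) := by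
  have := congrArg (fun ρ => ρ univ) (h.map_splice hxy)
  rw [Measure.map_apply (continuous_splice n y).measurable MeasurableSet.univ] at this
  simpa using this

end StationaryBratteliDiagram

/-! ### Classification of good infinite measures -/

section Classification

set_option linter.unusedSectionVars false

/-- Clopen sets of infinite measure are unions of two disjoint clopen sets of infinite measure. -/
def SplitsInfinite {X : Type*} [TopologicalSpace X] [MeasurableSpace X] (μ : Measure X) : Prop :=
  ∀ A : Set X, IsClopen A → μ A = ⊤ → ∃ T, IsClopen T ∧ T ⊆ A ∧ μ T = ⊤ ∧ μ (A \ T) = ⊤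

/-- Every finite value of `μ` on clopen sets is a value of `ν` on a clopen set. -/
def ClopenValuesSubset {X Y : Type*} [TopologicalSpace X] [MeasurableSpace X]
    [TopologicalSpace Y] [MeasurableSpace Y] (μ : Measure X) (ν : Measure Y) : Prop :=
  ∀ A : Set X, IsClopen A → μ A ≠ ⊤ → ∃ B : Set Y, IsClopen B ∧ ν B = μ A

variable {X Y : Type*} [TopologicalSpace X] [MeasurableSpace X] [BorelSpace X]
  [TopologicalSpace Y] [MeasurableSpace Y] [BorelSpace Y] {μ : Measure X} {ν : Measure Y}

theorem IsClopen.measurableSet_borel {A : Set X} (hA : IsClopen A) : MeasurableSet A :=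
  hA.isOpen.measurableSet

/-- Goodness only applies to a strict inequality. It is strict because `T` is finite and its
complement in `A` is not null; if that complement is null, all of `B` serves as the copy. Finiteness
also permits cancellation in the complement. -/
theorem exists_clopen_subset_of_lt (hgood : ∀ V : Set Y, IsClopen V → IsGoodClopen ν V)
    (hval : ClopenValuesSubset μ ν) {A T : Set X} {B : Set Y}
    (hT : IsClopen T) (hB : IsClopen B) (hTA : T ⊆ A) (hAB : μ A = ν B) (hfin : μ T ≠ ⊤) :
    ∃ T', IsClopen T' ∧ T' ⊆ B ∧ ν T' = μ T ∧ ν (B \ T') = μ (A \ T) := by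
  have hadd : μ A = μ T + μ (A \ T) := by
    rw [← measure_inter_add_sdiff A hT.measurableSet_borel, inter_eq_right.2 hTA]
  by_cases h0 : μ (A \ T) = 0
  · exact ⟨B, hB, subset_rfl, by rw [← hAB, hadd, h0, add_zero], by simp [h0]⟩
  obtain ⟨B₀, hB₀, hval₀⟩ := hval T hT hfin
  have hlt : μ T < ν B := by
    rw [← hAB, hadd]; exact ENNReal.lt_add_right hfin h0
  obtain ⟨T', hT', hTB, hT'val⟩ := hgood B hB B₀ hB₀ (hval₀ ▸ hlt)
  rw [hval₀] at hT'val
  refine ⟨T', hT', hTB, hT'val, ?_⟩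
  rw [measure_sdiff hTB hT'.measurableSet_borel.nullMeasurableSet (hT'val ▸ hfin), hT'val, ← hAB,
    hadd, ENNReal.add_sub_cancel_left hfin]

/-- If only one of the two pieces is infinite, the finite one is copied by goodness and the other is
its complement. Goodness says nothing when both are infinite; there the splitting property takes
over. -/
theorem exists_clopen_match (hgood : ∀ V : Set Y, IsClopen V → IsGoodClopen ν V)
    (hval : ClopenValuesSubset μ ν) (hsplit : SplitsInfinite ν) {A T : Set X} {B : Set Y}
    (hA : IsClopen A) (hT : IsClopen T) (hB : IsClopen B) (hTA : T ⊆ A) (hAB : μ A = ν B) :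
    ∃ T', IsClopen T' ∧ T' ⊆ B ∧ ν T' = μ T ∧ ν (B \ T') = μ (A \ T) := by
  by_cases h1 : μ T = ⊤
  · by_cases h2 : μ (A \ T) = ⊤
    · obtain ⟨T', hT', hs, h3, h4⟩ := hsplit B hB
        (by rw [← hAB]; exact measure_mono_top hTA h1)
      exact ⟨T', hT', hs, by rw [h3, h1], by rw [h4, h2]⟩
    · obtain ⟨T', hT', hs, h3, h4⟩ := exists_clopen_subset_of_lt hgood hval (hA.diff hT) hB
        sdiff_subset hAB h2
      refine ⟨B \ T', hB.diff hT', sdiff_subset, ?_, ?_⟩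
      · rw [h4, sdiff_sdiff_cancel_left hTA]
      · rw [sdiff_sdiff_cancel_left hs, h3]
  · exact exists_clopen_subset_of_lt hgood hval hT hB hTA hAB h1

/-- Two locally constant labellings whose fibres have equal measures. -/
structure IsMatched (μ : Measure X) (ν : Measure Y) (f : X → ℕ) (g : Y → ℕ) : Prop where
  left : IsLocallyConstant f
  right : IsLocallyConstant g
  measure_eq : ∀ k, μ (f ⁻¹' {k}) = ν (g ⁻¹' {k})

theorem IsMatched.symm {f : X → ℕ} {g : Y → ℕ} (h : IsMatched μ ν f g) : IsMatched ν μ g f :=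
  ⟨h.right, h.left, fun k => (h.measure_eq k).symm⟩

open Classical in
/-- The common refinement of a labelling and a two-piece partition. -/
noncomputable def refineLabel {Z : Type*} (f : Z → ℕ) (T : Set Z) (z : Z) : ℕ :=
  2 * f z + if z ∈ T then 1 else 0

theorem refineLabel_eq_iff {Z W : Type*} {f : Z → ℕ} {T : Set Z} {g : W → ℕ} {S : Set W} {z : Z}
    {w : W} : refineLabel f T z = refineLabel g S w ↔ f z = g w ∧ (z ∈ T ↔ w ∈ S) := by
  classical
  unfold refineLabel
  by_cases h : z ∈ T <;> by_cases h' : w ∈ S <;> simp [h, h'] <;> omega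

theorem IsLocallyConstant.refineLabel {Z : Type*} [TopologicalSpace Z] {f : Z → ℕ}
    (hf : IsLocallyConstant f) {T : Set Z} (hT : IsClopen T) :
    IsLocallyConstant (refineLabel f T) := by
  rw [IsLocallyConstant.iff_eventually_eq]
  intro z
  have h1 := (IsLocallyConstant.iff_eventually_eq f).1 hf z
  by_cases hz : z ∈ T
  · filter_upwards [h1, hT.isOpen.mem_nhds hz] with w hw hw'
    exact refineLabel_eq_iff.2 ⟨hw, by simp [hz, hw']⟩
  · filter_upwards [h1, hT.compl.isOpen.mem_nhds hz] with w hw hw'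
    exact refineLabel_eq_iff.2 ⟨hw, by simpa [hz] using hw'⟩

theorem refineLabel_preimage_even {Z : Type*} (f : Z → ℕ) (T : Set Z) (k : ℕ) :
    refineLabel f T ⁻¹' {2 * k} = f ⁻¹' {k} \ (f ⁻¹' {k} ∩ T) := by
  ext z
  by_cases h : z ∈ T
  all_goals
    simp [refineLabel, h]
    try omega

theorem refineLabel_preimage_odd {Z : Type*} (f : Z → ℕ) (T : Set Z) (k : ℕ) :
    refineLabel f T ⁻¹' {2 * k + 1} = f ⁻¹' {k} ∩ T := by
  ext z
  by_cases h : z ∈ T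
  all_goals
    simp [refineLabel, h]
    try omega

theorem IsMatched.exists_refine (hgood : ∀ V : Set Y, IsClopen V → IsGoodClopen ν V)
    (hval : ClopenValuesSubset μ ν) (hsplit : SplitsInfinite ν) {f : X → ℕ} {g : Y → ℕ}
    (h : IsMatched μ ν f g) {T : Set X} (hT : IsClopen T) :
    ∃ S, IsClopen S ∧ IsMatched μ ν (refineLabel f T) (refineLabel g S) := by
  have hf : ∀ k, IsClopen (f ⁻¹' {k}) := fun k => h.left.isClopen_fiber k
  have hg : ∀ k, IsClopen (g ⁻¹' {k}) := fun k => h.right.isClopen_fiber k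
  choose S hS hSg hS1 hS2 using fun k => exists_clopen_match hgood hval hsplit (hf k)
    ((hf k).inter hT) (hg k) inter_subset_left (h.measure_eq k)
  have hSk : ∀ k, g ⁻¹' {k} ∩ ⋃ j, S j = S k := by
    intro k
    ext y
    simp only [mem_inter_iff, mem_preimage, mem_singleton_iff, mem_iUnion]
    constructor
    · rintro ⟨rfl, j, hj⟩
      have : g y = j := hSg j hj
      rwa [this]
    · exact fun hy => ⟨hSg k hy, k, hy⟩
  -- The union runs over infinitely many labels, but each `S k` lies in its own open fibre, so the
  -- complement is a union of open sets too.
  have hSc : IsClopen (⋃ k, S k) := by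
    refine ⟨⟨?_⟩, isOpen_iUnion fun k => (hS k).isOpen⟩
    have : (⋃ k, S k)ᶜ = ⋃ k, g ⁻¹' {k} \ S k := by
      ext y
      simp only [mem_compl_iff, mem_iUnion, mem_sdiff, mem_preimage, mem_singleton_iff]
      constructor
      · exact fun hy => ⟨g y, rfl, fun hy' => hy ⟨_, hy'⟩⟩
      · rintro ⟨k, rfl, hy⟩ ⟨j, hj⟩
        have : g y = j := hSg j hj
        exact hy (by rwa [this])
    rw [this]
    exact isOpen_iUnion fun k => ((hg k).diff (hS k)).isOpen
  refine ⟨⋃ k, S k, hSc, h.left.refineLabel hT, h.right.refineLabel hSc, fun k => ?_⟩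
  obtain ⟨j, rfl | rfl⟩ := Nat.even_or_odd' k
  · rw [refineLabel_preimage_even, refineLabel_preimage_even, hSk, hS2]
  · rw [refineLabel_preimage_odd, refineLabel_preimage_odd, hSk, hS1]

/-- The back-and-forth: each stage first splits along `T n` on the left and copies the pieces to the
right, then splits along `S n` on the right and copies back. -/
theorem exists_matched_sequence
    (hμ : ∀ V : Set X, IsClopen V → IsGoodClopen μ V)
    (hν : ∀ V : Set Y, IsClopen V → IsGoodClopen ν V) (huniv : μ univ = ν univ)
    (h1 : ClopenValuesSubset μ ν) (h2 : ClopenValuesSubset ν μ) (hsμ : SplitsInfinite μ)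
    (hsν : SplitsInfinite ν) (T : ℕ → Set X) (S : ℕ → Set Y) (hT : ∀ n, IsClopen (T n))
    (hS : ∀ n, IsClopen (S n)) :
    ∃ (f : ℕ → X → ℕ) (g : ℕ → Y → ℕ), (∀ n, IsMatched μ ν (f n) (g n)) ∧
      (∀ n x y, f (n + 1) x = g (n + 1) y → f n x = g n y) ∧
      (∀ n x x', f (n + 1) x = f (n + 1) x' → (x ∈ T n ↔ x' ∈ T n)) ∧
      (∀ n y y', g (n + 1) y = g (n + 1) y' → (y ∈ S n ↔ y' ∈ S n)) := by
  have step : ∀ (n : ℕ) (p : {p : (X → ℕ) × (Y → ℕ) // IsMatched μ ν p.1 p.2}),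
      ∃ q : {p : (X → ℕ) × (Y → ℕ) // IsMatched μ ν p.1 p.2},
        (∀ x y, q.1.1 x = q.1.2 y → p.1.1 x = p.1.2 y) ∧
        (∀ x x', q.1.1 x = q.1.1 x' → (x ∈ T n ↔ x' ∈ T n)) ∧
        (∀ y y', q.1.2 y = q.1.2 y' → (y ∈ S n ↔ y' ∈ S n)) := by
    intro n p
    obtain ⟨S', hS', hm⟩ := p.2.exists_refine hν h1 hsν (hT n)
    obtain ⟨T', hT', hm'⟩ := hm.symm.exists_refine hμ h2 hsμ (hS n)
    refine ⟨⟨(_, _), hm'.symm⟩, fun x y h => ?_, fun x x' h => ?_, fun y y' h => ?_⟩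
    · exact (refineLabel_eq_iff.1 (refineLabel_eq_iff.1 h).1).1
    · exact (refineLabel_eq_iff.1 (refineLabel_eq_iff.1 h).1).2
    · exact (refineLabel_eq_iff.1 h).2
  choose nxt hn1 hn2 hn3 using step
  let p0 : {p : (X → ℕ) × (Y → ℕ) // IsMatched μ ν p.1 p.2} :=
    ⟨(fun _ => 0, fun _ => 0), IsLocallyConstant.const 0, IsLocallyConstant.const 0, fun k => by
      by_cases hk : 0 = k <;> simp [hk, huniv]⟩
  let s : ℕ → {p : (X → ℕ) × (Y → ℕ) // IsMatched μ ν p.1 p.2} :=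
    fun n => Nat.rec p0 (fun n p => nxt n p) n
  exact ⟨fun n => (s n).1.1, fun n => (s n).1.2, fun n => (s n).2, fun n => hn1 n (s n),
    fun n => hn2 n (s n), fun n => hn3 n (s n)⟩

/-- The fibres over the labels of `x` are nested and compact. They are non-empty because they have
the measure of a non-empty open set, which is positive by fullness. -/
theorem IsMatched.exists_eq [CompactSpace Y] {f : ℕ → X → ℕ} {g : ℕ → Y → ℕ}
    (hfull : ∀ U : Set X, IsOpen U → U.Nonempty → 0 < μ U)
    (hm : ∀ n, IsMatched μ ν (f n) (g n))
    (hmono : ∀ n x y, f (n + 1) x = g (n + 1) y → f n x = g n y) (x : X) :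
    ∃ y, ∀ n, f n x = g n y := by
  have hc : ∀ n, IsClosed (g n ⁻¹' {f n x}) := fun n => ((hm n).right.isClopen_fiber _).1
  obtain ⟨y, hy⟩ := IsCompact.nonempty_iInter_of_sequence_nonempty_isCompact_isClosed
    (fun n => g n ⁻¹' {f n x}) (fun n y hy => (hmono n x y (Eq.symm hy)).symm)
    (fun n => by
      have : 0 < ν (g n ⁻¹' {f n x}) := by
        rw [← (hm n).measure_eq]
        exact hfull _ ((hm n).left.isClopen_fiber _).isOpen ⟨x, rfl⟩
      exact nonempty_of_measure_ne_zero this.ne') (hc 0).isCompact hc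
  exact ⟨y, fun n => (mem_iInter.1 hy n).symm⟩

theorem measure_preimage_eq_of_matched {f : X → ℕ} {g : Y → ℕ} (h : IsMatched μ ν f g)
    (I : Set ℕ) : μ (f ⁻¹' I) = ν (g ⁻¹' I) := by
  have hf : f ⁻¹' I = ⋃ k ∈ I, f ⁻¹' {k} := by ext; simp
  have hg : g ⁻¹' I = ⋃ k ∈ I, g ⁻¹' {k} := by ext; simp
  rw [hf, hg, measure_biUnion I.to_countable, measure_biUnion I.to_countable]
  · exact tsum_congr fun k => h.measure_eq k
  · exact fun i _ j _ hij => Disjoint.preimage _ (by simpa using hij)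
  · exact fun k _ => (h.right.isClopen_fiber k).measurableSet_borel
  · exact fun i _ j _ hij => Disjoint.preimage _ (by simpa using hij)
  · exact fun k _ => (h.left.isClopen_fiber k).measurableSet_borel

variable [CompactSpace X] [T2Space X] [TotallyDisconnectedSpace X] [SecondCountableTopology X]

theorem exists_seq_isClopen (X : Type*) [TopologicalSpace X] [CompactSpace X] [T2Space X]
    [TotallyDisconnectedSpace X] [SecondCountableTopology X] :
    ∃ T : ℕ → Set X, (∀ n, IsClopen (T n)) ∧ ∀ A, IsClopen A → ∃ n, T n = A := by
  have : Countable (TopologicalSpace.Clopens X) :=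
    TopologicalSpace.Clopens.countable_iff_secondCountable.2 inferInstance
  obtain ⟨e, he⟩ := exists_surjective_nat (TopologicalSpace.Clopens X)
  refine ⟨fun n => e n, fun n => (e n).isClopen, fun A hA => ?_⟩
  obtain ⟨n, hn⟩ := he ⟨A, hA⟩
  exact ⟨n, by simp [hn]⟩

theorem eq_of_forall_isClopen {x x' : X} (h : ∀ A : Set X, IsClopen A → (x ∈ A ↔ x' ∈ A)) :
    x = x' := by
  by_contra hne
  obtain ⟨U, hU, hx, hx'⟩ := exists_isClopen_of_totally_separated hne
  exact hx' ((h U hU).1 hx)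

/-- Measures which vanish on their defective sets are determined by their values on clopen
sets. -/
theorem measure_eq_of_isClopen {μ ρ : Measure X} (h : ∀ A, IsClopen A → μ A = ρ A)
    (hμ : μ (defectiveSet μ) = 0) (hρ : ρ (defectiveSet ρ) = 0) : μ = ρ := by
  obtain ⟨T, hT, hTs⟩ := exists_seq_isClopen X
  have hdef : defectiveSet μ = defectiveSet ρ := by
    ext x
    simp only [defectiveSet, mem_ofPred_eq]
    exact forall₃_congr fun U hU _ => by rw [h U hU]
  -- The clopen sets of finite measure cover exactly the complement of the defective set, and on
  -- each of them the two finite measures agree on the $\pi$-system of clopen sets.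
  let s : ℕ → Set X := fun n => {x | x ∈ T n ∧ μ (T n) ≠ ⊤}
  have hcompl : (⋃ n, s n)ᶜ = defectiveSet μ := by
    ext x
    simp only [s, mem_compl_iff, mem_iUnion, mem_ofPred_eq, defectiveSet, not_exists, not_and,
      not_not]
    constructor
    · intro hx U hU hxU
      obtain ⟨n, rfl⟩ := hTs U hU
      exact hx n hxU
    · exact fun hx n hn => hx (T n) (hT n) hn
  have hsm : ∀ n, IsClopen (s n) ∧ μ (s n) ≠ ⊤ := by
    intro n
    by_cases hn : μ (T n) = ⊤
    · have : s n = ∅ := by ext x; simp [s, hn]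
      rw [this]; exact ⟨isClopen_empty, by simp⟩
    · have : s n = T n := by ext x; simp [s, hn]
      rw [this]; exact ⟨hT n, hn⟩
  have key : μ.restrict (⋃ n, s n) = ρ.restrict (⋃ n, s n) := by
    rw [Measure.restrict_iUnion_congr]
    intro n
    have : IsFiniteMeasure (μ.restrict (s n)) := ⟨by
      rw [Measure.restrict_apply_univ]; exact (hsm n).2.lt_top⟩
    refine ext_of_generate_finite {A : Set X | IsClopen A} ?_ (fun A hA B hB _ => hA.inter hB) ?_ ?_
    · rw [BorelSpace.measurable_eq (α := X)]
      exact isTopologicalBasis_isClopen.borel_eq_generateFrom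
    · intro A hA
      rw [Measure.restrict_apply hA.measurableSet_borel, Measure.restrict_apply
        hA.measurableSet_borel]
      exact h _ (IsClopen.inter hA (hsm n).1)
    · rw [Measure.restrict_apply_univ, Measure.restrict_apply_univ]
      exact h _ (hsm n).1
  have e1 : μ.restrict (⋃ n, s n) = μ := Measure.restrict_eq_self_of_ae_mem (by
    rw [← hcompl] at hμ; exact hμ)
  have e2 : ρ.restrict (⋃ n, s n) = ρ := Measure.restrict_eq_self_of_ae_mem (by
    rw [← hdef, ← hcompl] at hρ; exact hρ)
  rw [← e1, key, e2]

variable [CompactSpace Y] [T2Space Y] [TotallyDisconnectedSpace Y] [SecondCountableTopology Y]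

/-- The labels separate points on both sides, since the back-and-forth runs through all clopen sets;
points with equal labels correspond bijectively. A clopen set is a union of label fibres at some
stage, which gives both continuity and equality of measures on clopen sets. -/
theorem homeomorphicMeasures_of_clopenValues (hμ : IsGoodInfiniteMeasure μ)
    (hν : IsGoodInfiniteMeasure ν) (h1 : ClopenValuesSubset μ ν) (h2 : ClopenValuesSubset ν μ)
    (hsμ : SplitsInfinite μ) (hsν : SplitsInfinite ν) : HomeomorphicMeasures μ ν := by
  obtain ⟨T, hT, hTs⟩ := exists_seq_isClopen X
  obtain ⟨S, hS, hSs⟩ := exists_seq_isClopen Y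
  obtain ⟨f, g, hm, hmono, hfT, hgS⟩ := exists_matched_sequence hμ.good hν.good
    (hμ.nonDefective.infinite.trans hν.nonDefective.infinite.symm) h1 h2 hsμ hsν T S hT hS
  choose h hh using IsMatched.exists_eq hμ.nonDefective.full hm hmono
  choose k hk using IsMatched.exists_eq hν.nonDefective.full (fun n => (hm n).symm)
    fun n y x hyx => (hmono n x y hyx.symm).symm
  have inj_right : ∀ y y', (∀ n, g n y = g n y') → y = y' := fun y y' hy =>
    eq_of_forall_isClopen fun A hA => by
      obtain ⟨n, rfl⟩ := hSs A hA
      exact hgS n y y' (hy (n + 1))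
  have inj_left : ∀ x x', (∀ n, f n x = f n x') → x = x' := fun x x' hx =>
    eq_of_forall_isClopen fun A hA => by
      obtain ⟨n, rfl⟩ := hTs A hA
      exact hfT n x x' (hx (n + 1))
  let e : X ≃ Y := ⟨h, k, fun x => inj_left _ _ fun n => by rw [← hk, ← hh],
    fun y => inj_right _ _ fun n => by rw [← hh, ← hk]⟩
  have hpre : ∀ n, h ⁻¹' S n = f (n + 1) ⁻¹' (g (n + 1) '' S n) := by
    intro n
    ext x
    simp only [mem_preimage, mem_image]
    constructor
    · exact fun hx => ⟨h x, hx, (hh x _).symm⟩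
    · rintro ⟨y, hy, hyx⟩
      exact (hgS n y (h x) (hyx.trans (hh x _))).1 hy
  have hpre' : ∀ n, S n = g (n + 1) ⁻¹' (g (n + 1) '' S n) := by
    intro n
    refine (subset_preimage_image _ _).antisymm ?_
    rintro y ⟨y', hy', hyy⟩
    exact (hgS n y' y hyy).1 hy'
  have hcont : Continuous e := by
    refine isTopologicalBasis_isClopen.continuous_iff.2 fun A hA => ?_
    obtain ⟨n, rfl⟩ := hSs A hA
    change IsOpen (h ⁻¹' S n)
    rw [hpre]
    exact (hm (n + 1)).left _
  let H : X ≃ₜ Y := hcont.homeoOfEquivCompactToT2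
  refine ⟨H, ?_⟩
  have hmap' : ∀ A, μ.map H A = μ (H ⁻¹' A) := fun A => H.toMeasurableEquiv.map_apply A
  have hmap : ∀ A, IsClopen A → μ.map H A = ν A := by
    intro A hA
    rw [hmap']
    obtain ⟨n, rfl⟩ := hSs A hA
    change μ (h ⁻¹' S n) = ν (S n)
    rw [hpre, measure_preimage_eq_of_matched (hm (n + 1)), ← hpre']
  refine measure_eq_of_isClopen hmap ?_ hν.nonDefective.defective_null
  rw [hmap']
  have hsub : H ⁻¹' defectiveSet (μ.map H) ⊆ defectiveSet μ := by
    intro x hx U hU hxU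
    have := hx (H.symm ⁻¹' U) (hU.preimage H.symm.continuous) (by simpa using hxU)
    rwa [hmap', ← preimage_comp, H.symm_comp_self, preimage_id] at this
  exact measure_mono_null hsub hμ.nonDefective.defective_null

end Classification

/-! ### Sequences determined backwards in a finite set -/

/-- Equality of two terms propagates to all earlier pairs with the same difference. The pigeonhole
principle finds arbitrarily late coincidences at distances at most the cardinality of `α`, and all
such distances divide its factorial. -/
theorem exists_period_of_backward {α : Type*} [Finite α] (g : α → α) (s : ℕ → α)
    (h : ∀ n, s n = g (s (n + 1))) : ∃ p, 0 < p ∧ ∀ n, s (n + p) = s n := by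
  have := Fintype.ofFinite α
  have back : ∀ k i j, s (i + k) = s (j + k) → s i = s j := by
    intro k
    induction k with
    | zero => intro i j hij; simpa using hij
    | succ k ih => exact fun i j hij => ih i j (by rw [h (i + k), h (j + k)]; exact congrArg g hij)
  refine ⟨(Fintype.card α).factorial, Nat.factorial_pos _, fun n => ?_⟩
  -- The coincidence is sought beyond `N`, so the shift by `q` is valid at each intermediate index
  -- from `n` to `n + card!`.
  let N := n + (Fintype.card α).factorial
  obtain ⟨i, j, hij, hs⟩ := Fintype.exists_ne_map_eq_of_card_lt
    (fun i : Fin (Fintype.card α + 1) => s (N + i)) (by simp)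
  wlog hlt : i < j generalizing i j
  · exact this j i hij.symm hs.symm (lt_of_le_of_ne (not_lt.1 hlt) hij.symm)
  have hij' : (i : ℕ) < j := hlt
  set q := (j : ℕ) - i with hq
  have hper : ∀ m, m ≤ N → s (m + q) = s m := by
    intro m hm
    refine back (N + i - m) _ _ ?_
    rw [show m + q + (N + i - m) = N + j by omega, show m + (N + i - m) = N + i by omega]
    exact hs.symm
  obtain ⟨t, ht⟩ : q ∣ (Fintype.card α).factorial := Nat.dvd_factorial (by omega) (by omega)
  have : ∀ r, r ≤ t → s (n + q * r) = s n := by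
    intro r
    induction r with
    | zero => simp
    | succ r ih =>
      intro hr
      have h1 : q * r ≤ q * t := Nat.mul_le_mul_left q (by omega)
      rw [Nat.mul_succ, ← add_assoc, hper _ (by omega), ih (by omega)]
  rw [ht]; exact this t le_rfl

namespace StationaryBratteliDiagram

variable {B : StationaryBratteliDiagram}

/-! ### Decomposing cylinders -/

/-- A path that follows `x` up to level `n + 1` and then the edge `e`. -/
noncomputable def extend (x : B.PathSpace) (n : ℕ) (e : B.Edge) (he : e.source = vtx x n) :
    B.PathSpace := (exists_extension x n e he).choose

theorem extend_mem (x : B.PathSpace) (n : ℕ) (e : B.Edge) (he : e.source = vtx x n) :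
    extend x n e he ∈ cyl x n := (exists_extension x n e he).choose_spec.1

theorem extend_edge (x : B.PathSpace) (n : ℕ) (e : B.Edge) (he : e.source = vtx x n) :
    (extend x n e he).1.2 n = e := (exists_extension x n e he).choose_spec.2

theorem vtx_extend (x : B.PathSpace) (n : ℕ) (e : B.Edge) (he : e.source = vtx x n) :
    vtx (extend x n e he) (n + 1) = e.range := by rw [vtx_succ, extend_edge]

theorem mem_cyl_succ {x y : B.PathSpace} {n : ℕ} :
    y ∈ cyl x (n + 1) ↔ y ∈ cyl x n ∧ y.1.2 n = x.1.2 n := by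
  simp only [cyl, mem_ofPred_eq, Nat.lt_succ_iff_lt_or_eq, and_assoc]
  refine and_congr_right fun _ => ⟨fun h => ⟨fun k hk => h k (Or.inl hk), h n (Or.inr rfl)⟩, ?_⟩
  rintro ⟨h, h'⟩ k (hk | rfl)
  exacts [h k hk, h']

theorem mem_cyl_extend {x y : B.PathSpace} {n : ℕ} {e : B.Edge} {he : e.source = vtx x n} :
    y ∈ cyl (extend x n e he) (n + 1) ↔ y ∈ cyl x n ∧ y.1.2 n = e := by
  rw [mem_cyl_succ, extend_edge, cyl_eq_of_mem (extend_mem x n e he)]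

theorem measure_cyl_inter (μ : Measure B.PathSpace) (x : B.PathSpace) (n : ℕ)
    {T : Set B.PathSpace} (hT : MeasurableSet T) :
    μ (cyl x n ∩ T) = ∑ u, ∑ i : Fin (B.F u (vtx x n)),
      μ (cyl (extend x n ⟨vtx x n, u, i⟩ rfl) (n + 1) ∩ T) := by
  have hU : cyl x n ∩ T = ⋃ a : Σ u, Fin (B.F u (vtx x n)),
      cyl (extend x n ⟨vtx x n, a.1, a.2⟩ rfl) (n + 1) ∩ T := by
    ext y
    simp only [mem_inter_iff, mem_iUnion, mem_cyl_extend]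
    constructor
    · rintro ⟨hy, hT⟩
      have hs : (y.1.2 n).source = vtx x n := vtx_eq_of_mem hy
      generalize hv : vtx x n = v at hs ⊢
      generalize y.1.2 n = e at hs ⊢
      obtain ⟨s, r, l⟩ := e
      obtain rfl : s = v := hs
      exact ⟨⟨r, l⟩, ⟨hy, rfl⟩, hT⟩
    · rintro ⟨a, ⟨hy, -⟩, hT⟩
      exact ⟨hy, hT⟩
  rw [hU, measure_iUnion, tsum_fintype, Fintype.sum_sigma]
  · intro a b hab
    refine Set.disjoint_left.2 fun y hy hy' => hab ?_
    have := (mem_cyl_extend.1 hy.1).2.symm.trans (mem_cyl_extend.1 hy'.1).2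
    obtain ⟨u, i⟩ := a
    obtain ⟨u', i'⟩ := b
    simp only [Edge.mk.injEq, true_and] at this
    obtain ⟨rfl, h⟩ := this
    rw [eq_of_heq h]
  · exact fun a => (measurableSet_cyl _ _).inter hT

theorem measurableSet_vtx (n : ℕ) (v : B.Vertex) :
    MeasurableSet {z : B.PathSpace | vtx z n = v} :=
  (isClopen_vtx n {v}).measurableSet_borel

open Classical in
/-- The number of ways to get from one vertex to another one, weighted by a measure. -/
theorem measure_cyl_inter_vtx (μ : Measure B.PathSpace) (w : B.Vertex) (c : ENNReal) (k : ℕ) :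
    ∀ (n : ℕ) (x : B.PathSpace), (∀ z, vtx z (n + k) = w → μ (cyl z (n + k)) = c) →
      μ (cyl x n ∩ {z | vtx z (n + k) = w}) = ((B.F ^ k) w (vtx x n) : ℕ) * c := by
  induction k with
  | zero =>
    intro n x h
    by_cases hw : vtx x n = w
    · have : cyl x n ∩ {z | vtx z (n + 0) = w} = cyl x n :=
        inter_eq_left.2 fun z hz => (vtx_eq_of_mem hz).trans hw
      rw [this, pow_zero, hw, Matrix.one_apply_eq, Nat.cast_one, one_mul]
      exact h x hw
    · have : cyl x n ∩ {z | vtx z (n + 0) = w} = ∅ := by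
        refine eq_empty_of_forall_notMem fun z hz => hw ?_
        rw [← vtx_eq_of_mem hz.1]; exact hz.2
      rw [this, pow_zero, Matrix.one_apply_ne (Ne.symm hw)]
      simp
  | succ k ih =>
    intro n x h
    rw [measure_cyl_inter μ x n (measurableSet_vtx _ _)]
    have h' : ∀ z, vtx z (n + 1 + k) = w → μ (cyl z (n + 1 + k)) = c := by
      rw [show n + 1 + k = n + (k + 1) by omega]; exact h
    have key : ∀ u (i : Fin (B.F u (vtx x n))),
        μ (cyl (extend x n ⟨vtx x n, u, i⟩ rfl) (n + 1) ∩ {z | vtx z (n + (k + 1)) = w}) =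
          ((B.F ^ k) w u : ℕ) * c := by
      intro u i
      have := ih (n + 1) (extend x n ⟨vtx x n, u, i⟩ rfl) h'
      rwa [vtx_extend, show n + 1 + k = n + (k + 1) by omega] at this
    simp only [key, Finset.sum_const, Finset.card_univ, Fintype.card_fin, pow_succ,
      Matrix.mul_apply, Nat.cast_sum, Nat.cast_mul, Finset.sum_mul, nsmul_eq_mul]
    exact Finset.sum_congr rfl fun u _ => by ring

/-- For each length there is a measure giving mass one to all cylinders of this length. -/
theorem exists_counting_measure (B : StationaryBratteliDiagram) (N : ℕ) :
    ∃ ρ : Measure B.PathSpace, ∀ z, ρ (cyl z N) = 1 := by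
  classical
  have : Fintype (range (pre N : B.PathSpace → _)) := Fintype.ofFinite _
  refine ⟨∑ c : range (pre N : B.PathSpace → _), Measure.dirac c.2.choose, fun z => ?_⟩
  rw [Measure.finsetSum_apply]
  have key : ∀ c : range (pre N : B.PathSpace → _),
      Measure.dirac c.2.choose (cyl z N) = if c = ⟨pre N z, z, rfl⟩ then 1 else 0 := by
    intro c
    have hc : pre N c.2.choose = c := c.2.choose_spec
    rw [Measure.dirac_apply' _ (measurableSet_cyl z N)]
    by_cases h : c = ⟨pre N z, z, rfl⟩
    · rw [if_pos h, indicator_of_mem]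
      · rfl
      · rw [← pre_eq_iff, hc, h]
    · rw [if_neg h, indicator_of_notMem]
      rw [← pre_eq_iff, hc]
      exact fun h' => h (Subtype.ext h')
  simp [key]

/-! ### Matrix powers as numbers of paths -/

section PathCount

open Classical

/-- With a measure that gives mass one to each cylinder of length `n + k`, the mass formula reads an
entry of `B.F ^ k` as a number of cylinders. -/
theorem exists_of_pow_pos {k n : ℕ} {x : B.PathSpace} {w : B.Vertex}
    (h : 0 < (B.F ^ k) w (vtx x n)) : ∃ z ∈ cyl x n, vtx z (n + k) = w := by
  obtain ⟨ρ, hρ⟩ := exists_counting_measure B (n + k)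
  have := measure_cyl_inter_vtx ρ w 1 k n x fun z _ => hρ z
  have h0 : ρ (cyl x n ∩ {z | vtx z (n + k) = w}) ≠ 0 := by
    rw [this, mul_one]; exact_mod_cast h.ne'
  obtain ⟨z, hz⟩ := nonempty_of_measure_ne_zero h0
  exact ⟨z, hz.1, hz.2⟩

theorem exists_two_of_pow {k n : ℕ} {x : B.PathSpace} {w : B.Vertex}
    (h : 2 ≤ (B.F ^ k) w (vtx x n)) : ∃ z ∈ cyl x n, ∃ z' ∈ cyl x n, vtx z (n + k) = w ∧
      vtx z' (n + k) = w ∧ Disjoint (cyl z (n + k)) (cyl z' (n + k)) := by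
  obtain ⟨z, hz, hzw⟩ := exists_of_pow_pos (n := n) (x := x) (k := k) (w := w) (by omega)
  by_contra! hcon
  obtain ⟨ρ, hρ⟩ := exists_counting_measure B (n + k)
  have := measure_cyl_inter_vtx ρ w 1 k n x fun z _ => hρ z
  have hle : ρ (cyl x n ∩ {y | vtx y (n + k) = w}) ≤ ρ (cyl z (n + k)) := by
    refine measure_mono fun y hy => ?_
    by_contra hyz
    exact hcon z hz y hy.1 hzw hy.2 (disjoint_cyl hyz)
  rw [this, hρ, mul_one] at hle
  have : (B.F ^ k) w (vtx x n) ≤ 1 := by exact_mod_cast hle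
  omega

theorem mem_cyl_of_pow_le_one {k n : ℕ} {x y z : B.PathSpace} {w : B.Vertex}
    (h : (B.F ^ k) w (vtx x n) ≤ 1) (hy : y ∈ cyl x n) (hz : z ∈ cyl x n)
    (hyw : vtx y (n + k) = w) (hzw : vtx z (n + k) = w) : z ∈ cyl y (n + k) := by
  by_contra hcon
  obtain ⟨ρ, hρ⟩ := exists_counting_measure B (n + k)
  have := measure_cyl_inter_vtx ρ w 1 k n x fun z _ => hρ z
  have hle : ρ (cyl y (n + k) ∪ cyl z (n + k)) ≤ ρ (cyl x n ∩ {y | vtx y (n + k) = w}) := by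
    refine measure_mono (union_subset ?_ ?_) <;> intro a ha
    · exact ⟨cyl_subset_of_mem hy (by omega) ha, (vtx_eq_of_mem ha).trans hyw⟩
    · exact ⟨cyl_subset_of_mem hz (by omega) ha, (vtx_eq_of_mem ha).trans hzw⟩
  rw [this, measure_union (disjoint_cyl hcon) (measurableSet_cyl _ _), hρ, hρ, mul_one] at hle
  have : 1 + 1 ≤ (B.F ^ k) w (vtx x n) := by exact_mod_cast hle
  omega

end PathCount

/-! ### Cylinder masses of invariant measures -/

/-- The measure of the cylinders that end in the vertex `v` of level `n + 1`. -/
noncomputable def mass (μ : Measure B.PathSpace) (n : ℕ) (v : B.Vertex) : ENNReal :=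
  μ (cyl (pathThrough n v) n)

theorem IsTailInvariant.measure_cyl {μ : Measure B.PathSpace} (h : B.IsTailInvariant μ)
    (x : B.PathSpace) (n : ℕ) : μ (cyl x n) = mass μ n (vtx x n) :=
  h.measure_cyl_eq (vtx_pathThrough n _).symm

theorem IsTailInvariant.mass_eq {μ : Measure B.PathSpace} (h : B.IsTailInvariant μ) (n : ℕ)
    (v : B.Vertex) : mass μ n v = ∑ u, (B.F u v : ENNReal) * mass μ (n + 1) u := by
  have := measure_cyl_inter μ (pathThrough n v) n MeasurableSet.univ
  simp only [inter_univ, h.measure_cyl, vtx_extend] at this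
  rw [vtx_pathThrough] at this
  simpa using this

open Classical in
theorem IsTailInvariant.measure_cyl_inter_vtx {μ : Measure B.PathSpace} (h : B.IsTailInvariant μ)
    (x : B.PathSpace) (n k : ℕ) (w : B.Vertex) :
    μ (cyl x n ∩ {z | vtx z (n + k) = w}) =
      ((B.F ^ k) w (vtx x n) : ℕ) * mass μ (n + k) w :=
  StationaryBratteliDiagram.measure_cyl_inter_vtx μ w _ k n x fun z hz => by
    rw [h.measure_cyl, hz]

open Classical in
theorem IsTailInvariant.mass_eq_pow {μ : Measure B.PathSpace} (h : B.IsTailInvariant μ)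
    (n k : ℕ) (v : B.Vertex) :
    mass μ n v = ∑ w, ((B.F ^ k) w v : ENNReal) * mass μ (n + k) w := by
  have hU : cyl (pathThrough n v) n =
      ⋃ w, cyl (pathThrough n v) n ∩ {z | vtx z (n + k) = w} := by
    ext z; simp
  rw [mass, hU, measure_iUnion, tsum_fintype]
  · simp only [h.measure_cyl_inter_vtx, vtx_pathThrough]
  · intro w w' hw
    exact Set.disjoint_left.2 fun z hz hz' => hw (hz.2.symm.trans hz'.2)
  · exact fun w => (measurableSet_cyl _ _).inter (measurableSet_vtx _ _)

/-- The sets of vertices carrying positive, respectively finite, mass are periodic. -/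
theorem IsTailInvariant.exists_period {μ : Measure B.PathSpace} (h : B.IsTailInvariant μ) :
    ∃ p, 0 < p ∧ ∀ n v, (mass μ (p * n) v = 0 ↔ mass μ 0 v = 0) ∧
      (mass μ (p * n) v = ⊤ ↔ mass μ 0 v = ⊤) := by
  classical
  let s : ℕ → Set B.Vertex × Set B.Vertex := fun n => ({v | mass μ n v = 0}, {v | mass μ n v = ⊤})
  -- A mass is zero iff every successor along an edge has mass zero, and infinite iff some successor
  -- along an edge has infinite mass. The pattern is thus a fixed function of the next one.
  let g : Set B.Vertex × Set B.Vertex → Set B.Vertex × Set B.Vertex := fun S =>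
    ({v | ∀ u, B.F u v = 0 ∨ u ∈ S.1}, {v | ∃ u, B.F u v ≠ 0 ∧ u ∈ S.2})
  obtain ⟨p, hp, hs⟩ := exists_period_of_backward g s fun n => by
    refine Prod.ext ?_ ?_
    · ext v
      simp [s, g, h.mass_eq n v]
    · ext v
      simp only [s, g, h.mass_eq n v, mem_ofPred_eq, ENNReal.sum_eq_top, ENNReal.mul_eq_top]
      simp
  have hs' : ∀ n, s (p * n) = s 0 := by
    intro n
    induction n with
    | zero => rfl
    | succ n ih => rw [Nat.mul_succ, hs, ih]
  refine ⟨p, hp, fun n v => ⟨?_, ?_⟩⟩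
  · exact Set.ext_iff.1 (congrArg Prod.fst (hs' n)) v
  · exact Set.ext_iff.1 (congrArg Prod.snd (hs' n)) v

end StationaryBratteliDiagram

/-! ### Exponentially decaying sequences -/

/-- Sequences bounded by a geometric one. -/
def Decays (f : ℕ → ENNReal) : Prop :=
  ∃ K, 0 < K ∧ ∃ C : ENNReal, C ≠ ⊤ ∧ ∀ n, f n ≤ C * 2⁻¹ ^ (n / K)

theorem half_pow_anti {m n : ℕ} (h : m ≤ n) : (2⁻¹ : ENNReal) ^ n ≤ 2⁻¹ ^ m :=
  pow_le_pow_right_of_le_one' (by simp) h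

theorem Decays.mono {f g : ℕ → ENNReal} (hg : Decays g) (h : ∀ n, f n ≤ g n) : Decays f :=
  let ⟨K, hK, C, hC, hb⟩ := hg
  ⟨K, hK, C, hC, fun n => (h n).trans (hb n)⟩

theorem decays_zero : Decays fun _ => 0 := ⟨1, one_pos, 0, by simp, by simp⟩

theorem Decays.add {f g : ℕ → ENNReal} (hf : Decays f) (hg : Decays g) :
    Decays fun n => f n + g n := by
  obtain ⟨K, hK, C, hC, hb⟩ := hf
  obtain ⟨K', hK', C', hC', hb'⟩ := hg
  -- A larger block length only weakens a bound, so the product serves both sequences.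
  refine ⟨K * K', Nat.mul_pos hK hK', C + C', by simp [hC, hC'], fun n => ?_⟩
  rw [add_mul]
  refine add_le_add ((hb n).trans ?_) ((hb' n).trans ?_)
  · refine mul_le_mul' le_rfl ?_
    exact half_pow_anti (Nat.div_le_div_left (Nat.le_mul_of_pos_right K hK') hK)
  · refine mul_le_mul' le_rfl ?_
    exact half_pow_anti (Nat.div_le_div_left (Nat.le_mul_of_pos_left K' hK) hK')

theorem Decays.const_mul {f : ℕ → ENNReal} (hf : Decays f) {c : ENNReal} (hc : c ≠ ⊤) :
    Decays fun n => c * f n := by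
  obtain ⟨K, hK, C, hC, hb⟩ := hf
  exact ⟨K, hK, c * C, ENNReal.mul_ne_top hc hC, fun n => by rw [mul_assoc]; exact mul_le_mul' le_rfl (hb n)⟩

theorem decays_sum {ι : Type*} (s : Finset ι) {f : ι → ℕ → ENNReal} (h : ∀ i ∈ s, Decays (f i)) :
    Decays fun n => ∑ i ∈ s, f i n := by
  classical
  induction s using Finset.induction_on with
  | empty => simpa using decays_zero
  | insert i s hi ih =>
    simp only [Finset.sum_insert hi]
    exact (h i (by simp)).add (ih fun j hj => h j (by simp [hj]))

theorem Decays.shift {f : ℕ → ENNReal} (hf : Decays f) (k : ℕ) : Decays fun n => f (n + k) := by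
  obtain ⟨K, hK, C, hC, hb⟩ := hf
  refine ⟨K, hK, C, hC, fun n => (hb _).trans ?_⟩
  refine mul_le_mul' le_rfl ?_
  exact half_pow_anti (Nat.div_le_div_right (Nat.le_add_right n k))

theorem tsum_half_pow_div {K : ℕ} (hK : 0 < K) :
    ∑' j : ℕ, (2⁻¹ : ENNReal) ^ (j / K) ≠ ⊤ := by
  have : NeZero K := ⟨hK.ne'⟩
  have h : ∑' j : ℕ, (2⁻¹ : ENNReal) ^ (j / K) = ∑' a : ℕ × Fin K, (2⁻¹ : ENNReal) ^ a.1 :=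
    (Nat.divModEquiv K).tsum_eq (fun a : ℕ × Fin K => (2⁻¹ : ENNReal) ^ a.1)
  rw [h, ENNReal.tsum_prod (f := fun (a : ℕ) (_ : Fin K) => (2⁻¹ : ENNReal) ^ a)]
  simp only [tsum_fintype, Finset.sum_const, Finset.card_univ, Fintype.card_fin, nsmul_eq_mul]
  rw [ENNReal.tsum_mul_left, ENNReal.tsum_geometric]
  refine ENNReal.mul_ne_top (by simp) ?_
  simp

/-- Since $\lfloor n/K\rfloor+\lfloor j/K\rfloor\le\lfloor (n+j)/K\rfloor$, the factor depending on
`n` can be taken out and a convergent series in `j` remains. -/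
theorem Decays.tsum {f : ℕ → ENNReal} (hf : Decays f) {q : ℕ} (hq : 0 < q) :
    Decays fun n => ∑' j, f (n + (j + 1) * q) := by
  obtain ⟨K, hK, C, hC, hb⟩ := hf
  refine ⟨K, hK, C * ∑' j : ℕ, 2⁻¹ ^ (j / K),
    ENNReal.mul_ne_top hC (tsum_half_pow_div hK), fun n => ?_⟩
  rw [mul_right_comm, ← ENNReal.tsum_mul_left]
  refine ENNReal.tsum_le_tsum fun j => (hb _).trans ?_
  rw [mul_assoc, ← pow_add]
  refine mul_le_mul' le_rfl ?_
  refine half_pow_anti ((Nat.div_add_div_le_add_div (x := n) (y := j) (z := K)).trans (Nat.div_le_div_right ?_))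
  have : j ≤ (j + 1) * q := (Nat.le_succ j).trans (Nat.le_mul_of_pos_right _ hq)
  omega

theorem decays_of_two_mul_le {f : ℕ → ENNReal} {q : ℕ} (hq : 0 < q) (hfin : ∀ n, f n ≠ ⊤)
    (h : ∀ n, 2 * f (n + q) ≤ f n) : Decays f := by
  refine ⟨q, hq, ∑ i ∈ Finset.range q, f i, by simpa [ENNReal.sum_eq_top] using fun i _ => hfin i,
    fun n => ?_⟩
  have key : ∀ t s, f (s + q * t) ≤ f s * 2⁻¹ ^ t := by
    intro t s
    induction t with
    | zero => simp
    | succ t ih =>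
      have h1 : f (s + q * (t + 1)) ≤ 2⁻¹ * f (s + q * t) := by
        rw [Nat.mul_succ, ← add_assoc]
        calc f (s + q * t + q) = 2⁻¹ * (2 * f (s + q * t + q)) := by
              rw [← mul_assoc, ENNReal.inv_mul_cancel (by simp) (by simp), one_mul]
          _ ≤ _ := by gcongr; exact h _
      calc f (s + q * (t + 1)) ≤ 2⁻¹ * (f s * 2⁻¹ ^ t) := h1.trans (by gcongr)
        _ = f s * 2⁻¹ ^ (t + 1) := by rw [pow_succ]; ring
  calc f n = f (n % q + q * (n / q)) := by rw [Nat.mod_add_div]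
    _ ≤ f (n % q) * 2⁻¹ ^ (n / q) := key _ _
    _ ≤ _ := by
      gcongr
      exact Finset.single_le_sum (f := f) (fun _ _ => zero_le)
        (Finset.mem_range.2 (Nat.mod_lt n hq))

/-! ### Decay of masses along a non-negative integer matrix -/

section MatrixDecay

variable {V : Type*} [Fintype V] [DecidableEq V] (A : Matrix V V ℕ)

theorem matrix_pow_mul_le (k l : ℕ) (u v w : V) :
    (A ^ l) u w * (A ^ k) w v ≤ (A ^ (l + k)) u v := by
  rw [pow_add, Matrix.mul_apply]
  exact Finset.single_le_sum (f := fun w => (A ^ l) u w * (A ^ k) w v) (fun _ _ => Nat.zero_le _)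
    (Finset.mem_univ w)

theorem matrix_pow_mul_add_le (k l : ℕ) (u v : V) {w w' : V} (h : w ≠ w') :
    (A ^ l) u w * (A ^ k) w v + (A ^ l) u w' * (A ^ k) w' v ≤ (A ^ (l + k)) u v := by
  rw [pow_add, Matrix.mul_apply, ← Finset.sum_pair h
    (f := fun w => (A ^ l) u w * (A ^ k) w v)]
  exact Finset.sum_le_sum_of_subset (Finset.subset_univ _)

/-- Two closed walks at `v` of the same length are obtained by doing the loop of length `q` last or
first, the other part being the round trip through `w`. They differ at time `q`, where one is at `v`
and the other at `w`. -/
theorem two_le_pow_of_two_cycles {q l : ℕ} {v w : V} (hv : 0 < (A ^ q) v v)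
    (hvw : 0 < (A ^ q) w v) (hwv : 0 < (A ^ l) v w) (hne : w ≠ v) :
    2 ≤ (A ^ ((q + l) + q)) v v := by
  have h1 := matrix_pow_mul_add_le A q (q + l) v v hne.symm
  have h2 : 0 < (A ^ (q + l)) v v := by
    have := matrix_pow_mul_le A q l v v w
    rw [add_comm l q] at this
    exact (Nat.mul_pos hwv hvw).trans_le this
  have h3 : 0 < (A ^ (q + l)) v w :=
    (Nat.mul_pos hv hwv).trans_le (matrix_pow_mul_le A l q v w v)
  have := Nat.mul_pos h2 hv
  have := Nat.mul_pos h3 hvw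
  omega

variable {A} {a : ℕ → V → ENNReal}

/-- Induction on the number of vertices reachable from `v`. If some power has diagonal entry at
least two at `v`, the mass there is finite by assumption and at least halves every `q` steps. If a
single cycle passes through `v`, the edges leaving it cannot lead back, since this would make two
cycles; the masses at the exits decay by induction and `h3` sums them. If no cycle passes through
`v`, its successors decay by induction. -/
theorem decays_of_not_rich (h1 : ∀ n k v, a n v = ∑ w, ((A ^ k) w v : ENNReal) * a (n + k) w)
    (h2 : ∀ n v, a n v = ⊤ ↔ a 0 v = ⊤)
    (h3 : ∀ q v, 0 < q → (A ^ q) v v = 1 → ∀ n, a n v ≤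
      ∑' j : ℕ, ∑ w ∈ Finset.univ.erase v, ((A ^ q) w v : ENNReal) * a (n + (j + 1) * q) w)
    (v : V) (h : ∀ k w, 0 < (A ^ k) w v → a 0 w = ⊤ → ∀ q, 0 < q → (A ^ q) w w < 2) :
    Decays fun n => a n v := by
  classical
  induction hc : (Finset.univ.filter fun w => ∃ k, 0 < (A ^ k) w v).card
    using Nat.strong_induction_on generalizing v with
  | _ c ih =>
  subst hc
  -- A vertex that is reachable from `v` but cannot return reaches strictly fewer vertices: `v`
  -- itself is missing.
  have hrec : ∀ k w, 0 < (A ^ k) w v → (∀ l, (A ^ l) v w = 0) →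
      Decays (fun n => a n w) := by
    intro k w hw hv
    refine ih _ (Finset.card_lt_card ?_) w (fun l u hu => h (l + k) u
      ((Nat.mul_pos hu hw).trans_le (matrix_pow_mul_le A k l u v w))) rfl
    refine Finset.ssubset_iff_of_subset ?_ |>.2 ⟨v, ?_, ?_⟩
    · intro u
      simp only [Finset.mem_filter_univ]
      rintro ⟨l, hu⟩
      exact ⟨l + k, (Nat.mul_pos hu hw).trans_le (matrix_pow_mul_le A k l u v w)⟩
    · simp only [Finset.mem_filter_univ]
      exact ⟨0, by simp⟩
    · simp [hv]
  by_cases hrich : ∃ q, 0 < q ∧ 2 ≤ (A ^ q) v v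
  · obtain ⟨q, hq, hq2⟩ := hrich
    have hfin : a 0 v ≠ ⊤ := fun htop => absurd (h 0 v (by simp) htop q hq) (by omega)
    refine decays_of_two_mul_le hq (fun n => fun htop => hfin ((h2 n v).1 htop)) fun n => ?_
    rw [h1 n q v]
    refine le_trans ?_ (Finset.single_le_sum (f := fun w => ((A ^ q) w v : ENNReal) * a (n + q) w)
      (fun _ _ => zero_le) (Finset.mem_univ v))
    gcongr
    exact_mod_cast hq2
  push Not at hrich
  by_cases hloop : ∃ q, 0 < q ∧ (A ^ q) v v ≠ 0
  · obtain ⟨q, hq, hq1⟩ := hloop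
    have hq1 : (A ^ q) v v = 1 := by have := hrich q hq; omega
    have hR : Decays fun n => ∑ w ∈ Finset.univ.erase v, ((A ^ q) w v : ENNReal) * a n w := by
      refine decays_sum _ fun w hw => ?_
      rcases Nat.eq_zero_or_pos ((A ^ q) w v) with h0 | hpos
      · simpa [h0] using decays_zero
      · refine (hrec q w hpos fun l => ?_).const_mul (by simp)
        by_contra hl
        have := two_le_pow_of_two_cycles A (by omega) hpos (Nat.pos_of_ne_zero hl)
          (Finset.ne_of_mem_erase hw)
        have := hrich (q + l + q) (by omega)
        omega
    exact (hR.tsum hq).mono fun n => h3 q v hq hq1 n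
  · push Not at hloop
    refine (decays_sum Finset.univ (f := fun w n => ((A ^ 1) w v : ENNReal) * a (n + 1) w)
      fun w _ => ?_).mono fun n => (h1 n 1 v).le
    rcases Nat.eq_zero_or_pos ((A ^ 1) w v) with h0 | hpos
    · simpa [h0] using decays_zero
    · refine ((hrec 1 w hpos fun l => ?_).shift 1).const_mul (by simp)
      by_contra hl
      have := matrix_pow_mul_le A 1 l v v w
      rw [hloop (l + 1) (by omega)] at this
      have := Nat.mul_pos (Nat.pos_of_ne_zero hl) hpos
      omega

theorem exists_rich_of_top (h1 : ∀ n k v, a n v = ∑ w, ((A ^ k) w v : ENNReal) * a (n + k) w)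
    (h2 : ∀ n v, a n v = ⊤ ↔ a 0 v = ⊤)
    (h3 : ∀ q v, 0 < q → (A ^ q) v v = 1 → ∀ n, a n v ≤
      ∑' j : ℕ, ∑ w ∈ Finset.univ.erase v, ((A ^ q) w v : ENNReal) * a (n + (j + 1) * q) w)
    {v : V} (hv : a 0 v = ⊤) :
    ∃ k w q, 0 < (A ^ k) w v ∧ a 0 w = ⊤ ∧ 0 < q ∧ 2 ≤ (A ^ q) w w := by
  by_contra! hcon
  obtain ⟨K, -, C, hC, hb⟩ := decays_of_not_rich h1 h2 h3 v fun k w h h' q hq => hcon k w q h h' hq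
  have := hb 0
  simp only [hv, Nat.zero_div, pow_zero, mul_one, top_le_iff] at this
  exact hC this

end MatrixDecay

/-! ### Splitting clopen sets of infinite measure -/

namespace StationaryBratteliDiagram

variable {B : StationaryBratteliDiagram}

-- As `v` has only one closed walk of length `b`, the paths found at `v` after each of the first `j`
-- turns lie in a single cylinder of growing length. At most one path never leaves this cycle, and
-- points are null; every other path is counted at the first turn that ends elsewhere.
open Classical in
theorem IsTailInvariant.mass_le_tsum {μ : Measure B.PathSpace} (h : B.IsTailInvariant μ)
    (hna : ∀ x, μ {x} = 0) {b : ℕ} (hb : 0 < b) {v : B.Vertex} (hv : (B.F ^ b) v v = 1) (m : ℕ) :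
    mass μ m v ≤ ∑' j : ℕ, ∑ w ∈ Finset.univ.erase v,
      ((B.F ^ b) w v : ENNReal) * mass μ (m + (j + 1) * b) w := by
  set x : B.PathSpace := pathThrough m v with hx
  have hxv : vtx x m = v := vtx_pathThrough m v
  let E : ℕ → Set B.PathSpace := fun j => {z | z ∈ cyl x m ∧ ∀ i ≤ j, vtx z (m + i * b) = v}
  have hE : ∀ j, ∀ z ∈ E j, ∀ z' ∈ E j, z' ∈ cyl z (m + j * b) := by
    intro j
    induction j with
    | zero =>
      intro z hz z' hz'
      rw [Nat.zero_mul, add_zero, cyl_eq_of_mem hz.1]; exact hz'.1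
    | succ j ih =>
      intro z hz z' hz'
      have hz'z := ih z ⟨hz.1, fun i hi => hz.2 i (by omega)⟩ z'
        ⟨hz'.1, fun i hi => hz'.2 i (by omega)⟩
      have e : m + (j + 1) * b = m + j * b + b := by ring
      rw [e]
      refine mem_cyl_of_pow_le_one (w := v) (x := z) ?_ (mem_cyl_self _ _) hz'z ?_ ?_
      · rw [hz.2 j (by omega), hv]
      · rw [← e]; exact hz.2 _ le_rfl
      · rw [← e]; exact hz'.2 _ le_rfl
  have hstep : ∀ j, μ (E j \ E (j + 1)) ≤ ∑ w ∈ Finset.univ.erase v,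
      ((B.F ^ b) w v : ENNReal) * mass μ (m + (j + 1) * b) w := by
    intro j
    have e : m + (j + 1) * b = m + j * b + b := by ring
    rcases (E j).eq_empty_or_nonempty with h0 | ⟨z, hz⟩
    · simp [h0]
    have hsub : E j \ E (j + 1) ⊆ ⋃ w ∈ Finset.univ.erase v,
        cyl z (m + j * b) ∩ {y | vtx y (m + j * b + b) = w} := by
      intro y hy
      refine mem_iUnion₂.2 ⟨vtx y (m + j * b + b), ?_, hE j z hz y hy.1, rfl⟩
      refine Finset.mem_erase.2 ⟨fun hyv => hy.2 ⟨hy.1.1, fun i hi => ?_⟩, Finset.mem_univ _⟩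
      rcases Nat.lt_or_ge j i with hij | hij
      · obtain rfl : i = j + 1 := by omega
        rw [e, hyv]
      · exact hy.1.2 i hij
    refine (measure_mono hsub).trans ((measure_biUnion_finset_le _ _).trans ?_)
    refine Finset.sum_le_sum fun w _ => ?_
    rw [h.measure_cyl_inter_vtx, hz.2 j le_rfl, e]
  have hInter : μ (⋂ j, E j) = 0 := by
    rcases (⋂ j, E j).eq_empty_or_nonempty with h0 | ⟨z, hz⟩
    · simp [h0]
    refine measure_mono_null (t := {z}) (fun y hy => ?_) (hna z)
    rw [← iInter_cyl]
    refine mem_iInter.2 fun n => ?_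
    have := hE n z (mem_iInter.1 hz n) y (mem_iInter.1 hy n)
    exact cyl_anti z ((Nat.le_mul_of_pos_right n hb).trans (Nat.le_add_left _ _)) this
  have hcover : cyl x m ⊆ (⋂ j, E j) ∪ ⋃ j, E j \ E (j + 1) := by
    intro z hz
    by_cases hall : ∀ j, z ∈ E j
    · exact Or.inl (mem_iInter.2 hall)
    · push Not at hall
      have h0 : z ∈ E 0 := ⟨hz, fun i hi => by
        rw [Nat.le_zero.1 hi, Nat.zero_mul, add_zero, vtx_eq_of_mem hz, hxv]⟩
      obtain ⟨j, hj, hmin⟩ : ∃ j, z ∉ E j ∧ ∀ i < j, z ∈ E i :=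
        ⟨Nat.find hall, Nat.find_spec hall, fun i hi => not_not.1 (Nat.find_min hall hi)⟩
      cases j with
      | zero => exact absurd h0 hj
      | succ j => exact Or.inr (mem_iUnion.2 ⟨j, hmin j j.lt_succ_self, hj⟩)
  calc mass μ m v ≤ μ (⋂ j, E j) + μ (⋃ j, E j \ E (j + 1)) :=
        (measure_mono hcover).trans (measure_union_le _ _)
    _ ≤ 0 + ∑' j, μ (E j \ E (j + 1)) := by
        rw [hInter]; gcongr; exact measure_iUnion_le _
    _ ≤ _ := by rw [zero_add]; exact ENNReal.tsum_le_tsum hstep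

theorem IsTailInvariant.splitsInfinite {μ : Measure B.PathSpace} (h : B.IsTailInvariant μ)
    (hna : ∀ x, μ {x} = 0) : SplitsInfinite μ := by
  classical
  obtain ⟨p, hp, hper⟩ := h.exists_period
  intro A hA htop
  obtain ⟨N, hN⟩ := exists_level_of_isClopen hA
  have hlev := hN (p * N) (Nat.le_mul_of_pos_left N hp)
  obtain ⟨t, htA, hAt⟩ := exists_finset_cyl hlev
  obtain ⟨x, hxA, hx⟩ : ∃ x ∈ A, μ (cyl x (p * N)) = ⊤ := by
    by_contra! hcon
    rw [hAt] at htop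
    exact ((measure_biUnion_finset_le t _).trans_lt
      (ENNReal.sum_lt_top.2 fun x hx => (hcon x (htA x hx)).lt_top)).ne htop
  rw [h.measure_cyl] at hx
  -- The set of infinite vertices is constant only along multiples of `p`, hence the telescoped
  -- matrix. Two different closed walks at the infinite vertex `w` then give two disjoint cylinders
  -- of infinite measure inside `A`.
  obtain ⟨k, w, q, hk, hw, hq, hq2⟩ := exists_rich_of_top (A := B.F ^ p)
    (a := fun n v => mass μ (p * n) v) (v := vtx x (p * N))
    (fun n k v => by simpa only [← pow_mul, Nat.mul_add] using h.mass_eq_pow (p * n) (p * k) v)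
    (fun n v => by simpa using (hper n v).2)
    (fun q v hq hv n => by
      simp only [← pow_mul] at hv ⊢
      refine (h.mass_le_tsum hna (Nat.mul_pos hp hq) hv (p * n)).trans_eq ?_
      refine tsum_congr fun j => ?_
      rw [show p * (n + (j + 1) * q) = p * n + (j + 1) * (p * q) by ring])
    (by simpa using (hper N _).2.1 hx)
  rw [← pow_mul] at hk hq2
  obtain ⟨z, hz, hzw⟩ := exists_of_pow_pos hk
  rw [← hzw] at hq2
  obtain ⟨y, hy, y', hy', hyw, hyw', hd⟩ := exists_two_of_pow hq2
  have hsub : ∀ y ∈ cyl z (p * N + p * k), cyl y (p * N + p * k + p * q) ⊆ A := fun y hy =>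
    (cyl_subset_of_mem hy (by omega)).trans
      ((cyl_subset_of_mem hz (by omega)).trans (hlev x hxA))
  have hinf : ∀ y : B.PathSpace, vtx y (p * N + p * k + p * q) = vtx z (p * N + p * k) →
      μ (cyl y (p * N + p * k + p * q)) = ⊤ := by
    intro y hy
    rw [h.measure_cyl, hy, hzw, ← Nat.mul_add, ← Nat.mul_add, (hper _ _).2]
    simpa using hw
  refine ⟨cyl y _, isClopen_cyl y _, hsub y hy, hinf y hyw, ?_⟩
  exact measure_mono_top (subset_sdiff.2 ⟨hsub y' hy', hd.symm⟩) (hinf y' hyw')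

theorem mem_of_forall_cyl_inter {Z : Set B.PathSpace} (hZ : IsClosed Z) {y : B.PathSpace}
    (h : ∀ n, (cyl y n ∩ Z).Nonempty) : y ∈ Z := by
  by_contra hy
  obtain ⟨n, hn⟩ := exists_cyl_subset (hZ.isOpen_compl.mem_nhds hy)
  obtain ⟨z, hz, hzZ⟩ := h n
  exact hn hz hzZ

/-! ### Minimal components and orbit equivalence -/

theorem OrbitEquivalent.symm {C : StationaryBratteliDiagram} (h : B.OrbitEquivalent C) :
    C.OrbitEquivalent B := by
  obtain ⟨h, hh⟩ := h
  exact ⟨h.symm, fun x y => by rw [hh]; simp⟩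

theorem image_closed_saturated {C : StationaryBratteliDiagram} {h : B.PathSpace ≃ₜ C.PathSpace}
    (hh : ∀ x y, B.Tail x y ↔ C.Tail (h x) (h y)) {Z : Set B.PathSpace}
    (hZ : Z.Nonempty ∧ IsClosed Z ∧ B.IsSaturated Z) :
    (h '' Z).Nonempty ∧ IsClosed (h '' Z) ∧ C.IsSaturated (h '' Z) := by
  refine ⟨hZ.1.image h, (h.isClosed_image).2 hZ.2.1, ?_⟩
  rintro _ y hxy ⟨x, hx, rfl⟩
  exact ⟨h.symm y, hZ.2.2 x _ ((hh _ _).2 (by simpa using hxy)) hx, by simp⟩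

theorem isMinimalComponent_image {C : StationaryBratteliDiagram} {h : B.PathSpace ≃ₜ C.PathSpace}
    (hh : ∀ x y, B.Tail x y ↔ C.Tail (h x) (h y)) {Z : Set B.PathSpace}
    (hZ : B.IsMinimalComponent Z) : C.IsMinimalComponent (h '' Z) := by
  refine ⟨image_closed_saturated hh hZ.1, fun Y hY hYZ => ?_⟩
  have hh' : ∀ x y, C.Tail x y ↔ B.Tail (h.symm x) (h.symm y) := fun x y => by rw [hh]; simp
  have h1 := hZ.2 (image_closed_saturated hh' hY) (by
    rintro _ ⟨y, hy, rfl⟩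
    obtain ⟨z, hz, rfl⟩ := hYZ hy
    simpa using hz)
  rintro _ ⟨z, hz, rfl⟩
  obtain ⟨y, hy, rfl⟩ := h1 hz
  simpa using hy

theorem OrbitEquivalent.encard_le {C : StationaryBratteliDiagram} (h : B.OrbitEquivalent C) :
    {Z | B.IsMinimalComponent Z}.encard ≤ {Z | C.IsMinimalComponent Z}.encard := by
  obtain ⟨h, hh⟩ := h
  exact encard_le_encard_of_injOn (f := fun Z => h '' Z)
    (fun Z hZ => isMinimalComponent_image hh hZ) h.injective.image_injective.injOn

theorem OrbitEquivalent.encard_eq {C : StationaryBratteliDiagram} (h : B.OrbitEquivalent C) :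
    {Z | B.IsMinimalComponent Z}.encard = {Z | C.IsMinimalComponent Z}.encard :=
  h.encard_le.antisymm h.symm.encard_le

theorem OrbitEquivalent.refl (B : StationaryBratteliDiagram) : B.OrbitEquivalent B :=
  ⟨Homeomorph.refl _, fun _ _ => Iff.rfl⟩

/-! ### Telescoped diagrams with additional loops -/

/-- The `k`-th block of `p` consecutive edges of a path. -/
def blockOf (p : ℕ) (z : B.PathSpace) (k : ℕ) : Fin p → B.Edge := fun i => z.1.2 (p * k + i)

/-- The blocks of `p` consecutive edges leading from `u` to `w`. -/
def Block (B : StationaryBratteliDiagram) (p : ℕ) (u w : B.Vertex) : Type :=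
  {e : Fin p → B.Edge //
    ∃ z k, vtx z (p * k) = u ∧ vtx z (p * (k + 1)) = w ∧ e = blockOf p z k}

instance (p : ℕ) (u w : B.Vertex) : Finite (B.Block p u w) :=
  inferInstanceAs (Finite {e : Fin p → B.Edge //
    ∃ z k, vtx z (p * k) = u ∧ vtx z (p * (k + 1)) = w ∧ e = blockOf p z k})

/-- The data from which a telescoping of a part of a diagram is built and extended by finitely
many vertices with loops. -/
structure TowerData (B : StationaryBratteliDiagram) where
  p : ℕ
  p_pos : 0 < p
  U : Set B.Vertex
  exists_block : ∀ u ∈ U, ∃ w ∈ U, Nonempty (B.Block p u w)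
  N : ℕ
  two_le : 2 ≤ N
  i : ℕ
  i_pos : 0 < i

namespace TowerData

variable (D : TowerData B)

/-- The edge multiplicities: blocks between the vertices of `U`, and `i` additional vertices, each
with `N` loops and one edge to each vertex of `U`. -/
noncomputable def multiplicity : Matrix (D.U ⊕ Fin D.i) (D.U ⊕ Fin D.i) ℕ
  | .inl w, .inl u => Nat.card (B.Block D.p u w)
  | .inr _, .inl _ => 0
  | .inl _, .inr _ => 1
  | .inr j, .inr j' => if j = j' then D.N else 0

/-- The telescoped diagram with additional vertices. -/
noncomputable def diagram : StationaryBratteliDiagram where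
  Vertex := D.U ⊕ Fin D.i
  fintypeVertex := Fintype.ofFinite _
  nonemptyVertex := ⟨.inr ⟨0, D.i_pos⟩⟩
  hat _ := 1
  F := D.multiplicity
  hat_pos _ := one_pos
  exists_in
    | .inl _ => ⟨.inr ⟨0, D.i_pos⟩, one_pos⟩
    | .inr j => ⟨.inr j, by have := D.two_le; simp only [multiplicity, if_true]; omega⟩
  exists_out
    | .inl u => by
      obtain ⟨w, hw, hb⟩ := D.exists_block u u.2
      exact ⟨.inl ⟨w, hw⟩, Nat.card_pos⟩
    | .inr j => ⟨.inr j, by have := D.two_le; simp only [multiplicity, if_true]; omega⟩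

variable {D}

theorem vtx_ne_inr {v w : D.U ⊕ Fin D.i} (h : 0 < D.multiplicity v w) {j : Fin D.i}
    (hv : v = .inr j) : w = .inr j := by
  subst hv
  cases w with
  | inl u => exact absurd h (lt_irrefl 0)
  | inr j' =>
    by_contra hne
    have : ¬ j = j' := fun h => hne (by rw [h])
    simp [multiplicity, this] at h

theorem vtx_inr_of_succ {y : D.diagram.PathSpace} {n : ℕ} {j : Fin D.i}
    (h : vtx y (n + 1) = .inr j) : vtx y n = .inr j := by
  rw [vtx_succ] at h
  exact vtx_ne_inr (edge_pos (y.1.2 n)) h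

theorem vtx_inr_of_le {y : D.diagram.PathSpace} {m n : ℕ} (hmn : m ≤ n) {j : Fin D.i}
    (h : vtx y n = .inr j) : vtx y m = .inr j := by
  induction n, hmn using Nat.le_induction with
  | base => exact h
  | succ n _ ih => exact ih (vtx_inr_of_succ h)

theorem exists_inl_of_le {y : D.diagram.PathSpace} {m n : ℕ} (hmn : m ≤ n) {u : D.U}
    (h : vtx y m = .inl u) : ∃ w, vtx y n = .inl w := by
  cases hn : vtx y n with
  | inl w => exact ⟨w, rfl⟩
  | inr j => rw [vtx_inr_of_le hmn hn] at h; cases h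

/-- The loop edges at the additional vertices. -/
noncomputable def loopEdge (j : Fin D.i) (l : Fin D.N) : D.diagram.Edge :=
  ⟨.inr j, .inr j, Fin.cast (by simp [diagram, multiplicity]) l⟩

/-- The edge leading from an additional vertex to a vertex of `U`. -/
noncomputable def entryEdge (j : Fin D.i) (u : D.U) : D.diagram.Edge :=
  ⟨.inr j, .inl u, ⟨0, one_pos⟩⟩

/-- The paths that never leave an additional vertex. -/
def loopSet (D : TowerData B) (j : Fin D.i) : Set D.diagram.PathSpace :=
  {y | ∀ n, vtx y n = .inr j}

theorem loopSet_nonempty (j : Fin D.i) : (D.loopSet j).Nonempty :=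
  ⟨⟨(⟨.inr j, ⟨0, one_pos⟩⟩, fun _ => loopEdge j ⟨0, by have := D.two_le; omega⟩),
    rfl, fun _ => rfl⟩, fun _ => rfl⟩

theorem isClosed_loopSet (j : Fin D.i) : IsClosed (D.loopSet j) := by
  have : D.loopSet j = ⋂ n, {y : D.diagram.PathSpace | vtx y n ∈ ({.inr j} : Set _)} := by
    ext y; simp only [loopSet, mem_iInter]; rfl
  rw [this]
  exact isClosed_iInter fun n => (isClopen_vtx n _).1

theorem isSaturated_loopSet (j : Fin D.i) : D.diagram.IsSaturated (D.loopSet j) := by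
  rintro x y ⟨N, hN⟩ hx n
  refine vtx_inr_of_le (le_max_left n N) ?_
  have : vtx x (max n N) = vtx y (max n N) := congrArg Edge.source (hN _ (le_max_right n N))
  rw [← this]; exact hx _

theorem loopSet_injective : Function.Injective D.loopSet := by
  intro j j' h
  obtain ⟨y, hy⟩ := loopSet_nonempty j
  have h1 := hy 0
  rw [h] at hy
  exact Sum.inr_injective (h1.symm.trans (hy 0))

/-- If a path `y` in `Z` enters `U`, a looping path can be followed arbitrarily long, then left by
the edge to the current vertex of `y`, and continued as `y`; these paths are tail equivalent to `y`
and converge to the looping path. If `y` never enters `U` it stays at one added vertex, and splicing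
with `y` approximates every path looping there. -/
theorem exists_loopSet_subset {Z : Set D.diagram.PathSpace}
    (hZ : Z.Nonempty ∧ IsClosed Z ∧ D.diagram.IsSaturated Z) : ∃ j, D.loopSet j ⊆ Z := by
  obtain ⟨⟨y, hy⟩, hc, hs⟩ := hZ
  by_cases h : ∃ n u, vtx y n = .inl u
  · obtain ⟨n₀, u₀, hu₀⟩ := h
    refine ⟨⟨0, D.i_pos⟩, fun z hz => mem_of_forall_cyl_inter hc fun n => ?_⟩
    obtain ⟨u, hu⟩ := exists_inl_of_le (show n₀ ≤ max n n₀ + 1 by omega) hu₀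
    have he : (entryEdge ⟨0, D.i_pos⟩ u : D.diagram.Edge).source = vtx z (max n n₀) :=
      (hz _).symm
    have hv : vtx (extend z _ _ he) (max n n₀ + 1) = vtx y (max n n₀ + 1) := by
      rw [vtx_extend, hu]; rfl
    refine ⟨splice (max n n₀ + 1) (extend z _ _ he) y, ?_, hs y _ (splice_tail hv) hy⟩
    exact cyl_subset_of_mem (cyl_anti z (le_max_left n n₀) (extend_mem z _ _ he)) (by omega)
      (splice_mem_cyl _ _ _)
  · have hinr : ∀ n, ∃ j, vtx y n = .inr j := by
      intro n
      cases hn : vtx y n with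
      | inl u => exact absurd ⟨n, u, hn⟩ h
      | inr j => exact ⟨j, rfl⟩
    obtain ⟨j, hj⟩ := hinr 0
    have hyj : ∀ n, vtx y n = .inr j := by
      intro n
      obtain ⟨j', hj'⟩ := hinr n
      rw [hj', ← hj, vtx_inr_of_le (Nat.zero_le n) hj']
    refine ⟨j, fun z hz => mem_of_forall_cyl_inter hc fun n => ?_⟩
    exact ⟨splice n z y, splice_mem_cyl _ _ _,
      hs y _ (splice_tail ((hz n).trans (hyj n).symm)) hy⟩

theorem isMinimalComponent_iff {Z : Set D.diagram.PathSpace} :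
    D.diagram.IsMinimalComponent Z ↔ Z ∈ range D.loopSet := by
  have hmem : ∀ j, (D.loopSet j).Nonempty ∧ IsClosed (D.loopSet j) ∧
      D.diagram.IsSaturated (D.loopSet j) := fun j =>
    ⟨loopSet_nonempty j, isClosed_loopSet j, isSaturated_loopSet j⟩
  constructor
  · intro h
    obtain ⟨j, hj⟩ := exists_loopSet_subset h.1
    exact ⟨j, hj.antisymm (h.2 (hmem j) hj)⟩
  · rintro ⟨j, rfl⟩
    refine ⟨hmem j, fun Y hY hYj => ?_⟩
    obtain ⟨j', hj'⟩ := exists_loopSet_subset hY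
    obtain ⟨y, hy⟩ := loopSet_nonempty j'
    obtain rfl : j' = j := Sum.inr_injective ((hy 0).symm.trans (hYj (hj' hy) 0))
    exact hj'

theorem encard_minimalComponents :
    {Z | D.diagram.IsMinimalComponent Z}.encard = D.i := by
  have : {Z | D.diagram.IsMinimalComponent Z} = range D.loopSet :=
    Set.ext fun Z => isMinimalComponent_iff
  rw [this, ← image_univ, loopSet_injective.encard_image, encard_univ, ENat.card_eq_coe_fintype_card,
    Fintype.card_fin]

end TowerData

/-! ### Coding tails of paths by blocks -/

theorem blockOf_congr {p k : ℕ} {z z' : B.PathSpace} (h : z' ∈ cyl z (p * (k + 1))) :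
    blockOf p z' k = blockOf p z k := by
  funext i
  exact h.2 _ (by rw [Nat.mul_succ]; have := i.2; omega)

theorem vtx_start_of_blockOf_eq {p k k' : ℕ} (hp : 0 < p) {z z' : B.PathSpace}
    (h : blockOf p z k = blockOf p z' k') : vtx z (p * k) = vtx z' (p * k') :=
  congrArg Edge.source (congrFun h ⟨0, hp⟩)

theorem vtx_end_eq_range {p : ℕ} (hp : 0 < p) (z : B.PathSpace) (k : ℕ) :
    vtx z (p * (k + 1)) = (blockOf p z k ⟨p - 1, by omega⟩).range := by
  rw [show p * (k + 1) = (p * k + (p - 1)) + 1 by rw [Nat.mul_succ]; omega, vtx_succ]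
  rfl

theorem vtx_end_of_blockOf_eq {p k k' : ℕ} (hp : 0 < p) {z z' : B.PathSpace}
    (h : blockOf p z k = blockOf p z' k') : vtx z (p * (k + 1)) = vtx z' (p * (k' + 1)) := by
  rw [vtx_end_eq_range hp, vtx_end_eq_range hp, h]

theorem mem_cyl_of_blockOf_eq {p n L : ℕ} (hp : 0 < p) {z z' : B.PathSpace}
    (h : z' ∈ cyl z (p * n)) (hb : ∀ k, n ≤ k → k < L → blockOf p z' k = blockOf p z k) :
    z' ∈ cyl z (p * L) := by
  refine ⟨h.1, fun j hj => ?_⟩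
  rcases lt_or_ge j (p * n) with hjn | hjn
  · exact h.2 j hjn
  · have := congrFun (hb (j / p) ((Nat.le_div_iff_mul_le hp).2 (by rwa [mul_comm]))
      (Nat.div_lt_of_lt_mul hj)) ⟨j % p, Nat.mod_lt j hp⟩
    simpa [blockOf, Nat.div_add_mod] using this

namespace TowerData

variable {D : TowerData B}

/-- The edge of the telescoped diagram that stands for a block. -/
noncomputable def mkEdge (u w : D.U) (b : B.Block D.p u w) : D.diagram.Edge :=
  ⟨.inl u, .inl w, Finite.equivFin (B.Block D.p u w) b⟩

theorem mkEdge_inj {u w u' w' : D.U} {b : B.Block D.p u w} {b' : B.Block D.p u' w'}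
    (h : mkEdge u w b = mkEdge u' w' b') : b.1 = b'.1 := by
  obtain rfl : u = u' := Sum.inl_injective (congrArg Edge.source h)
  obtain rfl : w = w' := Sum.inl_injective (congrArg Edge.range h)
  have h' : Finite.equivFin (B.Block D.p u w) b = Finite.equivFin (B.Block D.p u w) b' :=
    eq_of_heq (Edge.mk.inj h).2.2
  exact congrArg Subtype.val ((Finite.equivFin _).injective h')

theorem mkEdge_congr {u w u' w' : D.U} {b : B.Block D.p u w} {b' : B.Block D.p u' w'}
    (hu : u = u') (hw : w = w') (h : b.1 = b'.1) : mkEdge u w b = mkEdge u' w' b' := by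
  subst hu hw
  rw [show b = b' from Subtype.ext h]

theorem exists_mkEdge {e : D.diagram.Edge} {u w : D.U} (he : e.source = .inl u)
    (hr : e.range = .inl w) : ∃ b, e = mkEdge u w b := by
  obtain ⟨s, r, l⟩ := e
  obtain rfl : s = .inl u := he
  obtain rfl : r = .inl w := hr
  obtain ⟨b, hb⟩ := (Finite.equivFin (B.Block D.p u w)).surjective l
  exact ⟨b, by rw [mkEdge, hb]⟩

open Classical in
/-- The edge of the telescoped diagram that stands for the `k`-th block of a path. -/
noncomputable def code (D : TowerData B) (z : B.PathSpace) (k : ℕ) : D.diagram.Edge :=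
  if h : vtx z (D.p * k) ∈ D.U ∧ vtx z (D.p * (k + 1)) ∈ D.U then
    mkEdge ⟨_, h.1⟩ ⟨_, h.2⟩ ⟨blockOf D.p z k, z, k, rfl, rfl, rfl⟩
  else outEdge (.inr ⟨0, D.i_pos⟩)

theorem code_of_mem {z : B.PathSpace} {k : ℕ} (h : vtx z (D.p * k) ∈ D.U)
    (h' : vtx z (D.p * (k + 1)) ∈ D.U) :
    D.code z k = mkEdge ⟨_, h⟩ ⟨_, h'⟩ ⟨blockOf D.p z k, z, k, rfl, rfl, rfl⟩ :=
  dif_pos ⟨h, h'⟩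

theorem code_congr {z z' : B.PathSpace} {k : ℕ} (h : vtx z (D.p * k) ∈ D.U)
    (h' : vtx z (D.p * (k + 1)) ∈ D.U) (hb : blockOf D.p z k = blockOf D.p z' k) :
    D.code z k = D.code z' k := by
  have e := vtx_start_of_blockOf_eq D.p_pos hb
  have e' := vtx_end_of_blockOf_eq D.p_pos hb
  rw [code_of_mem h h', code_of_mem (e ▸ h) (e' ▸ h')]
  exact mkEdge_congr (Subtype.ext e) (Subtype.ext e') hb

theorem blockOf_eq_of_code_eq {z z' : B.PathSpace} {k : ℕ} (h : vtx z (D.p * k) ∈ D.U)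
    (h' : vtx z (D.p * (k + 1)) ∈ D.U) (g : vtx z' (D.p * k) ∈ D.U)
    (g' : vtx z' (D.p * (k + 1)) ∈ D.U) (hc : D.code z k = D.code z' k) :
    blockOf D.p z k = blockOf D.p z' k := by
  rw [code_of_mem h h', code_of_mem g g'] at hc
  exact mkEdge_inj hc

/-- The paths that visit `U` at all levels `p * k + 1` with `n ≤ k`. -/
def staySet (D : TowerData B) (n : ℕ) : Set B.PathSpace :=
  {z | ∀ k, n ≤ k → vtx z (D.p * k) ∈ D.U}

theorem staySet_mono {m n : ℕ} (h : m ≤ n) : D.staySet m ⊆ D.staySet n :=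
  fun _ hz k hk => hz k (h.trans hk)

theorem isClosed_staySet (n : ℕ) : IsClosed (D.staySet n) := by
  have : D.staySet n = ⋂ k, ⋂ _ : n ≤ k, {z | vtx z (D.p * k) ∈ D.U} := by
    ext z; simp only [staySet, mem_iInter]; rfl
  rw [this]
  exact isClosed_iInter fun k => isClosed_iInter fun _ => (isClopen_vtx _ _).1

/-- The paths whose tails can be attached to the beginning of `y`. -/
def encodeDomain (n : ℕ) (y : D.diagram.PathSpace) : Set B.PathSpace :=
  {z | z ∈ D.staySet n ∧ ∃ u : D.U, vtx y n = .inl u ∧ vtx z (D.p * n) = u}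

theorem isClosed_encodeDomain (n : ℕ) (y : D.diagram.PathSpace) :
    IsClosed (encodeDomain n y) := by
  have : encodeDomain n y = D.staySet n ∩
      {z | vtx z (D.p * n) ∈
        {v : B.Vertex | ∃ u : D.U, vtx y n = .inl u ∧ v = (u : B.Vertex)}} := rfl
  rw [this]
  exact (isClosed_staySet n).inter (isClopen_vtx _ _).1

theorem code_source {z : B.PathSpace} {n k : ℕ} (hz : z ∈ D.staySet n) (hk : n ≤ k) :
    (D.code z k).source = .inl ⟨_, hz k hk⟩ := by
  rw [code_of_mem (hz k hk) (hz (k + 1) (by omega))]; rfl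

theorem code_range {z : B.PathSpace} {n k : ℕ} (hz : z ∈ D.staySet n) (hk : n ≤ k) :
    (D.code z k).range = .inl ⟨_, hz (k + 1) (by omega)⟩ := by
  rw [code_of_mem (hz k hk) (hz (k + 1) (by omega))]; rfl

/-- The path that agrees with `y` up to level `n + 1` and codes the tail of `z` from then on. -/
noncomputable def encodeOfMem (n : ℕ) (y : D.diagram.PathSpace) (z : B.PathSpace)
    (h : z ∈ encodeDomain n y) : D.diagram.PathSpace :=
  ⟨(y.1.1, fun k => if k < n then y.1.2 k else D.code z k), by
    have hv : vtx y n = (D.code z n).source := by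
      obtain ⟨u, hu, hzu⟩ := h.2
      rw [hu, code_source h.1 le_rfl]
      exact congrArg Sum.inl (Subtype.ext hzu.symm)
    constructor
    · rcases Nat.eq_zero_or_pos n with rfl | hn
      · simpa using (vtx_zero y).symm.trans hv
      · simpa [hn] using y.2.1
    · intro k
      rcases lt_trichotomy (k + 1) n with hk | hk | hk
      · simpa [hk, (Nat.lt_succ_self k).trans hk] using y.2.2 k
      · subst hk
        simpa using (vtx_succ y k).symm.trans hv
      · have := (code_range h.1 (show n ≤ k by omega)).trans
          (code_source h.1 (show n ≤ k + 1 by omega)).symm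
        simpa [show ¬ k < n by omega, show ¬ k + 1 < n by omega] using this⟩

open Classical in
/-- The path that agrees with `y` up to level `n + 1` and codes the tail of `z` from then on, if
there is such a path, and otherwise `y`. -/
noncomputable def encode (n : ℕ) (y : D.diagram.PathSpace) (z : B.PathSpace) :
    D.diagram.PathSpace :=
  if h : z ∈ encodeDomain n y then encodeOfMem n y z h else y

variable {n k : ℕ} {y : D.diagram.PathSpace} {z z' : B.PathSpace}

theorem encode_of_mem (h : z ∈ encodeDomain n y) : encode n y z = encodeOfMem n y z h := dif_pos h

theorem encode_of_notMem (h : z ∉ encodeDomain n y) : encode n y z = y := dif_neg h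

theorem encode_fst : (encode n y z).1.1 = y.1.1 := by
  by_cases h : z ∈ encodeDomain n y
  · rw [encode_of_mem h]; rfl
  · rw [encode_of_notMem h]

theorem encode_of_lt (hk : k < n) : (encode n y z).1.2 k = y.1.2 k := by
  by_cases h : z ∈ encodeDomain n y
  · rw [encode_of_mem h]; exact if_pos hk
  · rw [encode_of_notMem h]

theorem encode_of_le (h : z ∈ encodeDomain n y) (hk : n ≤ k) :
    (encode n y z).1.2 k = D.code z k := by
  rw [encode_of_mem h]; exact if_neg hk.not_gt

theorem encode_mem_cyl (n : ℕ) (y : D.diagram.PathSpace) (z : B.PathSpace) :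
    encode n y z ∈ cyl y n := ⟨encode_fst, fun _ hk => encode_of_lt hk⟩

theorem vtx_encode (h : z ∈ encodeDomain n y) (hk : n ≤ k) :
    vtx (encode n y z) k = .inl ⟨_, h.1 k hk⟩ := by
  rw [vtx, encode_of_le h hk, code_source h.1 hk]

theorem encode_mem_cyl_of_mem (h : z ∈ encodeDomain n y) (h' : z' ∈ encodeDomain n y) {L : ℕ}
    (hz : z' ∈ cyl z (D.p * L)) : encode n y z' ∈ cyl (encode n y z) L := by
  refine ⟨by rw [encode_fst, encode_fst], fun k hk => ?_⟩
  rcases lt_or_ge k n with hkn | hkn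
  · rw [encode_of_lt hkn, encode_of_lt hkn]
  · rw [encode_of_le h hkn, encode_of_le h' hkn]
    exact code_congr (h'.1 k hkn) (h'.1 (k + 1) (by omega))
      (blockOf_congr (cyl_anti z (Nat.mul_le_mul_left _ hk) hz))

/-- An edge between vertices of `U` determines its block. Hence level `L` of the code and level `p *
L` of the original path carry the same information beyond the common beginning. -/
theorem mem_cyl_of_encode_mem_cyl (h : z ∈ encodeDomain n y) (h' : z' ∈ encodeDomain n y)
    (hz : z' ∈ cyl z (D.p * n)) {L : ℕ} (he : encode n y z' ∈ cyl (encode n y z) L) :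
    z' ∈ cyl z (D.p * L) := by
  refine mem_cyl_of_blockOf_eq D.p_pos hz fun k hk hkL => ?_
  refine blockOf_eq_of_code_eq (h'.1 k hk) (h'.1 (k + 1) (by omega)) (h.1 k hk)
    (h.1 (k + 1) (by omega)) ?_
  rw [← encode_of_le h hk, ← encode_of_le h' hk, he.2 k hkL]

/-- The encoding is continuous on its closed domain and constant off it. -/
theorem measurable_encode (n : ℕ) (y : D.diagram.PathSpace) : Measurable (encode n y) := by
  classical
  have hcont : ContinuousOn (encode n y) (encodeDomain n y) :=
    continuousOn_of_cyl fun z hz L => ⟨D.p * L, fun z' hz' h => encode_mem_cyl_of_mem hz hz' h⟩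
  have := ContinuousOn.measurable_piecewise hcont (continuousOn_const (c := y))
    (isClosed_encodeDomain n y).measurableSet
  convert this using 1
  ext z
  by_cases h : z ∈ encodeDomain n y
  · rw [piecewise_eq_of_mem _ _ _ h]
  · rw [piecewise_eq_of_notMem _ _ _ h, encode_of_notMem h]

theorem mem_encodeDomain_of_tail (h : ∀ k, D.p * n ≤ k → z'.1.2 k = z.1.2 k)
    (hz : z ∈ encodeDomain n y) : z' ∈ encodeDomain n y := by
  have hv : ∀ k, n ≤ k → vtx z' (D.p * k) = vtx z (D.p * k) := fun k hk =>
    congrArg Edge.source (h _ (Nat.mul_le_mul_left _ hk))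
  refine ⟨fun k hk => ?_, ?_⟩
  · rw [hv k hk]; exact hz.1 k hk
  · rw [hv n le_rfl]; exact hz.2

theorem encode_eq_of_tail (h : ∀ k, D.p * n ≤ k → z'.1.2 k = z.1.2 k)
    (hz : z ∈ encodeDomain n y) : encode n y z' = encode n y z := by
  have hz' := mem_encodeDomain_of_tail h hz
  refine path_ext (by rw [encode_fst, encode_fst]) fun k => ?_
  rcases lt_or_ge k n with hkn | hkn
  · rw [encode_of_lt hkn, encode_of_lt hkn]
  · rw [encode_of_le hz hkn, encode_of_le hz' hkn]
    refine code_congr (hz'.1 k hkn) (hz'.1 (k + 1) (by omega)) (funext fun i => ?_)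
    exact h _ ((Nat.mul_le_mul_left _ hkn).trans (Nat.le_add_right _ _))

/-- Changing the beginning of the path used for the encoding. -/
theorem encode_eq_encode {m : ℕ} {y' : D.diagram.PathSpace} (hz : z ∈ encodeDomain n y)
    (hmn : m ≤ n) (hz' : z ∈ encodeDomain m y') (h : encode m y' z ∈ cyl y n) :
    encode n y z = encode m y' z := by
  refine path_ext (encode_fst.trans h.1.symm) fun k => ?_
  rcases lt_or_ge k n with hkn | hkn
  · rw [encode_of_lt hkn, h.2 k hkn]
  · rw [encode_of_le hz hkn, encode_of_le hz' (hmn.trans hkn)]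

/-- Every path through `U` is the code of a path with a prescribed beginning. -/
theorem exists_encode_eq {x : B.PathSpace} {u : D.U} (hy : vtx y n = .inl u)
    (hx : vtx x (D.p * n) = u) :
    ∃ z ∈ cyl x (D.p * n), z ∈ encodeDomain n y ∧ encode n y z = y := by
  have hp := D.p_pos
  have hv : ∀ k, n ≤ k → ∃ w : D.U, vtx y k = .inl w := fun k hk => exists_inl_of_le hk hy
  have : Nonempty D.U := ⟨u⟩
  have : Nonempty B.PathSpace := ⟨x⟩
  choose! v hv using hv
  have hblock : ∀ k, n ≤ k → ∃ (t : B.PathSpace) (l : ℕ), vtx t (D.p * l) = v k ∧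
      vtx t (D.p * (l + 1)) = v (k + 1) ∧ ∀ b : B.Block D.p (v k) (v (k + 1)),
        b.1 = blockOf D.p t l → y.1.2 k = mkEdge (v k) (v (k + 1)) b := by
    intro k hk
    obtain ⟨⟨e, t, l, h1, h2, h3⟩, hb⟩ := exists_mkEdge (hv k hk)
      ((vtx_succ y k).symm.trans (hv (k + 1) (by omega)))
    exact ⟨t, l, h1, h2, fun b' hb' => hb.trans (mkEdge_congr rfl rfl (h3.trans hb'.symm))⟩
  choose! t l h1 h2 h3 using hblock
  have hvn : v n = u := Sum.inl_injective ((hv n le_rfl).symm.trans hy)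
  have hdiv : ∀ j, D.p * n ≤ j → n ≤ j / D.p := fun j hj =>
    (Nat.le_div_iff_mul_le hp).2 (by rwa [mul_comm])
  -- A block occurs in some path `t k` at an arbitrary position `l k`; the blocks are cut out there
  -- and concatenated. Only the values from `D.p * n` on matter.
  let f : ℕ → B.Edge := fun j => (t (j / D.p)).1.2 (D.p * l (j / D.p) + j % D.p)
  have hf : ∀ k (i : Fin D.p), f (D.p * k + i) = blockOf D.p (t k) (l k) i := by
    intro k i
    simp only [f, blockOf, Nat.mul_add_div hp, Nat.div_eq_of_lt i.2, add_zero, Nat.mul_add_mod,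
      Nat.mod_eq_of_lt i.2]
  have hf0 : ∀ k, n ≤ k → (f (D.p * k)).source = v k := by
    intro k hk
    have := hf k ⟨0, hp⟩
    rw [show D.p * k = D.p * k + ((⟨0, hp⟩ : Fin D.p) : ℕ) from rfl, this, ← h1 k hk]
    rfl
  have hfpath : ∀ j, D.p * n ≤ j → (f j).range = (f (j + 1)).source := by
    intro j hj
    have hkn := hdiv j hj
    obtain ⟨k, i, hi, rfl⟩ : ∃ k i, i < D.p ∧ j = D.p * k + i :=
      ⟨j / D.p, j % D.p, Nat.mod_lt j hp, (Nat.div_add_mod j D.p).symm⟩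
    have hnk : n ≤ k := by
      rwa [Nat.mul_add_div hp, Nat.div_eq_of_lt hi, add_zero] at hkn
    rw [hf k ⟨i, hi⟩]
    rcases Nat.lt_or_ge (i + 1) D.p with hi' | hi'
    · rw [add_assoc, hf k ⟨i + 1, hi'⟩]
      exact (t k).2.2 _
    · have : i = D.p - 1 := by omega
      subst this
      rw [← vtx_end_eq_range hp, h2 k hnk,
        show D.p * k + (D.p - 1) + 1 = D.p * (k + 1) by rw [Nat.mul_succ]; omega,
        hf0 _ (by omega)]
  have hstart : vtx x (D.p * n) = (f (D.p * n)).source := by rw [hf0 n le_rfl, hx, hvn]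
  let z : B.PathSpace := ⟨(x.1.1, fun j => if j < D.p * n then x.1.2 j else f j), by
    constructor
    · rcases Nat.eq_zero_or_pos (D.p * n) with h0 | hn
      · have := (vtx_zero x).symm.trans (h0 ▸ hstart)
        simpa [h0] using this
      · simpa [hn] using x.2.1
    · intro k
      rcases lt_trichotomy (k + 1) (D.p * n) with hk | hk | hk
      · simpa [hk, (Nat.lt_succ_self k).trans hk] using x.2.2 k
      · rw [← hk] at hstart
        simpa [← hk] using (vtx_succ x k).symm.trans hstart
      · simpa [show ¬ k < D.p * n by omega, show ¬ k + 1 < D.p * n by omega] using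
          hfpath k (by omega)⟩
  have hzf : ∀ j, D.p * n ≤ j → z.1.2 j = f j := fun j hj => if_neg hj.not_gt
  have hzb : ∀ k, n ≤ k → blockOf D.p z k = blockOf D.p (t k) (l k) := by
    intro k hk
    funext i
    rw [← hf]
    exact hzf _ ((Nat.mul_le_mul_left _ hk).trans (Nat.le_add_right _ _))
  have hzv : ∀ k, n ≤ k → vtx z (D.p * k) = v k := fun k hk =>
    (vtx_start_of_blockOf_eq hp (hzb k hk)).trans (h1 k hk)
  have hzd : z ∈ encodeDomain n y :=
    ⟨fun k hk => by rw [hzv k hk]; exact (v k).2, v n, hv n le_rfl, hzv n le_rfl⟩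
  refine ⟨z, ⟨rfl, fun j hj => if_pos hj⟩, hzd, path_ext encode_fst fun k => ?_⟩
  rcases lt_or_ge k n with hk | hk
  · exact encode_of_lt hk
  · rw [encode_of_le hzd hk, code_of_mem (hzd.1 k hk) (hzd.1 (k + 1) (by omega)),
      h3 k hk ⟨_, t k, l k, h1 k hk, h2 k hk, rfl⟩ rfl]
    exact mkEdge_congr (Subtype.ext (hzv k hk)) (Subtype.ext (hzv (k + 1) (by omega))) (hzb k hk)

end TowerData

/-! ### A criterion for tail invariance -/

theorem IsTailInvariant.measure_cyl_inter_splice {μ : Measure B.PathSpace}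
    (h : B.IsTailInvariant μ) {n : ℕ} {x x' : B.PathSpace} (hx : vtx x n = vtx x' n)
    {Q : Set B.PathSpace} (hQ : MeasurableSet Q) :
    μ (cyl x' n ∩ Q) = μ (cyl x n ∩ splice n x' ⁻¹' Q) := by
  have hm := (continuous_splice n x').measurable
  rw [inter_comm, ← Measure.restrict_apply hQ, ← h.map_splice hx, Measure.map_apply hm hQ,
    Measure.restrict_apply (hm hQ), inter_comm]

theorem measurableSet_tail_eq (f : B.PathSpace ≃ᵐ B.PathSpace) (n : ℕ) :
    MeasurableSet {y : B.PathSpace | ∀ k, n ≤ k → (f y).1.2 k = y.1.2 k} := by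
  have : {y : B.PathSpace | ∀ k, n ≤ k → (f y).1.2 k = y.1.2 k} =
      ⋂ k, ⋂ _ : n ≤ k, ⋃ e : B.Edge, f ⁻¹' ((fun y => y.1.2 k) ⁻¹' {e}) ∩
        (fun y : B.PathSpace => y.1.2 k) ⁻¹' {e} := by
    ext y
    simp only [mem_iInter, mem_iUnion, mem_inter_iff, mem_preimage, mem_singleton_iff]
    exact forall₂_congr fun k _ => ⟨fun h => ⟨_, h, rfl⟩, fun ⟨e, h, h'⟩ => h.trans h'.symm⟩
  rw [this]
  have hm : ∀ k (e : B.Edge), MeasurableSet ((fun y : B.PathSpace => y.1.2 k) ⁻¹' {e}) :=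
    fun k e => ((isClopen_discrete {e}).preimage (continuous_edge k)).measurableSet_borel
  exact MeasurableSet.iInter fun k => MeasurableSet.iInter fun _ => MeasurableSet.iUnion fun e =>
    (f.measurable (hm k e)).inter (hm k e)

theorem measurableSet_pre (n : ℕ) (c : B.FirstEdge × (Fin n → B.Edge)) :
    MeasurableSet (pre n ⁻¹' {c} : Set B.PathSpace) := (isClopen_pre n {c}).measurableSet_borel

section InvariantOfSplice

variable {ν : Measure B.PathSpace} {T : Set B.Vertex}

/-- On `R` the beginning, the beginning of the image and the unchanged tail are prescribed, so `f`
coincides there with one splicing map, whose effect on `ν` is known. -/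
theorem measure_le_measure_image
    (hsplice : ∀ n (y y' : B.PathSpace), vtx y n = vtx y' n → vtx y n ∈ T → ∀ A, MeasurableSet A →
      ν (cyl y' n ∩ A) = ν (cyl y n ∩ splice n y' ⁻¹' A))
    (f : B.PathSpace ≃ᵐ B.PathSpace) {n : ℕ} {R : Set B.PathSpace} (hR : MeasurableSet R)
    {c c' : B.FirstEdge × (Fin n → B.Edge)}
    (h : ∀ y ∈ R, vtx y n ∈ T ∧ pre n y = c ∧ pre n (f y) = c' ∧
      ∀ k, n ≤ k → (f y).1.2 k = y.1.2 k) : ν R ≤ ν (f '' R) := by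
  rcases R.eq_empty_or_nonempty with rfl | ⟨y, hy⟩
  · simp
  have hv : vtx y n = vtx (f y) n := congrArg Edge.source ((h y hy).2.2.2 n le_rfl).symm
  have hmem : ∀ z ∈ R, z ∈ cyl y n ∧ f z ∈ cyl (f y) n := fun z hz =>
    ⟨pre_eq_iff.1 ((h z hz).2.1.trans (h y hy).2.1.symm),
      pre_eq_iff.1 ((h z hz).2.2.1.trans (h y hy).2.2.1.symm)⟩
  have himg : f '' R ⊆ cyl (f y) n := by
    rintro _ ⟨z, hz, rfl⟩
    exact (hmem z hz).2
  rw [← inter_eq_right.2 himg, hsplice n y (f y) hv (h y hy).1 _ (f.measurableSet_image.2 hR)]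
  refine measure_mono fun z hz => ⟨(hmem z hz).1, z, hz, ?_⟩
  exact eq_splice (hmem z hz).2 (h z hz).2.2.2

/-- Almost every path lies in one of countably many pieces on which `f` is a single splice at a
vertex of `T`. On disjoint pieces the inequalities add up, and the images are disjoint since `f` is
injective. -/
theorem map_le_of_splice
    (hT : ∀ᵐ y ∂ν, ∃ n, ∀ k, n ≤ k → vtx y k ∈ T)
    (hsplice : ∀ n (y y' : B.PathSpace), vtx y n = vtx y' n → vtx y n ∈ T → ∀ A, MeasurableSet A →
      ν (cyl y' n ∩ A) = ν (cyl y n ∩ splice n y' ⁻¹' A))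
    (f : B.PathSpace ≃ᵐ B.PathSpace) (hf : ∀ x, B.Tail x (f x)) : ν.map f ≤ ν := by
  let P : (Σ n, (B.FirstEdge × (Fin n → B.Edge)) × (B.FirstEdge × (Fin n → B.Edge))) →
      Set B.PathSpace := fun a => {y | vtx y a.1 ∈ T} ∩ (pre a.1 ⁻¹' {a.2.1} ∩
        (f ⁻¹' (pre a.1 ⁻¹' {a.2.2}) ∩ {y | ∀ k, a.1 ≤ k → (f y).1.2 k = y.1.2 k}))
  have hPm : ∀ a, MeasurableSet (P a) := fun a =>
    (isClopen_vtx a.1 T).measurableSet_borel.inter ((measurableSet_pre _ _).inter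
      ((f.measurable (measurableSet_pre _ _)).inter (measurableSet_tail_eq f a.1)))
  have : Nonempty (Σ n, (B.FirstEdge × (Fin n → B.Edge)) × (B.FirstEdge × (Fin n → B.Edge))) :=
    let y : B.PathSpace := pathThrough 0 (Classical.arbitrary _)
    ⟨⟨0, pre 0 y, pre 0 y⟩⟩
  obtain ⟨s, hs⟩ := exists_surjective_nat
    (Σ n, (B.FirstEdge × (Fin n → B.Edge)) × (B.FirstEdge × (Fin n → B.Edge)))
  have hcover : ∀ᵐ y ∂ν, y ∈ ⋃ i, disjointed (fun i => P (s i)) i := by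
    filter_upwards [hT] with y hy
    obtain ⟨n, hn⟩ := hy
    obtain ⟨m, hm⟩ := hf y
    obtain ⟨i, hi⟩ := hs ⟨max n m, pre _ y, pre _ (f y)⟩
    rw [iUnion_disjointed]
    refine mem_iUnion.2 ⟨i, ?_⟩
    rw [hi]
    exact ⟨hn _ (le_max_left _ _), rfl, rfl,
      fun k hk => (hm k ((le_max_right _ _).trans hk)).symm⟩
  have hdm : ∀ i, MeasurableSet (disjointed (fun i => P (s i)) i) :=
    MeasurableSet.disjointed fun i => hPm (s i)
  refine Measure.le_iff.2 fun A hA => ?_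
  rw [Measure.map_apply f.measurable hA]
  have hfA := f.measurable hA
  have hle : ∀ i, ν (f ⁻¹' A ∩ disjointed (fun i => P (s i)) i) ≤
      ν (f '' (f ⁻¹' A ∩ disjointed (fun i => P (s i)) i)) := fun i =>
    measure_le_measure_image hsplice f (hfA.inter (hdm i)) (c := (s i).2.1) (c' := (s i).2.2)
      fun y hy => by
        have := disjointed_subset (fun i => P (s i)) i hy.2
        exact ⟨this.1, this.2.1, this.2.2.1, this.2.2.2⟩
  have hdisj := disjoint_disjointed fun i => P (s i)
  calc ν (f ⁻¹' A) ≤ ν (⋃ i, f ⁻¹' A ∩ disjointed (fun i => P (s i)) i) := by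
        refine measure_mono_ae ?_
        filter_upwards [hcover] with y hy hyA
        rw [← inter_iUnion]
        exact ⟨hyA, hy⟩
    _ ≤ ∑' i, ν (f ⁻¹' A ∩ disjointed (fun i => P (s i)) i) := measure_iUnion_le _
    _ ≤ ∑' i, ν (f '' (f ⁻¹' A ∩ disjointed (fun i => P (s i)) i)) :=
        ENNReal.tsum_le_tsum hle
    _ = ν (⋃ i, f '' (f ⁻¹' A ∩ disjointed (fun i => P (s i)) i)) := by
        rw [measure_iUnion]
        · intro i j hij
          exact (disjoint_image_iff f.injective).2
            ((hdisj hij).mono inter_subset_right inter_subset_right)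
        · exact fun i => f.measurableSet_image.2 (hfA.inter (hdm i))
    _ ≤ ν A := by
        refine measure_mono (iUnion_subset fun i => ?_)
        rintro _ ⟨y, hy, rfl⟩
        exact hy.1

/-- The inequality for `f` and for its inverse gives equality. Only splices at vertices of `T` need
checking, provided almost every path is eventually in `T`; for the copied measure these are the
vertices of `U`. -/
theorem isTailInvariant_of_splice
    (hT : ∀ᵐ y ∂ν, ∃ n, ∀ k, n ≤ k → vtx y k ∈ T)
    (hsplice : ∀ n (y y' : B.PathSpace), vtx y n = vtx y' n → vtx y n ∈ T → ∀ A, MeasurableSet A →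
      ν (cyl y' n ∩ A) = ν (cyl y n ∩ splice n y' ⁻¹' A)) : B.IsTailInvariant ν := by
  intro f hf
  refine (map_le_of_splice hT hsplice f hf).antisymm ?_
  have hf' : ∀ x, B.Tail x (f.symm x) := by
    intro x
    obtain ⟨n, hn⟩ := hf (f.symm x)
    exact ⟨n, fun k hk => by rw [hn k hk, f.apply_symm_apply]⟩
  have h := Measure.map_mono (map_le_of_splice hT hsplice f.symm hf') f.measurable
  rwa [Measure.map_map f.measurable f.symm.measurable, f.self_comp_symm, Measure.map_id] at h

end InvariantOfSplice

/-! ### The copied measure and its ergodicity -/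

namespace TowerData

/-- A path arrives in `U` at the vertex with index `n`. -/
def IsEntry (D : TowerData B) (n : ℕ) (y : D.diagram.PathSpace) : Prop :=
  (∃ u : D.U, vtx y n = .inl u) ∧ ∀ m < n, ∀ u : D.U, vtx y m ≠ .inl u

/-- The beginnings of paths up to the first arrival in `U`. -/
def EntryIndex (D : TowerData B) : Type :=
  {a : Σ n, D.diagram.FirstEdge × (Fin n → D.diagram.Edge) //
    ∃ y, pre a.1 y = a.2 ∧ D.IsEntry a.1 y}

/-- A path with the given beginning. -/
noncomputable def EntryIndex.rep {D : TowerData B} (a : D.EntryIndex) : D.diagram.PathSpace :=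
  a.2.choose

theorem EntryIndex.pre_rep {D : TowerData B} (a : D.EntryIndex) : pre a.1.1 a.rep = a.1.2 :=
  a.2.choose_spec.1

theorem EntryIndex.isEntry {D : TowerData B} (a : D.EntryIndex) : D.IsEntry a.1.1 a.rep :=
  a.2.choose_spec.2

/-- The vertex of arrival. -/
noncomputable def EntryIndex.top {D : TowerData B} (a : D.EntryIndex) : D.U :=
  a.isEntry.1.choose

theorem EntryIndex.vtx_rep {D : TowerData B} (a : D.EntryIndex) : vtx a.rep a.1.1 = .inl a.top :=
  a.isEntry.1.choose_spec

/-- The measure on the telescoped diagram that copies a given measure. -/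
noncomputable def towerMeasure (D : TowerData B) (μ : Measure B.PathSpace) :
    Measure D.diagram.PathSpace :=
  Measure.sum fun a : D.EntryIndex =>
    (μ.restrict (cyl (pathThrough (D.p * a.1.1) (a.top : B.Vertex)) (D.p * a.1.1) ∩
      D.staySet a.1.1)).map (encode a.1.1 a.rep)

variable {D : TowerData B} {μ : Measure B.PathSpace}

theorem measurableSet_staySet (n : ℕ) : MeasurableSet (D.staySet n) :=
  (isClosed_staySet n).measurableSet

theorem towerMeasure_eq_tsum {A : Set D.diagram.PathSpace} (hA : MeasurableSet A) :
    D.towerMeasure μ A = ∑' a : D.EntryIndex,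
      μ (cyl (pathThrough (D.p * a.1.1) (a.top : B.Vertex)) (D.p * a.1.1) ∩ D.staySet a.1.1 ∩
        encode a.1.1 a.rep ⁻¹' A) := by
  rw [towerMeasure, Measure.sum_apply _ hA]
  refine tsum_congr fun a => ?_
  rw [Measure.map_apply (measurable_encode _ _) hA,
    Measure.restrict_apply (measurable_encode _ _ hA), inter_comm]

theorem mem_encodeDomain {n : ℕ} {x z : B.PathSpace} {y : D.diagram.PathSpace} {u : D.U}
    (hy : vtx y n = .inl u) (hx : vtx x (D.p * n) = u) (hz : z ∈ cyl x (D.p * n))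
    (hs : z ∈ D.staySet n) : z ∈ encodeDomain n y :=
  ⟨hs, u, hy, (vtx_eq_of_mem hz).trans hx⟩

/-- The code uses only the tail of `z` beyond level `p * n`, so splicing from one cylinder to the
other does not change it, and invariance of `μ` applies. -/
theorem measure_encode_indep (h : B.IsTailInvariant μ) {n : ℕ} {y : D.diagram.PathSpace} {u : D.U}
    (hy : vtx y n = .inl u) {x x' : B.PathSpace} (hx : vtx x (D.p * n) = u)
    (hx' : vtx x' (D.p * n) = u) {A : Set D.diagram.PathSpace} (hA : MeasurableSet A) :
    μ (cyl x (D.p * n) ∩ D.staySet n ∩ encode n y ⁻¹' A) =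
      μ (cyl x' (D.p * n) ∩ D.staySet n ∩ encode n y ⁻¹' A) := by
  have hQ := (measurableSet_staySet (D := D) n).inter (measurable_encode n y hA)
  rw [inter_assoc, inter_assoc, h.measure_cyl_inter_splice (hx'.trans hx.symm) hQ]
  congr 1
  ext z
  refine and_congr_right fun hz => ?_
  have hv : vtx x (D.p * n) = vtx z (D.p * n) := by rw [vtx_eq_of_mem hz, hx, hx']
  have htail : ∀ k, D.p * n ≤ k → (splice (D.p * n) x z).1.2 k = z.1.2 k :=
    fun k hk => splice_of_le hv hk
  have hvz : vtx z (D.p * n) = u := (vtx_eq_of_mem hz).trans hx'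
  have hvs : vtx (splice (D.p * n) x z) (D.p * n) = u := by
    rw [vtx_splice_of_le hv le_rfl, hvz]
  constructor
  · rintro ⟨h1, h2⟩
    have hd : splice (D.p * n) x z ∈ encodeDomain n y := ⟨h1, u, hy, hvs⟩
    have hd' := mem_encodeDomain_of_tail (fun k hk => (htail k hk).symm) hd
    refine ⟨hd'.1, ?_⟩
    rw [mem_preimage, encode_eq_of_tail (fun k hk => (htail k hk).symm) hd]
    exact h2
  · rintro ⟨h1, h2⟩
    have hd : z ∈ encodeDomain n y := ⟨h1, u, hy, hvz⟩
    have hd' := mem_encodeDomain_of_tail htail hd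
    refine ⟨hd'.1, ?_⟩
    rw [mem_preimage, encode_eq_of_tail htail hd]
    exact h2

/-- The measure of a set of paths passing through `U`. -/
theorem towerMeasure_apply (h : B.IsTailInvariant μ) {n : ℕ} {y : D.diagram.PathSpace} {u : D.U}
    (hy : vtx y n = .inl u) {x : B.PathSpace} (hx : vtx x (D.p * n) = u)
    {A : Set D.diagram.PathSpace} (hA : MeasurableSet A) (hAy : A ⊆ cyl y n) :
    D.towerMeasure μ A = μ (cyl x (D.p * n) ∩ D.staySet n ∩ encode n y ⁻¹' A) := by
  classical
  have hex : ∃ m, ∃ w : D.U, vtx y m = .inl w := ⟨n, u, hy⟩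
  set k := Nat.find hex with hk
  have hkn : k ≤ n := Nat.find_min' hex ⟨u, hy⟩
  have hentry : D.IsEntry k y :=
    ⟨Nat.find_spec hex, fun m hm w hw => Nat.find_min hex hm ⟨w, hw⟩⟩
  -- The first arrival of `y` in `U` selects the only summand that charges the cylinder of `y`:
  -- another summand would give some path two different beginnings up to first arrival.
  let a : D.EntryIndex := ⟨⟨k, pre k y⟩, y, rfl, hentry⟩
  have hya : y ∈ cyl a.rep k := pre_eq_iff.1 a.pre_rep.symm
  rw [towerMeasure_eq_tsum hA, tsum_eq_single a]
  · set x₀ : B.PathSpace := pathThrough (D.p * k) (a.top : B.Vertex)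
    have hx₀ : vtx x₀ (D.p * k) = a.top := vtx_pathThrough _ _
    have hyk : vtx y k = .inl a.top := (vtx_eq_of_mem hya).trans a.vtx_rep
    -- Since the summand is based at the arrival level `k`, a path `z₀` coded by `y` is needed to
    -- locate the cylinder of level `p * n` that corresponds to `cyl y n`.
    obtain ⟨z₀, hz₀, hd₀, he₀⟩ := exists_encode_eq hyk hx₀
    have hd₀' : z₀ ∈ encodeDomain k a.rep := ⟨hd₀.1, a.top, a.vtx_rep, (vtx_eq_of_mem hz₀).trans hx₀⟩
    have hz₀n : vtx z₀ (D.p * n) = u := by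
      have := vtx_encode hd₀ hkn
      rw [he₀, hy] at this
      exact (congrArg Subtype.val (Sum.inl_injective this)).symm
    have hd₀n : z₀ ∈ encodeDomain n y := ⟨staySet_mono hkn hd₀.1, u, hy, hz₀n⟩
    have he₀' : encode k a.rep z₀ = y := by
      rw [← encode_eq_encode hd₀' le_rfl hd₀ (by rw [he₀]; exact hya), he₀] at *
    rw [← measure_encode_indep h hy hz₀n hx hA]
    congr 1
    ext z
    change (z ∈ cyl x₀ (D.p * k) ∧ z ∈ D.staySet k) ∧ encode k a.rep z ∈ A ↔
      (z ∈ cyl z₀ (D.p * n) ∧ z ∈ D.staySet n) ∧ encode n y z ∈ A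
    constructor
    · rintro ⟨⟨hz, hs⟩, hzA⟩
      have hzd : z ∈ encodeDomain k a.rep := mem_encodeDomain a.vtx_rep hx₀ hz hs
      have hmem : z ∈ cyl z₀ (D.p * n) := by
        refine mem_cyl_of_encode_mem_cyl hd₀' hzd ?_ ?_
        · rw [cyl_eq_of_mem hz₀]; exact hz
        · rw [he₀']; exact hAy hzA
      have hs' := staySet_mono hkn hs
      refine ⟨⟨hmem, hs'⟩, ?_⟩
      rw [encode_eq_encode (mem_encodeDomain hy hz₀n hmem hs') hkn hzd (hAy hzA)]
      exact hzA
    · rintro ⟨⟨hz, hs⟩, hzA⟩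
      have hzk : z ∈ cyl x₀ (D.p * k) := cyl_subset_of_mem hz₀ (Nat.mul_le_mul_left _ hkn)
        hz
      have hs' : z ∈ D.staySet k := by
        intro l hl
        rcases lt_or_ge l n with hln | hln
        · rw [vtx_eq_of_mem_of_le hz (Nat.mul_le_mul_left _ hln.le)]; exact hd₀.1 l hl
        · exact hs l hln
      have hzd : z ∈ encodeDomain k a.rep := mem_encodeDomain a.vtx_rep hx₀ hzk hs'
      have hcyl : encode k a.rep z ∈ cyl y n := by
        rw [← he₀']; exact encode_mem_cyl_of_mem hd₀' hzd hz
      refine ⟨⟨hzk, hs'⟩, ?_⟩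
      rw [← encode_eq_encode (mem_encodeDomain hy hz₀n hz hs) hkn hzd hcyl]
      exact hzA
  · intro b hb
    refine measure_mono_null (t := ∅) (fun z hz => hb ?_) measure_empty
    have h1 : encode b.1.1 b.rep z ∈ cyl b.rep b.1.1 := encode_mem_cyl _ _ _
    have h2 : encode b.1.1 b.rep z ∈ cyl y k := cyl_anti y hkn (hAy hz.2)
    set w := encode b.1.1 b.rep z
    have hwb : D.IsEntry b.1.1 w := by
      refine ⟨⟨b.top, (vtx_eq_of_mem h1).trans b.vtx_rep⟩, fun m hm u => ?_⟩
      rw [vtx_eq_of_mem_of_le h1 hm.le]; exact b.isEntry.2 m hm u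
    have hwy : D.IsEntry k w := by
      refine ⟨?_, fun m hm u => ?_⟩
      · rw [vtx_eq_of_mem h2]; exact hentry.1
      · rw [vtx_eq_of_mem_of_le h2 hm.le]; exact hentry.2 m hm u
    have hbk : b.1.1 = k := by
      rcases lt_trichotomy b.1.1 k with hlt | heq | hlt
      · exact absurd hwb.1.choose_spec (hwy.2 _ hlt _)
      · exact heq
      · exact absurd hwy.1.choose_spec (hwb.2 _ hlt _)
    have hpre : b.1 = ⟨b.1.1, pre b.1.1 w⟩ := by
      rw [pre_eq_iff.2 h1, b.pre_rep]
    refine Subtype.ext ?_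
    rw [hpre, hbk, pre_eq_iff.2 h2]

theorem ae_exists_inl : ∀ᵐ y : D.diagram.PathSpace ∂(D.towerMeasure μ), ∃ n, ∃ u : D.U, vtx y n = .inl u := by
  have hm : MeasurableSet {y : D.diagram.PathSpace | ∃ n, ∃ u : D.U, vtx y n = .inl u} := by
    have : {y : D.diagram.PathSpace | ∃ n, ∃ u : D.U, vtx y n = .inl u} =
        ⋃ n, {y : D.diagram.PathSpace | vtx y n ∈ {v : D.U ⊕ Fin D.i | ∃ u : D.U, v = .inl u}} := by
      ext y; simp only [mem_iUnion]; rfl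
    rw [this]
    exact MeasurableSet.iUnion fun n => (isClopen_vtx n _).measurableSet_borel
  rw [ae_iff]
  change D.towerMeasure μ {y | ∃ n, ∃ u : D.U, vtx y n = .inl u}ᶜ = 0
  rw [towerMeasure_eq_tsum hm.compl, ENNReal.tsum_eq_zero]
  refine fun a => measure_mono_null (t := ∅) (fun z hz => hz.2 ?_) measure_empty
  exact ⟨a.1.1, a.top, (vtx_eq_of_mem (encode_mem_cyl _ _ _)).trans a.vtx_rep⟩

theorem splice_encode {n : ℕ} {y y' : D.diagram.PathSpace} {z : B.PathSpace}
    (hv : vtx y n = vtx y' n) (hz : z ∈ encodeDomain n y) :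
    splice n y' (encode n y z) = encode n y' z := by
  have hz' : z ∈ encodeDomain n y' := ⟨hz.1, by rw [← hv]; exact hz.2⟩
  refine (eq_splice (encode_mem_cyl _ _ _) fun k hk => ?_).symm
  rw [encode_of_le hz hk, encode_of_le hz' hk]

theorem isTailInvariant_towerMeasure (h : B.IsTailInvariant μ) :
    D.diagram.IsTailInvariant (D.towerMeasure μ) := by
  refine isTailInvariant_of_splice (B := D.diagram)
    (T := {v : D.U ⊕ Fin D.i | ∃ u : D.U, v = .inl u}) ?_ ?_
  · filter_upwards [ae_exists_inl] with y ⟨n, u, hu⟩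
    exact ⟨n, fun k hk => exists_inl_of_le hk hu⟩
  · rintro n y y' hv ⟨u, hu⟩ A hA
    have hx := vtx_pathThrough (B := B) (D.p * n) u
    have hm := (continuous_splice n y').measurable hA
    rw [towerMeasure_apply h (hv.symm.trans hu) hx ((measurableSet_cyl _ _).inter hA)
      inter_subset_left, towerMeasure_apply h hu hx ((measurableSet_cyl _ _).inter hm)
      inter_subset_left]
    congr 1
    ext z
    refine and_congr_right fun hz => ?_
    have hd := mem_encodeDomain hu hx hz.1 hz.2
    change encode n y' z ∈ _ ∧ _ ↔ encode n y z ∈ _ ∧ splice n y' (encode n y z) ∈ A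
    rw [splice_encode hv hd]
    exact and_congr (iff_of_true (encode_mem_cyl _ _ _) (encode_mem_cyl _ _ _)) Iff.rfl

theorem tail_encode {m n : ℕ} {y y' : D.diagram.PathSpace} {z : B.PathSpace}
    (hz : z ∈ encodeDomain n y) (hz' : z ∈ encodeDomain m y') :
    D.diagram.Tail (encode n y z) (encode m y' z) :=
  ⟨max n m, fun k hk => by
    rw [encode_of_le hz ((le_max_left _ _).trans hk), encode_of_le hz' ((le_max_right _ _).trans hk)]⟩

/-- The paths whose codes are tail equivalent to elements of `E`. -/
def decodeSet (E : Set D.diagram.PathSpace) : Set B.PathSpace :=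
  ⋃ (n : ℕ) (u : D.U), encodeDomain n (pathThrough (B := D.diagram) n (.inl u)) ∩
    encode n (pathThrough (B := D.diagram) n (.inl u)) ⁻¹' E

theorem mem_decodeSet_of_mem {E : Set D.diagram.PathSpace} (hE : D.diagram.IsSaturated E) {n : ℕ}
    {y : D.diagram.PathSpace} {z : B.PathSpace} (hz : z ∈ encodeDomain n y)
    (h : encode n y z ∈ E) : z ∈ decodeSet E := by
  obtain ⟨u, hu, hzu⟩ := hz.2
  have hz' : z ∈ encodeDomain n (pathThrough (B := D.diagram) n (.inl u)) :=
    ⟨hz.1, u, vtx_pathThrough _ _, hzu⟩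
  exact mem_iUnion₂.2 ⟨n, u, hz', hE _ _ (tail_encode hz hz') h⟩

theorem isSaturated_decodeSet {E : Set D.diagram.PathSpace} (hE : D.diagram.IsSaturated E) :
    B.IsSaturated (decodeSet E) := by
  rintro x x' ⟨M, hM⟩ hx
  obtain ⟨n, u, hd, he⟩ := mem_iUnion₂.1 hx
  have hM' : M ≤ D.p * max n M := (le_max_right n M).trans (Nat.le_mul_of_pos_left _ D.p_pos)
  have hs := staySet_mono (le_max_left n M) hd.1
  have hd' : x ∈ encodeDomain (max n M)
      (pathThrough (B := D.diagram) (max n M) (.inl ⟨_, hs _ le_rfl⟩)) :=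
    ⟨hs, _, vtx_pathThrough _ _, rfl⟩
  have htail : ∀ k, D.p * max n M ≤ k → x'.1.2 k = x.1.2 k := fun k hk =>
    (hM k (hM'.trans hk)).symm
  refine mem_decodeSet_of_mem hE (mem_encodeDomain_of_tail htail hd') ?_
  rw [encode_eq_of_tail htail hd']
  exact hE _ _ (tail_encode hd hd') he

theorem measurableSet_decodeSet {E : Set D.diagram.PathSpace} (hE : MeasurableSet E) :
    MeasurableSet (decodeSet E) :=
  MeasurableSet.iUnion fun _ => MeasurableSet.iUnion fun _ =>
    (isClosed_encodeDomain _ _).measurableSet.inter (measurable_encode _ _ hE)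

theorem decodeSet_compl_subset {E : Set D.diagram.PathSpace} (hE : D.diagram.IsSaturated E) :
    decodeSet Eᶜ ⊆ (decodeSet E)ᶜ := by
  intro x hx hx'
  obtain ⟨n, u, hd, he⟩ := mem_iUnion₂.1 hx
  obtain ⟨m, w, hd', he'⟩ := mem_iUnion₂.1 hx'
  exact he (hE _ _ (tail_encode hd' hd) he')

theorem towerMeasure_eq_zero {E : Set D.diagram.PathSpace} (hm : MeasurableSet E)
    (hE : D.diagram.IsSaturated E) (h : μ (decodeSet E) = 0) : D.towerMeasure μ E = 0 := by
  rw [towerMeasure_eq_tsum hm, ENNReal.tsum_eq_zero]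
  refine fun a => measure_mono_null (fun z hz => ?_) h
  exact mem_decodeSet_of_mem hE
    (mem_encodeDomain a.vtx_rep (vtx_pathThrough _ _) hz.1.1 hz.1.2) hz.2

/-- Decoding a saturated set yields a saturated set, and complementary sets have disjoint decodings.
So one of the decodings is null, and the corresponding set is null for the copied measure. -/
theorem isTailErgodic_towerMeasure (h : B.IsTailErgodic μ) :
    D.diagram.IsTailErgodic (D.towerMeasure μ) := by
  intro E hm hE
  have hE' : D.diagram.IsSaturated Eᶜ := fun x y ⟨N, hN⟩ hx hy =>
    hx (hE y x ⟨N, fun n hn => (hN n hn).symm⟩ hy)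
  rcases h _ (measurableSet_decodeSet hm) (isSaturated_decodeSet hE) with h0 | h0
  · exact Or.inl (towerMeasure_eq_zero hm hE h0)
  · exact Or.inr (towerMeasure_eq_zero hm.compl hE'
      (measure_mono_null (decodeSet_compl_subset hE) h0))

end TowerData

end StationaryBratteliDiagram

/-! ### Values of good infinite measures on clopen sets -/

section ClopenValues

variable {X : Type*} [TopologicalSpace X] [MeasurableSpace X] [BorelSpace X]

/-- The finite values of a measure on clopen sets. -/
def clopenValues (μ : Measure X) : Set ENNReal := {a | a ≠ ⊤ ∧ ∃ A, IsClopen A ∧ μ A = a}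

variable {μ : Measure X}

omit [BorelSpace X] in
theorem zero_mem_clopenValues : 0 ∈ clopenValues μ := ⟨by simp, ∅, isClopen_empty, by simp⟩

/-- The complement of a clopen set of finite measure is infinite, so goodness places a disjoint copy
of the second set in it. -/
theorem add_mem_clopenValues (hg : ∀ V : Set X, IsClopen V → IsGoodClopen μ V)
    (hinf : μ univ = ⊤) {a b : ENNReal} (ha : a ∈ clopenValues μ) (hb : b ∈ clopenValues μ) :
    a + b ∈ clopenValues μ := by
  obtain ⟨ha, A, hA, rfl⟩ := ha
  obtain ⟨hb, C, hC, rfl⟩ := hb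
  have hAc : μ Aᶜ = ⊤ := by
    have := measure_add_measure_compl (μ := μ) hA.measurableSet_borel
    rw [hinf, ENNReal.add_eq_top] at this
    exact this.resolve_left ha
  obtain ⟨W, hW, hWA, hWC⟩ := hg Aᶜ hA.compl C hC (by rw [hAc]; exact hb.lt_top)
  refine ⟨by simp [ha, hb], A ∪ W, hA.union hW, ?_⟩
  rw [measure_union (disjoint_compl_right.mono_right hWA) hW.measurableSet_borel, hWC]

theorem sub_mem_clopenValues (hg : ∀ V : Set X, IsClopen V → IsGoodClopen μ V) {a b : ENNReal}
    (ha : a ∈ clopenValues μ) (hb : b ∈ clopenValues μ) (hab : a < b) :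
    b - a ∈ clopenValues μ := by
  obtain ⟨ha, A, hA, rfl⟩ := ha
  obtain ⟨hb, C, hC, rfl⟩ := hb
  obtain ⟨W, hW, hWC, hWA⟩ := hg C hC A hA hab
  refine ⟨ENNReal.sub_ne_top hb, C \ W, hC.diff hW, ?_⟩
  rw [measure_sdiff hWC hW.measurableSet_borel.nullMeasurableSet (hWA ▸ ha), hWA]

end ClopenValues

namespace StationaryBratteliDiagram

variable {B : StationaryBratteliDiagram}

theorem measure_biUnion_cyl_mem {μ : Measure B.PathSpace} {S : Set ENNReal} (h0 : 0 ∈ S)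
    (hadd : ∀ a ∈ S, ∀ b ∈ S, a + b ∈ S) {n : ℕ} (t : Finset B.PathSpace)
    (ht : ∀ x ∈ t, μ (cyl x n) ∈ S) : μ (⋃ x ∈ t, cyl x n) ∈ S := by
  classical
  induction t using Finset.induction_on with
  | empty => simpa using h0
  | insert x t hx ih =>
    have ih' := ih fun y hy => ht y (by simp [hy])
    rw [Finset.set_biUnion_insert]
    by_cases hmem : x ∈ ⋃ y ∈ t, cyl y n
    · obtain ⟨y, hy, hxy⟩ := mem_iUnion₂.1 hmem
      rw [union_eq_right.2]
      · exact ih'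
      · rw [cyl_eq_of_mem hxy]
        exact subset_biUnion_of_mem (u := fun y => cyl y n) (Finset.mem_coe.2 hy)
    · rw [measure_union]
      · exact hadd _ (ht x (by simp)) _ ih'
      · rw [disjoint_iUnion₂_right]
        exact fun y hy => (disjoint_cyl fun h => hmem (mem_iUnion₂.2 ⟨y, hy, h⟩)).symm
      · exact t.measurableSet_biUnion fun y _ => measurableSet_cyl y n

theorem IsTailInvariant.measure_vtx_eq_zero {μ : Measure B.PathSpace} (h : B.IsTailInvariant μ)
    {n : ℕ} {v : B.Vertex} (hv : mass μ n v = 0) : μ {z | vtx z n = v} = 0 := by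
  obtain ⟨t, ht, hAt⟩ := exists_finset_cyl (A := {z : B.PathSpace | vtx z n = v}) (n := n)
    fun x hx y hy => (vtx_eq_of_mem hy).trans hx
  rw [hAt]
  exact measure_biUnion_cyl_mem (S := {0}) rfl (by simp) t fun x hx => by
    rw [mem_singleton_iff, h.measure_cyl, show vtx x n = v from ht x hx, hv]

/-! ### Goodness and clopen values of the copied measure -/

namespace TowerData

noncomputable instance (D : TowerData B) : Fintype D.U := Fintype.ofFinite _

/-- The data are adapted to a measure if `U` consists of the vertices of positive finite mass and
the number of loops is large. -/
structure IsAdapted (D : TowerData B) (μ : Measure B.PathSpace) : Prop where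
  invariant : B.IsTailInvariant μ
  mem_U_iff : ∀ n v, v ∈ D.U ↔ mass μ (D.p * n) v ≠ 0 ∧ mass μ (D.p * n) v ≠ ⊤
  nonempty : D.U.Nonempty
  nonatomic : ∀ x, μ {x} = 0
  infinite : μ univ = ⊤
  good : ∀ V : Set B.PathSpace, IsClopen V → IsGoodClopen μ V
  loops : ∀ w : D.U, ∑ u : D.U, Nat.card (B.Block D.p u w) ≤ D.N

variable {D : TowerData B} {μ : Measure B.PathSpace}

namespace IsAdapted

variable (H : D.IsAdapted μ)
include H

/-- Below a cylinder of finite mass no vertex of infinite mass occurs, and the paths meeting a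
vertex of mass zero are null. So almost every path of the cylinder stays in `U`. -/
theorem measure_inter_staySet {n : ℕ} {x : B.PathSpace} (hx : vtx x (D.p * n) ∈ D.U)
    (Q : Set B.PathSpace) :
    μ (cyl x (D.p * n) ∩ D.staySet n ∩ Q) = μ (cyl x (D.p * n) ∩ Q) := by
  have hfin : μ (cyl x (D.p * n)) ≠ ⊤ := by
    rw [H.invariant.measure_cyl]; exact ((H.mem_U_iff n _).1 hx).2
  have hnull : μ (⋃ k, ⋃ v : {v // mass μ (D.p * k) v = 0}, {z | vtx z (D.p * k) = v.1}) = 0 :=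
    measure_iUnion_null fun k => measure_iUnion_null fun v => H.invariant.measure_vtx_eq_zero v.2
  refine measure_congr ?_
  filter_upwards [measure_eq_zero_iff_ae_notMem.1 hnull] with z hz
  refine propext ⟨fun h => ⟨h.1.1, h.2⟩, fun h => ⟨⟨h.1, fun k hk => ?_⟩, h.2⟩⟩
  rw [H.mem_U_iff k]
  refine ⟨fun h0 => hz (mem_iUnion₂.2 ⟨k, ⟨_, h0⟩, rfl⟩), ?_⟩
  rw [← H.invariant.measure_cyl]
  exact ((measure_mono (cyl_subset_of_mem h.1 (Nat.mul_le_mul_left _ hk))).trans_lt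
    hfin.lt_top).ne

theorem towerMeasure_cyl {n : ℕ} {y : D.diagram.PathSpace} {u : D.U} (hy : vtx y n = .inl u) :
    D.towerMeasure μ (cyl y n) = mass μ (D.p * n) u := by
  have hx := vtx_pathThrough (B := B) (D.p * n) u
  rw [towerMeasure_apply H.invariant hy hx (measurableSet_cyl y n) subset_rfl,
    H.measure_inter_staySet (by rw [hx]; exact u.2),
    inter_eq_left.2 (show _ ⊆ encode n y ⁻¹' cyl y n from fun z _ => encode_mem_cyl n y z)]
  rfl

theorem mass_inl (n : ℕ) (u : D.U) :
    mass (B := D.diagram) (D.towerMeasure μ) n (.inl u) = mass μ (D.p * n) u :=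
  H.towerMeasure_cyl (vtx_pathThrough (B := D.diagram) n (.inl u))

theorem invariant_towerMeasure : D.diagram.IsTailInvariant (D.towerMeasure μ) :=
  isTailInvariant_towerMeasure H.invariant

omit H in
theorem sum_vertex (f : D.diagram.Vertex → ENNReal) :
    ∑ v, f v = ∑ u : D.U, f (.inl u) + ∑ j : Fin D.i, f (.inr j) := by
  refine Eq.trans ?_ (Fintype.sum_sum_type (f := (f : D.U ⊕ Fin D.i → ENNReal)))
  exact @Fintype.sum_equiv D.diagram.Vertex (D.U ⊕ Fin D.i) ENNReal _ _ _
    (Equiv.refl (D.U ⊕ Fin D.i)) f f fun _ => rfl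

/-- No edge leads from `U` to an added vertex, so the recursion for masses closes up on `U`; its
column sums are at most `N` by the adaptedness condition. -/
theorem sum_mass_le (n : ℕ) : ∑ u : D.U, mass μ (D.p * n) (u : B.Vertex) ≤
    D.N * ∑ u : D.U, mass μ (D.p * (n + 1)) (u : B.Vertex) := by
  have h1 : ∀ u : D.U, mass μ (D.p * n) (u : B.Vertex) = ∑ w : D.U,
      (Nat.card (B.Block D.p u w) : ENNReal) * mass μ (D.p * (n + 1)) (w : B.Vertex) := by
    intro u
    have h0 := (H.mass_inl n u).symm.trans
      ((H.invariant_towerMeasure.mass_eq n (.inl u)).trans (sum_vertex _))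
    simp only [H.mass_inl] at h0
    have h2 : ∀ j : Fin D.i, D.diagram.F (.inr j) (.inl u) = 0 := fun _ => rfl
    simp only [h2, Nat.cast_zero, zero_mul, Finset.sum_const_zero, add_zero] at h0
    exact h0
  simp only [h1]
  rw [Finset.sum_comm, Finset.mul_sum]
  refine Finset.sum_le_sum fun w _ => ?_
  rw [← Finset.sum_mul]
  gcongr
  exact_mod_cast H.loops w

/-- Write $S_n$ for the total mass of $U$ at level $n$. The mass $m_n$ of an added vertex satisfies
$m_n=S_{n+1}+N m_{n+1}$, and $S_{n+1}\le N S_{n+2}$, so each further loop contributes at least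
another $S_{n+1}$. Hence $m_n\ge K S_{n+1}$ for every $K$, while $S_{n+1}>0$. -/
theorem mass_inr (n : ℕ) (j : Fin D.i) :
    mass (B := D.diagram) (D.towerMeasure μ) n (.inr j) = ⊤ := by
  have hrec : ∀ n, mass (B := D.diagram) (D.towerMeasure μ) n (.inr j) =
      ∑ u : D.U, mass μ (D.p * (n + 1)) (u : B.Vertex) +
        D.N * mass (B := D.diagram) (D.towerMeasure μ) (n + 1) (.inr j) := by
    intro n
    refine ((H.invariant_towerMeasure.mass_eq n (.inr j)).trans (sum_vertex _)).trans ?_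
    simp only [H.mass_inl]
    have h1 : ∀ u : D.U, D.diagram.F (.inl u) (.inr j) = 1 := fun _ => rfl
    have h2 : ∀ j' : Fin D.i, D.diagram.F (.inr j') (.inr j) = if j' = j then D.N else 0 :=
      fun _ => rfl
    simp [h1, h2]
  have hle : ∀ K n : ℕ, K * ∑ u : D.U, mass μ (D.p * (n + 1)) (u : B.Vertex) ≤
      mass (B := D.diagram) (D.towerMeasure μ) n (.inr j) := by
    intro K
    induction K with
    | zero => simp
    | succ K ih =>
      intro n
      rw [hrec n]
      calc ((K + 1 : ℕ) : ENNReal) * ∑ u : D.U, mass μ (D.p * (n + 1)) (u : B.Vertex)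
          = ∑ u : D.U, mass μ (D.p * (n + 1)) (u : B.Vertex) +
            K * ∑ u : D.U, mass μ (D.p * (n + 1)) (u : B.Vertex) := by push_cast; ring
        _ ≤ ∑ u : D.U, mass μ (D.p * (n + 1)) (u : B.Vertex) +
            K * (D.N * ∑ u : D.U, mass μ (D.p * (n + 1 + 1)) (u : B.Vertex)) := by
          gcongr; exact H.sum_mass_le (n + 1)
        _ = ∑ u : D.U, mass μ (D.p * (n + 1)) (u : B.Vertex) +
            D.N * (K * ∑ u : D.U, mass μ (D.p * (n + 1 + 1)) (u : B.Vertex)) := by ring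
        _ ≤ _ := by gcongr; exact ih (n + 1)
  by_contra hne
  have h0 : ∑ u : D.U, mass μ (D.p * (n + 1)) (u : B.Vertex) ≠ 0 := by
    obtain ⟨u, hu⟩ := H.nonempty
    intro h0
    exact ((H.mem_U_iff (n + 1) u).1 hu).1 (Finset.sum_eq_zero_iff.1 h0 ⟨u, hu⟩ (Finset.mem_univ _))
  obtain ⟨K, hK⟩ := ENNReal.exists_nat_mul_gt h0 hne
  exact absurd (hle K n) hK.not_ge

theorem towerMeasure_cyl_inr {n : ℕ} {y : D.diagram.PathSpace} {j : Fin D.i}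
    (hy : vtx y n = .inr j) : D.towerMeasure μ (cyl y n) = ⊤ := by
  rw [H.invariant_towerMeasure.measure_cyl, hy, H.mass_inr]

theorem towerMeasure_univ : D.towerMeasure μ univ = ⊤ :=
  measure_mono_top (subset_univ _)
    (H.towerMeasure_cyl_inr (vtx_pathThrough (B := D.diagram) 0 (.inr ⟨0, D.i_pos⟩)))

theorem towerMeasure_singleton (y : D.diagram.PathSpace) : D.towerMeasure μ {y} = 0 := by
  by_cases hy : ∃ n, ∃ u : D.U, vtx y n = .inl u
  · obtain ⟨n, u, hu⟩ := hy
    have hx := vtx_pathThrough (B := B) (D.p * n) u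
    rw [towerMeasure_apply H.invariant hu hx (measurableSet_singleton y)
      (singleton_subset_iff.2 (mem_cyl_self y n))]
    set Q := cyl (pathThrough (D.p * n) (u : B.Vertex)) (D.p * n) ∩ D.staySet n ∩ encode n y ⁻¹' {y}
    rcases Q.eq_empty_or_nonempty with h0 | ⟨z, hz⟩
    · rw [h0, measure_empty]
    refine measure_mono_null (t := {z}) (fun z' hz' => ?_) (H.nonatomic z)
    have hd := mem_encodeDomain hu hx hz.1.1 hz.1.2
    have hd' := mem_encodeDomain hu hx hz'.1.1 hz'.1.2
    have he : encode n y z' = encode n y z := hz'.2.trans hz.2.symm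
    rw [← iInter_cyl]
    refine mem_iInter.2 fun L => ?_
    refine cyl_anti z (Nat.le_mul_of_pos_left L D.p_pos)
      (mem_cyl_of_encode_mem_cyl hd hd' ?_ (by rw [he]; exact mem_cyl_self _ _))
    rw [cyl_eq_of_mem hz.1.1]; exact hz'.1.1
  · exact measure_mono_null (singleton_subset_iff.2 hy) (ae_iff.1 ae_exists_inl)

theorem isNonDefective_towerMeasure : IsNonDefective (D.towerMeasure μ) where
  full U hU := by
    rintro ⟨y, hy⟩
    obtain ⟨n, hn⟩ := exists_cyl_subset (hU.mem_nhds hy)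
    refine lt_of_lt_of_le ?_ (measure_mono hn)
    cases hv : vtx y n with
    | inl u =>
      rw [H.towerMeasure_cyl hv]
      exact pos_iff_ne_zero.2 ((H.mem_U_iff n u).1 u.2).1
    | inr j => rw [H.towerMeasure_cyl_inr hv]; exact ENNReal.zero_lt_top
  nonatomic := H.towerMeasure_singleton
  infinite := H.towerMeasure_univ
  defective_null := by
    refine measure_mono_null (fun y hy => ?_) (ae_iff.1 (ae_exists_inl (D := D) (μ := μ)))
    rintro ⟨n, u, hu⟩
    have := hy _ (isClopen_cyl y n) (mem_cyl_self y n)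
    rw [H.towerMeasure_cyl hu] at this
    exact ((H.mem_U_iff n u).1 u.2).2 this

theorem mass_mem_clopenValues (n : ℕ) (u : D.U) :
    mass μ (D.p * n) (u : B.Vertex) ∈ clopenValues μ :=
  ⟨((H.mem_U_iff n u).1 u.2).2, _, isClopen_cyl _ _, rfl⟩

theorem exists_subset_cyl {n : ℕ} {y : D.diagram.PathSpace} {u : D.U} (hy : vtx y n = .inl u)
    {a : ENNReal} (ha : a ∈ clopenValues μ) (hle : a ≤ D.towerMeasure μ (cyl y n)) :
    ∃ W, IsClopen W ∧ W ⊆ cyl y n ∧ D.towerMeasure μ W = a := by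
  rcases hle.eq_or_lt with rfl | hlt
  · exact ⟨_, isClopen_cyl y n, subset_rfl, rfl⟩
  set x : B.PathSpace := pathThrough (D.p * n) (u : B.Vertex)
  have hx : vtx x (D.p * n) = u := vtx_pathThrough _ _
  obtain ⟨-, A, hA, rfl⟩ := ha
  rw [H.towerMeasure_cyl hy] at hlt
  obtain ⟨V, hV, hVx, hVA⟩ := H.good _ (isClopen_cyl x (D.p * n)) A hA hlt
  obtain ⟨M, hM⟩ := exists_level_of_isClopen hV
  have hL := hM (D.p * max M n) ((le_max_left M n).trans (Nat.le_mul_of_pos_left _ D.p_pos))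
  set L := max M n
  -- Membership in `V` is decided at level `p * L`, hence by the first `L` code edges. So `W`, the
  -- union of the code cylinders met by `V`, pulls back to `V` up to a null set.
  let W : Set D.diagram.PathSpace := {y' | y' ∈ cyl y n ∧
    ∃ z ∈ cyl x (D.p * n) ∩ D.staySet n ∩ V, encode n y z ∈ cyl y' L}
  have hW : IsClopen W := isClopen_of_cyl L fun y' hy' y'' hy'' =>
    ⟨cyl_subset_of_mem hy'.1 (le_max_right M n) hy'', by
      rw [cyl_eq_of_mem hy'']; exact hy'.2⟩
  refine ⟨W, hW, fun y' hy' => hy'.1, ?_⟩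
  rw [towerMeasure_apply H.invariant hy hx hW.measurableSet_borel fun y' hy' => hy'.1]
  have : cyl x (D.p * n) ∩ D.staySet n ∩ encode n y ⁻¹' W =
      cyl x (D.p * n) ∩ D.staySet n ∩ V := by
    ext z
    refine and_congr_right fun hz => ⟨?_, fun hzV => ?_⟩
    · rintro ⟨-, z', hz', he⟩
      have hd := mem_encodeDomain hy hx hz.1 hz.2
      have hd' := mem_encodeDomain hy hx hz'.1.1 hz'.1.2
      refine hL z' hz'.2 (mem_cyl_of_encode_mem_cyl hd' hd ?_ (mem_cyl_symm he))
      rw [cyl_eq_of_mem hz'.1.1]; exact hz.1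
    · exact ⟨encode_mem_cyl _ _ _, z, ⟨hz, hzV⟩, mem_cyl_self _ _⟩
  rw [this, H.measure_inter_staySet (by rw [hx]; exact u.2), inter_eq_right.2 hVx, hVA]

theorem add_mem {a b : ENNReal} (ha : a ∈ clopenValues μ) (hb : b ∈ clopenValues μ) :
    a + b ∈ clopenValues μ := add_mem_clopenValues H.good H.infinite ha hb

theorem biUnion_mem_clopenValues {n : ℕ} (t : Finset D.diagram.PathSpace)
    (ht : ∀ y ∈ t, ∃ u : D.U, vtx y n = .inl u) :
    D.towerMeasure μ (⋃ y ∈ t, cyl y n) ∈ clopenValues μ :=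
  measure_biUnion_cyl_mem zero_mem_clopenValues (fun _ ha _ hb => H.add_mem ha hb) t fun y hy => by
    obtain ⟨u, hu⟩ := ht y hy
    rw [H.towerMeasure_cyl hu]
    exact H.mass_mem_clopenValues n u

/-- Cylinders are filled greedily: if `a` exceeds the mass of the first one, that cylinder is used
entirely and the difference, again a clopen value by goodness of `μ`, is realised in the rest. -/
theorem exists_subset_biUnion {n : ℕ} (t : Finset D.diagram.PathSpace)
    (ht : ∀ y ∈ t, ∃ u : D.U, vtx y n = .inl u) {a : ENNReal} (ha : a ∈ clopenValues μ)
    (hlt : a < D.towerMeasure μ (⋃ y ∈ t, cyl y n)) :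
    ∃ W, IsClopen W ∧ W ⊆ (⋃ y ∈ t, cyl y n) ∧ D.towerMeasure μ W = a := by
  classical
  induction t using Finset.induction_on generalizing a with
  | empty => simp at hlt
  | insert y t hy ih =>
    have ht' := fun z hz => ht z (Finset.mem_insert_of_mem hz)
    obtain ⟨u, hu⟩ := ht y (Finset.mem_insert_self y t)
    rw [Finset.set_biUnion_insert] at hlt ⊢
    rcases le_or_gt a (D.towerMeasure μ (cyl y n)) with hle | hgt
    · obtain ⟨W, hW, hWy, hWa⟩ := H.exists_subset_cyl hu ha hle
      exact ⟨W, hW, hWy.trans subset_union_left, hWa⟩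
    by_cases hmem : y ∈ ⋃ z ∈ t, cyl z n
    · obtain ⟨z, hz, hyz⟩ := mem_iUnion₂.1 hmem
      have hsub : cyl y n ⊆ ⋃ z ∈ t, cyl z n := by
        rw [cyl_eq_of_mem hyz]
        exact subset_biUnion_of_mem (u := fun y => cyl y n) (Finset.mem_coe.2 hz)
      rw [union_eq_right.2 hsub] at hlt ⊢
      exact ih ht' ha hlt
    have hdisj : Disjoint (cyl y n) (⋃ z ∈ t, cyl z n) := by
      rw [disjoint_iUnion₂_right]
      exact fun z hz => (disjoint_cyl fun h => hmem (mem_iUnion₂.2 ⟨z, hz, h⟩)).symm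
    have hcyl : D.towerMeasure μ (cyl y n) ∈ clopenValues μ := by
      rw [H.towerMeasure_cyl hu]; exact H.mass_mem_clopenValues n u
    rw [measure_union hdisj (t.measurableSet_biUnion fun y _ => measurableSet_cyl y n)] at hlt
    obtain ⟨W, hW, hWt, hWa⟩ := ih ht' (sub_mem_clopenValues H.good hcyl ha hgt)
      (ENNReal.sub_lt_of_lt_add hgt.le (by rwa [add_comm]))
    refine ⟨cyl y n ∪ W, (isClopen_cyl y n).union hW, union_subset_union_right _ hWt, ?_⟩
    rw [measure_union (hdisj.mono_right hWt) hW.measurableSet_borel, hWa,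
      add_tsub_cancel_of_le hgt.le]

theorem mem_clopenValues_of_isClopen {V : Set D.diagram.PathSpace} (hV : IsClopen V)
    (hfin : D.towerMeasure μ V ≠ ⊤) : D.towerMeasure μ V ∈ clopenValues μ := by
  obtain ⟨n, hn⟩ := exists_level_of_isClopen hV
  obtain ⟨t, ht, htV⟩ := exists_finset_cyl (hn n le_rfl)
  rw [htV]
  refine H.biUnion_mem_clopenValues t fun y hy => ?_
  cases hv : vtx y n with
  | inl u => exact ⟨u, rfl⟩
  | inr j =>
    exact absurd (measure_mono_top (hn n le_rfl y (ht y hy)) (H.towerMeasure_cyl_inr hv)) hfin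

theorem isGoodClopen_towerMeasure {V : Set D.diagram.PathSpace} (hV : IsClopen V) :
    IsGoodClopen (D.towerMeasure μ) V := by
  intro A hA hlt
  have ha := H.mem_clopenValues_of_isClopen hA hlt.ne_top
  -- `V` may contain cylinders at added vertices, of infinite mass. The clopen sets `S L` exhaust it
  -- up to a null set, so one of them already has measure above the required value, and it is a
  -- finite union of cylinders ending in `U`.
  let S : ℕ → Set D.diagram.PathSpace := fun L => V ∩ {y | ∃ u : D.U, vtx y L = .inl u}
  have hmono : Monotone S := fun L L' hL y hy =>
    ⟨hy.1, let ⟨_, hu⟩ := hy.2; exists_inl_of_le hL hu⟩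
  have hVS : D.towerMeasure μ V = ⨆ L, D.towerMeasure μ (S L) := by
    rw [← hmono.measure_iUnion]
    refine measure_congr ?_
    filter_upwards [ae_exists_inl (D := D) (μ := μ)] with y ⟨n, hn⟩
    exact propext ⟨fun hy => mem_iUnion.2 ⟨n, hy, hn⟩, fun hy => (mem_iUnion.1 hy).choose_spec.1⟩
  rw [hVS, lt_iSup_iff] at hlt
  obtain ⟨L, hL⟩ := hlt
  obtain ⟨n, hn⟩ := exists_level_of_isClopen hV
  have hlev : ∀ y ∈ S (max n L), cyl y (max n L) ⊆ S (max n L) := fun y hy z hz =>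
    ⟨hn _ (le_max_left n L) y hy.1 hz, by
      rw [mem_ofPred_eq, vtx_eq_of_mem hz]; exact hy.2⟩
  obtain ⟨t, ht, htV⟩ := exists_finset_cyl hlev
  have hL' := hL.trans_le (measure_mono (hmono (le_max_right n L)))
  rw [htV] at hL'
  obtain ⟨W, hW, hWt, hWa⟩ := H.exists_subset_biUnion t (fun y hy => (ht y hy).2) ha hL'
  rw [← htV] at hWt
  exact ⟨W, hW, hWt.trans inter_subset_left, hWa⟩

theorem isGoodInfiniteMeasure_towerMeasure : IsGoodInfiniteMeasure (D.towerMeasure μ) :=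
  ⟨H.isNonDefective_towerMeasure, fun _ hV => H.isGoodClopen_towerMeasure hV⟩

theorem splitsInfinite_towerMeasure : SplitsInfinite (D.towerMeasure μ) :=
  H.invariant_towerMeasure.splitsInfinite H.towerMeasure_singleton

/-- A clopen set of finite measure splits into cylinders that end in `U` or, on the side of `μ`, may
be null; the two sides assign the same masses to vertices of `U`. Goodness makes both value sets
closed under addition. -/
theorem clopenValues_eq : clopenValues (D.towerMeasure μ) = clopenValues μ := by
  refine Set.Subset.antisymm ?_ ?_
  · rintro _ ⟨ha, A, hA, rfl⟩
    exact H.mem_clopenValues_of_isClopen hA ha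
  · rintro _ ⟨ha, A, hA, rfl⟩
    obtain ⟨n, hn⟩ := exists_level_of_isClopen hA
    obtain ⟨t, ht, htA⟩ := exists_finset_cyl (hn (D.p * n) (Nat.le_mul_of_pos_left _ D.p_pos))
    rw [htA]
    refine measure_biUnion_cyl_mem zero_mem_clopenValues (fun _ ha _ hb => add_mem_clopenValues
      (fun _ hV => H.isGoodClopen_towerMeasure hV) H.towerMeasure_univ ha hb) t fun x hx => ?_
    rw [H.invariant.measure_cyl]
    by_cases h0 : mass μ (D.p * n) (vtx x (D.p * n)) = 0
    · rw [h0]; exact zero_mem_clopenValues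
    have hfin : mass μ (D.p * n) (vtx x (D.p * n)) ≠ ⊤ := by
      rw [← H.invariant.measure_cyl]
      refine ((measure_mono ?_).trans_lt ha.lt_top).ne
      exact hn _ (Nat.le_mul_of_pos_left _ D.p_pos) x (ht x hx)
    rw [← H.mass_inl n ⟨_, (H.mem_U_iff n _).2 ⟨h0, hfin⟩⟩]
    exact ⟨by rw [H.mass_inl]; exact hfin, _, isClopen_cyl _ _, rfl⟩

end IsAdapted

end TowerData

/-! ### Measures on their supports -/

section OnSupport

variable {μ : Measure B.PathSpace}

theorem onSupport_apply (A : Set μ.support) : onSupport μ A = μ (Subtype.val '' A) :=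
  (MeasurableEmbedding.subtype_coe Measure.isClosed_support.measurableSet).comap_apply μ A

theorem onSupport_preimage (A : Set B.PathSpace) :
    onSupport μ (Subtype.val ⁻¹' A) = μ A := by
  rw [onSupport_apply, Subtype.image_preimage_coe, inter_comm]
  exact measure_inter_conull Measure.measure_compl_support

theorem exists_isClopen_preimage {S : Set μ.support} (hS : IsClopen S) :
    ∃ A : Set B.PathSpace, IsClopen A ∧ Subtype.val ⁻¹' A = S := by
  have hemb := (Measure.isClosed_support (μ := μ)).isClosedEmbedding_subtypeVal
  obtain ⟨A, hA, hSA, hAS⟩ := exists_clopen_of_closed_subset_open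
    (hemb.isClosedMap S hS.1) (hemb.isClosedMap Sᶜ hS.compl.1).isOpen_compl (by
      rintro _ ⟨x, hx, rfl⟩ ⟨y, hy, hxy⟩
      exact hy (by rwa [Subtype.ext hxy]))
  refine ⟨A, hA, Subset.antisymm (fun x hx => ?_) fun x hx => hSA ⟨x, hx, rfl⟩⟩
  by_contra hxS
  exact hAS hx ⟨x, hxS, rfl⟩

variable (h : IsGoodInfiniteMeasure (onSupport μ))
include h

theorem measure_singleton_of_onSupport (x : B.PathSpace) : μ {x} = 0 := by
  by_cases hx : x ∈ μ.support
  · have := h.nonDefective.nonatomic ⟨x, hx⟩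
    rwa [onSupport_apply, image_singleton] at this
  · exact measure_mono_null (singleton_subset_iff.2 hx) Measure.measure_compl_support

theorem measure_univ_of_onSupport : μ univ = ⊤ := by
  rw [← onSupport_preimage (μ := μ), preimage_univ]; exact h.nonDefective.infinite

theorem isGoodClopen_of_onSupport {V : Set B.PathSpace} (hV : IsClopen V) : IsGoodClopen μ V := by
  intro A hA hlt
  rw [← onSupport_preimage (μ := μ), ← onSupport_preimage (μ := μ)] at hlt
  obtain ⟨W, hW, hWV, hWA⟩ := h.good _ (hV.preimage continuous_subtype_val) _
    (hA.preimage continuous_subtype_val) hlt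
  obtain ⟨W', hW', rfl⟩ := exists_isClopen_preimage hW
  refine ⟨W' ∩ V, hW'.inter hV, inter_subset_right, ?_⟩
  rw [← onSupport_preimage (μ := μ), preimage_inter, inter_eq_left.2 hWV, hWA, onSupport_preimage]

/-- Otherwise every cylinder at the levels indexed by multiples of `p` that meets the support has
infinite measure. Then every point of the support is defective, so the defective set would be both
null and of infinite measure. -/
theorem exists_mass_ne (hinv : B.IsTailInvariant μ) {p : ℕ} (hp : 0 < p)
    (hper : ∀ n v, (mass μ (p * n) v = 0 ↔ mass μ 0 v = 0) ∧
      (mass μ (p * n) v = ⊤ ↔ mass μ 0 v = ⊤)) : ∃ v, mass μ 0 v ≠ 0 ∧ mass μ 0 v ≠ ⊤ := by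
  by_contra! hcon
  have hdef : defectiveSet (onSupport μ) = univ := by
    refine eq_univ_of_forall fun x U hU hxU => ?_
    obtain ⟨A, hA, rfl⟩ := exists_isClopen_preimage hU
    rw [onSupport_preimage]
    obtain ⟨N, hN⟩ := exists_level_of_isClopen hA
    refine measure_mono_top (hN (p * N) (Nat.le_mul_of_pos_left N hp) x hxU) ?_
    have hpos : 0 < μ (cyl x (p * N)) :=
      (Measure.mem_support_iff_forall x.1).1 x.2 _ (cyl_mem_nhds x.1 _)
    rw [hinv.measure_cyl] at hpos ⊢
    exact (hper N _).2.2 (hcon _ fun h0 => hpos.ne' ((hper N _).1.2 h0))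
  have := h.nonDefective.defective_null
  rw [hdef, h.nonDefective.infinite] at this
  exact ENNReal.top_ne_zero this

omit h in
theorem splitsInfinite_onSupport (hs : SplitsInfinite μ) : SplitsInfinite (onSupport μ) := by
  intro A hA htop
  obtain ⟨A, hA', rfl⟩ := exists_isClopen_preimage hA
  rw [onSupport_preimage] at htop
  obtain ⟨T, hT, hTA, h1, h2⟩ := hs A hA' htop
  exact ⟨Subtype.val ⁻¹' T, hT.preimage continuous_subtype_val, preimage_mono hTA,
    by rw [onSupport_preimage, h1], by rw [← preimage_sdiff, onSupport_preimage, h2]⟩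

omit h in
theorem clopenValues_onSupport : clopenValues (onSupport μ) = clopenValues μ := by
  ext a
  refine and_congr_right fun _ => ⟨?_, ?_⟩
  · rintro ⟨A, hA, rfl⟩
    obtain ⟨A, hA', rfl⟩ := exists_isClopen_preimage hA
    exact ⟨A, hA', (onSupport_preimage A).symm⟩
  · rintro ⟨A, hA, rfl⟩
    exact ⟨_, hA.preimage continuous_subtype_val, onSupport_preimage A⟩

end OnSupport

/-! ### The construction for the given measure -/

theorem IsTailInvariant.exists_block {μ : Measure B.PathSpace} (h : B.IsTailInvariant μ) {p : ℕ}
    (hper : ∀ n v, (mass μ (p * n) v = 0 ↔ mass μ 0 v = 0) ∧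
      (mass μ (p * n) v = ⊤ ↔ mass μ 0 v = ⊤)) {u : B.Vertex} (h0 : mass μ 0 u ≠ 0)
    (htop : mass μ 0 u ≠ ⊤) :
    ∃ w, (mass μ 0 w ≠ 0 ∧ mass μ 0 w ≠ ⊤) ∧ Nonempty (B.Block p u w) := by
  classical
  have hsum := h.mass_eq_pow 0 p u
  rw [hsum] at h0 htop
  -- A non-zero term of a finite sum belongs to a vertex that is reached in `p` steps and whose mass
  -- is positive and finite.
  obtain ⟨w, -, hw⟩ := Finset.exists_ne_zero_of_sum_ne_zero h0
  have hw' := ENNReal.sum_ne_top.1 htop w (Finset.mem_univ w)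
  have hpos := left_ne_zero_of_mul hw
  have hmass : mass μ (p * 1) w ≠ 0 := by simpa using right_ne_zero_of_mul hw
  have hmass' : mass μ (p * 1) w ≠ ⊤ := fun ht => hw' (by
    rw [mul_one] at ht
    rw [zero_add, ht, ENNReal.mul_top hpos])
  refine ⟨w, ⟨fun h => hmass ((hper 1 w).1.2 h), fun h => hmass' ((hper 1 w).2.2 h)⟩, ?_⟩
  obtain ⟨z, hz, hzw⟩ := exists_of_pow_pos (n := 0) (x := pathThrough 0 u) (k := p) (w := w) (by
    rw [vtx_pathThrough]
    exact Nat.pos_of_ne_zero fun h => hpos (by rw [h, Nat.cast_zero]))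
  exact ⟨⟨blockOf p z 0, z, 0, by rw [mul_zero, vtx_eq_of_mem hz, vtx_pathThrough],
    by rw [← hzw, zero_add, mul_one, zero_add], rfl⟩⟩

end StationaryBratteliDiagram

open StationaryBratteliDiagram in
theorem mainTheorem11 (B : StationaryBratteliDiagram) (μ : Measure B.PathSpace)
    (hinv : B.IsTailInvariant μ) (herg : B.IsTailErgodic μ)
    (hgood : IsGoodInfiniteMeasure (onSupport μ)) :
    ∃ (C : ℕ+ → StationaryBratteliDiagram) (ν : ∀ i, Measure (C i).PathSpace),
      (∀ i, (C i).IsTailInvariant (ν i) ∧ (C i).IsTailErgodic (ν i) ∧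
        IsGoodInfiniteMeasure (ν i) ∧ HomeomorphicMeasures (onSupport μ) (ν i)) ∧
      (∀ i j, (C i).OrbitEquivalent (C j) ↔ i = j) ∧
      (∀ i, {Z | (C i).IsMinimalComponent Z}.encard = ((i : ℕ) : ℕ∞)) := by
  classical
  obtain ⟨p, hp, hper⟩ := hinv.exists_period
  let U : Set B.Vertex := {v | mass μ 0 v ≠ 0 ∧ mass μ 0 v ≠ ⊤}
  let _ : Fintype U := Fintype.ofFinite U
  let D : ℕ+ → B.TowerData := fun i =>
    { p := p
      p_pos := hp
      U := U
      exists_block := fun u hu => hinv.exists_block hper hu.1 hu.2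
      -- The total number of blocks dominates every column sum, which is what makes the added
      -- vertices infinite.
      N := 2 + ∑ w : U, ∑ u : U, Nat.card (B.Block p u w)
      two_le := Nat.le_add_right _ _
      i := i
      i_pos := i.pos }
  have hD : ∀ i, (D i).IsAdapted μ := fun i =>
    { invariant := hinv
      mem_U_iff := fun n v => by
        change (mass μ 0 v ≠ 0 ∧ mass μ 0 v ≠ ⊤) ↔ mass μ (p * n) v ≠ 0 ∧ mass μ (p * n) v ≠ ⊤
        rw [Ne, Ne, Ne, Ne, (hper n v).1, (hper n v).2]
      nonempty := exists_mass_ne hgood hinv hp hper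
      nonatomic := measure_singleton_of_onSupport hgood
      infinite := measure_univ_of_onSupport hgood
      good := fun V hV => isGoodClopen_of_onSupport hgood hV
      loops := fun w => (Finset.single_le_sum
        (f := fun w : U => ∑ u : U, Nat.card (B.Block p u w)) (fun _ _ => Nat.zero_le _)
        (Finset.mem_univ w)).trans (Nat.le_add_left _ _) }
  have hvals : ∀ i, clopenValues (onSupport μ) = clopenValues ((D i).towerMeasure μ) := fun i =>
    clopenValues_onSupport.trans (hD i).clopenValues_eq.symm
  have : CompactSpace μ.support :=
    isCompact_iff_compactSpace.1 Measure.isClosed_support.isCompact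
  have hencard : ∀ i, {Z | (D i).diagram.IsMinimalComponent Z}.encard = ((i : ℕ) : ℕ∞) :=
    fun i => TowerData.encard_minimalComponents
  refine ⟨fun i => (D i).diagram, fun i => (D i).towerMeasure μ, fun i =>
    ⟨(hD i).invariant_towerMeasure, TowerData.isTailErgodic_towerMeasure herg,
      (hD i).isGoodInfiniteMeasure_towerMeasure, ?_⟩, fun i j => ⟨fun h => ?_, ?_⟩, hencard⟩
  · refine homeomorphicMeasures_of_clopenValues hgood (hD i).isGoodInfiniteMeasure_towerMeasure
      (fun A hA hfin => ?_) (fun A hA hfin => ?_)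
      (splitsInfinite_onSupport (hinv.splitsInfinite (measure_singleton_of_onSupport hgood)))
      (hD i).splitsInfinite_towerMeasure
    · have : onSupport μ A ∈ clopenValues (onSupport μ) := ⟨hfin, A, hA, rfl⟩
      rw [hvals i] at this
      exact this.2
    · have : (D i).towerMeasure μ A ∈ clopenValues ((D i).towerMeasure μ) := ⟨hfin, A, hA, rfl⟩
      rw [← hvals i] at this
      exact this.2
  -- Orbit equivalent diagrams have equally many minimal components, and the counts are `i` and `j`.
  · have := h.encard_eq
    rw [hencard, hencard] at this
    exact PNat.coe_injective (by exact_mod_cast this)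
  · rintro rfl
    exact OrbitEquivalent.refl _
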